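/- **Definitions.** A family on a set $I$ is a set $\mathcal F$ of finite subsets of $I$; it is hereditary if closed under subsets and compact if it is closed in $2^I$. For a nonempty compact family, $\mathrm{rk}(\mathcal F)$ is the ordinal $\rho$ such that $\rho+1$ is the Cantor–Bendixson rank of $\mathcal F$. For $A\subseteq I$ let $\mathcal F\upharpoonright A=\{s\in\mathcal F: s\subseteq A\}$, and let $\mathrm{srk}(\mathcal F)=\min\{\mathrm{rk}(\mathcal F\upharpoonright C): C\subseteq I\text{ infinite}\}$. An ordinal $\lambda\ge\omega$ is exp-indecomposable if $\beta^\gamma<\lambda$ for all $\beta,\gamma<\lambda$; $\iota(\alpha)$ is the least exp-indecomposable ordinal $>\alpha$. A compact hereditary family $\mathcal F$ on $I$ is homogeneous if $\mathcal F=\{\emptyset\}$, or $[I]^{\le1}\subseteq\mathcal F$ and $1\le\mathrm{srk}(\mathcal F)\le\mathrm{rk}(\mathcal F)<\iota(\mathrm{srk}(\mathcal F))$ with $\mathrm{srk}(\mathcal F)<\omega_1$. For a family $\mathcal F$ on $M\subseteq\omega$ and $n\in M$ let $\mathcal F_{\{n\}}=\{s: n<\min s,\ \{n\}\cup s\in\mathcal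 F\}$ (with $\emptyset$ allowed as $s$) and $M/n=\{m\in M:m>n\}$. $\mathcal F$ is $0$-uniform on $M$ if $\mathcal F=\{\emptyset\}$; it is $(\beta+1)$-uniform on $M$ if $\emptyset\in\mathcal F$ and each $\mathcal F_{\{n\}}$, $n\in M$, is $\beta$-uniform on $M/n$; for $\alpha$ limit it is $\alpha$-uniform on $M$ if $\emptyset\in\mathcal F$ and each $\mathcal F_{\{n\}}$ is $\alpha_n$-uniform on $M/n$ for some non-decreasing $(\alpha_n)_{n\in M}$ of ordinals $<\alpha$ with supremum $\alpha$. A family on $\omega$ is spreading if $\{m_0<\dots<m_k\}\in\mathcal F$ and $m_i\le n_i$, $n_0<\dots<n_k$, imply $\{n_0,\dots,n_k\}\in\mathcal F$. Let $\mathfrak S$ be the set of all hereditary, spreading families that are $\alpha$-uniform on $\omega$ for some $\alpha<\omega_1$. A family $\mathcal G$ on $I$ is a multiplication of $\mathcal F$ by $\mathcal H\in\mathfrak S$ if $\mathcal G$ is homogeneous, $\iota(\mathrm{srk}(\mathcal G))=\iota(\mathrm{srk}(\mathcal F)\cdot\mathrm{srk}(\mathcal H))$, and every sequence in $\mathcal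 F$ has a subsequence $(t_n)_n$ with $\bigcup_{n\in x}t_n\in\mathcal G$ for all $x\in\mathcal H$. A basis of families on an infinite set $I$ is a pair $(\mathfrak B,\times)$ such that: (B.1) $\mathfrak B$ consists of homogeneous families on $I$, contains $[I]^{\le n}$ for every $n<\omega$, and for each $\omega\le\alpha<\omega_1$ contains some $\mathcal F$ with $\mathrm{srk}(\mathcal F)=\alpha$; (B.2) $\mathfrak B$ is closed under $\mathcal F\cup\mathcal G$ and $\mathcal F\sqcup\mathcal G=\{s\cup t:s\in\mathcal F,t\in\mathcal G\}$, and if $\mathcal F\subseteq\mathcal G\in\mathfrak B$ is homogeneous with $\iota(\mathrm{srk}(\mathcal F))=\iota(\mathrm{srk}(\mathcal G))$ then $\mathcal F\in\mathfrak B$; (B.3) $\times:\mathfrak B\times\mathfrak S\to\mathfrak B$ and $\mathcal F\times\mathcal H$ is always a multiplication of $\mathcal F$ by $\mathcal H$. Fix a Schreier sequence $(\mathcal S_\alpha)_{\alpha<\omega_1}$: $\mathcal S_0=[\omega]^{\le1}$; $\mathcal S_{\alpha+1}$ is the set of all $\bigcup_{i<n}s_i$ with nonempty $s_i\in\mathcal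 S_\alpha$, $s_0<\dots<s_{n-1}$ and $n\le\min s_0$ (including $\emptyset$, for $n=0$); and for $\alpha$ limit $\mathcal S_\alpha=\bigcup_n(\mathcal S_{\alpha_n}\upharpoonright\{m: m\ge n\})$ for some ordinals $\alpha_n<\alpha$ with $\sup_n\alpha_n=\alpha$. A bounded sequence $(x_n)$ in a real normed space is an $\ell_1^\alpha$-spreading model if there is $C>0$ with $\|\sum_{n\in s}a_nx_n\|\ge C\sum_{n\in s}|a_n|$ for all $s\in\mathcal S_\alpha$ and all scalars. A non-constant sequence $(x_n)$ is subsymmetric if there is $C\ge1$ with $\|\sum_{i\le n}a_ix_{l_i}\|\le C\|\sum_{i\le n}a_ix_{k_i}\|$ for all $n$, all scalars, and all $l_1<\dots<l_n$, $k_1<\dots<k_n$. **Theorem.** Suppose that the cardinal $\kappa$ has a basis of families. Then for every $1\le\alpha<\omega_1$ there is a reflexive real Banach space $\mathfrak X_\alpha$ of density $\kappa$ with a long unconditional basis $(u_\xi)_{\xi<\kappa}$ such that (a) every bounded sequence in $\mathfrak X_\alpha$ without norm-convergent subsequences has a subsequence that is an $\ell_1^\alpha$-spreading model; (b) no sequence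 in $\mathfrak X_\alpha$ is an $\ell_1^{\iota(\omega^\alpha)+\alpha\cdot\omega}$-spreading model; (c) $\mathfrak X_\alpha$ has no subsymmetric sequences; (d) if $1\le\alpha<\omega_1$ and $\iota(\omega^\alpha)+\alpha\cdot\omega\le\beta<\omega_1$, then $\mathfrak X_\alpha$ and $\mathfrak X_\beta$ are totally incomparable: no infinite-dimensional subspace of $\mathfrak X_\alpha$ is isomorphic to a subspace of $\mathfrak X_\beta$. -/

import Mathlib

open Set Filter Topology
open scoped Ordinal Cardinal

universe u

noncomputable section

namespace LongTsirelson

/-! ### Families of finite sets, their topology and their ranks -/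

/-- The restriction `F ↾ A` of a family of finite sets. -/
def restrict {I : Type u} (F : Set (Finset I)) (A : Set I) : Set (Finset I) :=
  {s | s ∈ F ∧ (s : Set I) ⊆ A}

/-- Closed under subsets. -/
def IsHereditary {I : Type u} (F : Set (Finset I)) : Prop :=
  ∀ s ∈ F, ∀ t, t ⊆ s → t ∈ F

/-- The family `F`, seen as a subset of the product space `2^I` through characteristic functions. -/
def charSet {I : Type u} (F : Set (Finset I)) : Set (I → Bool) :=
  (fun s : Finset I => (s : Set I).boolIndicator) '' F

/-- A family is compact if it is a closed subset of `2^I`. -/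
def IsCompactFamily {I : Type u} (F : Set (Finset I)) : Prop :=
  IsClosed (charSet F)

/-- Cantor-Bendixson rank: the least `α` with `X^(α+1) = X^(α)`. -/
def cbRank {X : Type u} [TopologicalSpace X] (A : Set X) : Ordinal.{u} :=
  sInf {α | CantorBendixson.iteratedDerivedSet A (α + 1) = CantorBendixson.iteratedDerivedSet A α}

/-- The rank of a compact family: the predecessor of its Cantor-Bendixson rank (which is a
successor ordinal when the family is compact and nonempty). -/
def rk {I : Type u} (F : Set (Finset I)) : Ordinal.{u} :=
  (cbRank (charSet F)).pred

/-- The small rank of a family relative to a partial order: the infimum of the ranks of its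
restrictions to infinite chains. -/
def srk {P : Type u} [PartialOrder P] (F : Set (Finset P)) : Ordinal.{u} :=
  sInf {ρ | ∃ C : Set P, C.Infinite ∧ IsChain (· ≤ ·) C ∧ ρ = rk (restrict F C)}

/-- Exponentially indecomposable ordinals; the first one is `ω`. -/
def IsExpIndecomposable (l : Ordinal.{u}) : Prop :=
  ω ≤ l ∧ ∀ β < l, ∀ γ < l, β ^ γ < l

/-- `ι(α)` is the least exponentially indecomposable ordinal above `α`. -/
def iota (α : Ordinal.{u}) : Ordinal.{u} :=
  sInf {l | α < l ∧ IsExpIndecomposable l}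

/-- Families consisting of (finite) chains of `P`. -/
def IsOnChains {P : Type u} [PartialOrder P] (F : Set (Finset P)) : Prop :=
  ∀ s ∈ F, IsChain (· ≤ ·) (s : Set P)

/-- The cube of all chains of `P` with at most `n` elements. -/
def cube (P : Type u) [PartialOrder P] (n : ℕ) : Set (Finset P) :=
  {s | s.card ≤ n ∧ IsChain (· ≤ ·) (s : Set P)}

/-- `F` is `(α, P)`-homogeneous (`α < ω₁`). -/
def IsHomogeneousOf {P : Type u} [PartialOrder P] (α : Ordinal.{u}) (F : Set (Finset P)) : Prop :=
  IsCompactFamily F ∧ IsHereditary F ∧ IsOnChains F ∧ α < ω_ 1 ∧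
    (α = 0 → F = {∅}) ∧
    (1 ≤ α → cube P 1 ⊆ F ∧ srk F = α ∧ α ≤ rk F ∧ rk F < iota α)

def IsHomogeneous {P : Type u} [PartialOrder P] (F : Set (Finset P)) : Prop :=
  ∃ α, IsHomogeneousOf α F

/-- `F ⊔_P G`: the unions `s ∪ t` that are chains, with `s ∈ F` and `t ∈ G`. -/
def sqUnion {P : Type u} [PartialOrder P] (F G : Set (Finset P)) : Set (Finset P) :=
  {w | IsChain (· ≤ ·) (w : Set P) ∧ ∃ s ∈ F, ∃ t ∈ G, (w : Set P) = (s : Set P) ∪ t}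

/-! ### Families on `ω` -/

/-- `F_{n} = {s : n < s and {n} ∪ s ∈ F}`. -/
def section_ (F : Set (Finset ℕ)) (n : ℕ) : Set (Finset ℕ) :=
  {s | (∀ m ∈ s, n < m) ∧ insert n s ∈ F}

/-- `α`-uniform families on a set `M` of integers. -/
inductive IsUniform : Ordinal.{0} → Set ℕ → Set (Finset ℕ) → Prop
  | zero (M : Set ℕ) : IsUniform 0 M {∅}
  | succ (β : Ordinal.{0}) (M : Set ℕ) (F : Set (Finset ℕ))
      (hM : ∀ s ∈ F, (s : Set ℕ) ⊆ M) (hF : ∅ ∈ F)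
      (h : ∀ n ∈ M, IsUniform β {m | m ∈ M ∧ n < m} (section_ F n)) :
      IsUniform (β + 1) M F
  | limit (α : Ordinal.{0}) (M : Set ℕ) (F : Set (Finset ℕ)) (a : ℕ → Ordinal.{0})
      (hα : Order.IsSuccLimit α)
      (hM : ∀ s ∈ F, (s : Set ℕ) ⊆ M) (hF : ∅ ∈ F)
      (hmono : MonotoneOn a M) (hlt : ∀ n ∈ M, a n < α) (hsup : ∀ β < α, ∃ n ∈ M, β < a n)
      (h : ∀ n ∈ M, IsUniform (a n) {m | m ∈ M ∧ n < m} (section_ F n)) :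
      IsUniform α M F

/-- If `{m₀ < ⋯ < m_{k-1}} ∈ F` and `m_i ≤ n_i` for all `i`, where `n₀ < ⋯ < n_{k-1}`, then
`{n₀ < ⋯ < n_{k-1}} ∈ F`. -/
def IsSpreading (F : Set (Finset ℕ)) : Prop :=
  ∀ (k : ℕ) (m n : Fin k → ℕ), StrictMono m → StrictMono n → (∀ i, m i ≤ n i) →
    Finset.univ.image m ∈ F → Finset.univ.image n ∈ F

/-- The collection `𝔖` of all hereditary, spreading, uniform families on `ω`. -/
def uniformFamilies : Set (Set (Finset ℕ)) :=
  {H | IsHereditary H ∧ IsSpreading H ∧ ∃ α < ω_ 1, IsUniform α univ H}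

/-! ### Bases of families -/

/-- `G` is a multiplication of the family `F` on chains of `P` by the family `H` on `ω`. -/
def IsMultiplication {P : Type u} [PartialOrder P] (F : Set (Finset P)) (H : Set (Finset ℕ))
    (G : Set (Finset P)) : Prop :=
  IsHomogeneous G ∧ iota (srk G) = iota (srk F * Ordinal.lift.{u} (srk H)) ∧
  ∀ s : ℕ → Finset P, (∀ n, s n ∈ F) → IsChain (· ≤ ·) (⋃ n, (s n : Set P)) →
    ∃ φ : ℕ → ℕ, StrictMono φ ∧ ∀ x ∈ H, ∃ w ∈ G, (w : Set P) = ⋃ n ∈ x, (s (φ n) : Set P)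

/-- `(B, mul)` is a basis of homogeneous families on chains of `P`. -/
structure IsBasis {P : Type u} [PartialOrder P] (B : Set (Set (Finset P)))
    (mul : Set (Finset P) → Set (Finset ℕ) → Set (Finset P)) : Prop where
  homogeneous : ∀ F ∈ B, IsHomogeneous F
  cube_mem : ∀ n, cube P n ∈ B
  exists_srk : ∀ α : Ordinal.{u}, ω ≤ α → α < ω_ 1 → ∃ F ∈ B, srk F = α
  union_mem : ∀ F ∈ B, ∀ G ∈ B, F ∪ G ∈ B
  sqUnion_mem : ∀ F ∈ B, ∀ G ∈ B, sqUnion F G ∈ B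
  subset_mem : ∀ F, ∀ G ∈ B, F ⊆ G → IsHomogeneous F → iota (srk F) = iota (srk G) → F ∈ B
  mul_mem : ∀ F ∈ B, ∀ H ∈ uniformFamilies, mul F H ∈ B
  mul_spec : ∀ F ∈ B, ∀ H ∈ uniformFamilies, IsMultiplication F H (mul F H)

/-- The partial order `P` has an infinite chain and a basis of families on its chains. -/
def HasBasis (P : Type u) [PartialOrder P] : Prop :=
  (∃ C : Set P, C.Infinite ∧ IsChain (· ≤ ·) C) ∧
    ∃ (B : Set (Set (Finset P))) (mul : Set (Finset P) → Set (Finset ℕ) → Set (Finset P)),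
      IsBasis B mul

/-- The cardinal `κ`, as the well-ordered set of ordinals below it, has a basis of families. -/
def HasBasisOfFamilies (κ : Cardinal.{u}) : Prop :=
  HasBasis κ.ord.ToType

/-! ### Generalized Schreier families -/

/-- The product `F ⊗ G`: unions of successive nonempty `s₀ < ⋯ < s_{n-1}` in `F` whose set of
minima belongs to `G`. -/
def prodFamily (F G : Set (Finset ℕ)) : Set (Finset ℕ) :=
  {w | ∃ (n : ℕ) (s : Fin n → Finset ℕ) (hs : ∀ i, (s i).Nonempty),
    (∀ i, s i ∈ F) ∧ (∀ i j, i < j → ∀ p ∈ s i, ∀ q ∈ s j, p < q) ∧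
    Finset.univ.image (fun i => (s i).min' (hs i)) ∈ G ∧ w = Finset.univ.biUnion s}

/-- The Schreier family: `#s ≤ min s`. -/
def schreier : Set (Finset ℕ) :=
  {s | ∀ m ∈ s, s.card ≤ m}

/-- `(S_α)_{α < ω₁}` is a Schreier sequence. -/
def IsSchreierSequence (S : Ordinal.{0} → Set (Finset ℕ)) : Prop :=
  S 0 = {s | s.card ≤ 1} ∧
  (∀ α < ω_ 1, S (α + 1) = prodFamily (S α) schreier) ∧
  ∀ α < ω_ 1, Order.IsSuccLimit α →
    ∃ a : ℕ → Ordinal.{0}, (∀ n, a n < α) ∧ (∀ β < α, ∃ n, β < a n) ∧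
      S α = {s | ∃ n, s ∈ S (a n) ∧ ∀ m ∈ s, n ≤ m}

/-! ### Banach space notions -/

/-- A bounded sequence with a lower `ℓ₁` estimate on all members of the family `F`; for
`F = S_α` this is an `ℓ₁^α`-spreading model. -/
def IsL1SpreadingModel (F : Set (Finset ℕ)) {X : Type u} [NormedAddCommGroup X] [NormedSpace ℝ X]
    (x : ℕ → X) : Prop :=
  (∃ K : ℝ, ∀ n, ‖x n‖ ≤ K) ∧
  ∃ C : ℝ, 0 < C ∧ ∀ s ∈ F, ∀ a : ℕ → ℝ, C * ∑ n ∈ s, |a n| ≤ ‖∑ n ∈ s, a n • x n‖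

/-- A non-constant sequence all of whose finite subsequences of the same length are uniformly
equivalent. -/
def IsSubsymmetric {X : Type u} [NormedAddCommGroup X] [NormedSpace ℝ X] (x : ℕ → X) : Prop :=
  (∃ i j, x i ≠ x j) ∧
  ∃ C : ℝ, 1 ≤ C ∧ ∀ (n : ℕ) (a : Fin n → ℝ) (l k : Fin n → ℕ), StrictMono l → StrictMono k →
    ‖∑ i, a i • x (l i)‖ ≤ C * ‖∑ i, a i • x (k i)‖

/-- No subsequence converges in norm. -/
def IsNontrivialSeq {X : Type u} [NormedAddCommGroup X] (x : ℕ → X) : Prop :=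
  ∀ φ : ℕ → ℕ, StrictMono φ → ¬ ∃ y, Tendsto (x ∘ φ) atTop (𝓝 y)

/-- The canonical embedding into the bidual is onto. -/
def IsReflexiveSpace (X : Type u) [NormedAddCommGroup X] [NormedSpace ℝ X] : Prop :=
  Function.Surjective (NormedSpace.inclusionInDoubleDual ℝ X)

/-- The density character: the least cardinality of a dense subset. -/
def densityCharacter (X : Type u) [TopologicalSpace X] : Cardinal.{u} :=
  sInf {c | ∃ D : Set X, Dense D ∧ #D = c}

/-- No infinite-dimensional subspace of `X` is isomorphic to a subspace of `Y`. -/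
def TotallyIncomparable (X Y : Type u) [NormedAddCommGroup X] [NormedSpace ℝ X]
    [NormedAddCommGroup Y] [NormedSpace ℝ Y] : Prop :=
  ∀ (V : Submodule ℝ X) (W : Submodule ℝ Y), ¬ FiniteDimensional ℝ V → IsEmpty (V ≃L[ℝ] W)

end LongTsirelson

end

open LongTsirelson

/-!
The space with index `α` is the completion of the finitely supported functions on `κ` under a norm
of Tsirelson type. Fix a hereditary, spreading, `ω ^ α`-uniform family `H` on `ℕ`, start with a
family `F₀` of the basis with `srk F₀ = ω`, and put `Fₙ₊₁ = Fₙ × H`. Let `qₙ x` be `2⁻ⁿ` times the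
largest `ℓ₁`-sum of `x` over a member of `Fₙ`. The norm of `x` is the norm of the sequence
`(qₙ x)ₙ` in the Tsirelson space whose admissible sets are the members of `H`, computed with the
functionals `TsFunctional`. The unit vectors form an unconditional basis by monotonicity of the
norm. The ordinal `ι(ω ^ α)` is exponentially indecomposable, hence closed under products, so the
ranks of all `Fₙ` stay below it (`exists_isTsirelson`).

*Lower estimates.* Consider disjoint blocks bounded away from zero. If some `qₙ` does not tend to
zero along them, choose members of `Fₙ` on which a subsequence has large `ℓ₁`-sums; by the
multiplication property their unions along members of `H` lie in `Fₙ₊₁` after passing to a further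
subsequence, and `qₙ₊₁` provides a lower `ℓ₁`-estimate on `H` (`C00.exists_lowerEstimate_of_le_q`).
If every `qₙ` tends to zero, a gliding hump produces blocks that live on successive intervals of the
Tsirelson space, and the admissible functionals provide the estimate
(`C00.exists_lowerEstimate_of_q_tendsto`). As `H` has arbitrarily large members, the same estimates
show that the basis is boundedly complete (`C00.exists_forall_norm_cut_le`). A bounded sequence
without Cauchy subsequences is close to a coordinatewise limit plus disjoint blocks, which gives
lower estimates on `H` in general. They pass to `S α`, which has rank `ω ^ α`
(`IsSchreierSequence.secRankLE`) and is carried into `H` by a fast increasing map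
(`exists_strictMono_image_mem`).

*No estimates of large rank.* Suppose that a bounded sequence had a lower `ℓ₁`-estimate on a family
of rank `ι(ω ^ α) * ω ^ (α * ω)`; this includes `S β` for `β ≥ ι(ω ^ α) + α * ω`, of rank `ω ^ β`.
The proof of `C00.not_lowerEstimate` derives a contradiction in four steps.
* Differences of members of the sequence form a well-founded tree of this rank of vectors whose
  convex combinations are bounded below and whose coordinates on any finite set may be taken to be
  zero (`C00.exists_blockTree_farSets`).
* As in Pták's theorem, a tree of rank `ω ^ γ` contains averages that are small on all members of a
  family of rank below `ω ^ γ` (`IsVectorTree.exists_average`). Using up the factor `ι(ω ^ α)`, the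
  vectors of the tree can be replaced by averages on which the first few `qₙ` are small
  (`C00.blockTree_thinSets`).
* James' argument for the non-distortability of `ℓ₁` improves the lower bound to `9 / 10` at the
  cost of finitely many square roots of the rank, for which the factor `ω ^ (α * ω)` leaves room
  (`BlockTree.improve`).
* A tree of rank `ω ^ α + 1` cannot have this constant: averages of its vectors that are small with
  respect to `H` are not additive with the first vector of the tree, as in Tsirelson's space
  (`not_blockTree_thinSets`).

In particular there is no `ℓ₁`-sequence, so the basis is shrinking, and with bounded completeness
the space is reflexive (`Space.isReflexiveSpace`). A subsymmetric sequence would be equivalent to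
the unit vectors of `ℓ₁` by the lower estimates (`Space.not_isSubsymmetric`). A common subspace of
the spaces with indices `α` and `β` would contain a sequence with a lower estimate on `S β`, which
the space with index `α` excludes if `β ≥ ι(ω ^ α) + α * ω`
(`totallyIncomparable_of_lowerEstimate`).
-/

namespace LongTsirelson

/-! ### Exponentially indecomposable ordinals -/

/-- The supremum of the iterates of `x ↦ x ^ x` is exponentially indecomposable. -/
theorem exists_isExpIndecomposable_gt (α : Ordinal.{u}) :
    ∃ l, α < l ∧ IsExpIndecomposable l ∧ (α < ω_ 1 → l < ω_ 1) := by
  let x : ℕ → Ordinal.{u} := fun n => (fun y => y ^ y)^[n] (max (α + 1) ω)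
  have hs : ∀ n, x (n + 1) = x n ^ x n := fun n => Function.iterate_succ_apply' _ _ _
  have hω : ∀ n, ω ≤ x n := by
    intro n
    induction n with
    | zero => exact le_max_right _ _
    | succ n ih =>
      rw [hs]
      exact ih.trans (Ordinal.right_le_opow _ (Ordinal.one_lt_omega0.trans_le ih))
  have hlt : ∀ n, x n < x (n + 1) := by
    intro n
    rw [hs]
    have h1 := Ordinal.one_lt_omega0.trans_le (hω n)
    exact Ordinal.left_lt_opow h1 h1
  have hmono : Monotone x := monotone_nat_of_le_succ fun n => (hlt n).le
  have hl : ∀ n, x n < ⨆ n, x n := fun n => (hlt n).trans_le (Ordinal.le_iSup x (n + 1))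
  refine ⟨⨆ n, x n, ?_, ⟨(hω 0).trans (hl 0).le, ?_⟩, ?_⟩
  · exact ((Order.lt_add_one_iff.2 le_rfl).trans_le (le_max_left _ _)).trans (hl 0)
  · intro β hβ γ hγ
    rw [Ordinal.lt_iSup_iff] at hβ hγ
    obtain ⟨m, hm⟩ := hβ
    obtain ⟨n, hn⟩ := hγ
    have h1 := hm.le.trans (hmono (le_max_left m n))
    have h2 := hn.le.trans (hmono (le_max_right m n))
    have h0 : 0 < x (max m n) := Ordinal.omega0_pos.trans_le (hω _)
    refine (Ordinal.opow_le_opow h1 h2 h0).trans_lt ?_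
    rw [← hs]
    exact hl _
  · intro hα
    refine Ordinal.iSup_lt_omega_one fun n => ?_
    induction n with
    | zero =>
      refine max_lt ?_ Ordinal.omega0_lt_omega_one
      exact (Cardinal.isSuccLimit_omega 1).add_one_lt hα
    | succ n ih =>
      rw [hs]
      exact Ordinal.isPrincipal_opow_omega 1 ih ih

theorem iota_spec (α : Ordinal.{u}) : α < iota α ∧ IsExpIndecomposable (iota α) := by
  obtain ⟨l, h1, h2, -⟩ := exists_isExpIndecomposable_gt α
  exact csInf_mem (s := {l | α < l ∧ IsExpIndecomposable l}) ⟨l, h1, h2⟩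

theorem iota_le {α l : Ordinal.{u}} (h : α < l) (hl : IsExpIndecomposable l) : iota α ≤ l :=
  csInf_le' ⟨h, hl⟩

theorem iota_lt_omega_one {α : Ordinal.{u}} (h : α < ω_ 1) : iota α < ω_ 1 := by
  obtain ⟨l, h1, h2, h3⟩ := exists_isExpIndecomposable_gt α
  exact (iota_le h1 h2).trans_lt (h3 h)

namespace IsExpIndecomposable

variable {l : Ordinal.{u}} (hl : IsExpIndecomposable l)
include hl

theorem two_lt : 2 < l := (Ordinal.natCast_lt_omega0 2).trans_le hl.1

theorem mul_lt {β γ : Ordinal.{u}} (hβ : β < l) (hγ : γ < l) : β * γ < l := by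
  have h : max β γ < l := max_lt hβ hγ
  refine lt_of_le_of_lt ?_ (hl.2 _ h 2 hl.two_lt)
  have : (max β γ) ^ (2 : Ordinal.{u}) = max β γ * max β γ := by
    rw [← one_add_one_eq_two, Ordinal.opow_add, Ordinal.opow_one]
  rw [this]
  exact mul_le_mul' (le_max_left _ _) (le_max_right _ _)

theorem add_one_lt {β : Ordinal.{u}} (hβ : β < l) : β + 1 < l := by
  have h : max β 2 < l := max_lt hβ hl.two_lt
  refine lt_of_le_of_lt ?_ (hl.mul_lt h hl.two_lt)
  rw [← one_add_one_eq_two, mul_add, mul_one]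
  exact add_le_add (le_max_left _ _)
    ((le_add_of_nonneg_left zero_le_one).trans (le_max_right _ _))

end IsExpIndecomposable

/-- Half of the compatibility of powers with lifts, which suffices to lift exponentially
indecomposable ordinals to another universe. -/
theorem lift_opow_le (a b : Ordinal.{0}) (ha : a ≠ 0) :
    Ordinal.lift.{u} a ^ Ordinal.lift.{u} b ≤ Ordinal.lift.{u} (a ^ b) := by
  induction b using Ordinal.limitRecOn with
  | zero => simp
  | add_one b ih =>
    rw [Ordinal.lift_add, Ordinal.lift_one, Ordinal.opow_add_one, Ordinal.opow_add_one,
      Ordinal.lift_mul]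
    exact mul_le_mul_left ih _
  | limit b hb ih =>
    have ha' : Ordinal.lift.{u} a ≠ 0 := fun h =>
      ha (Ordinal.lift_inj.1 (h.trans Ordinal.lift_zero.symm))
    rw [Ordinal.opow_le_of_isSuccLimit ha' (Ordinal.isSuccLimit_lift.2 hb)]
    intro c hc
    obtain ⟨c, hc', rfl⟩ := Ordinal.lt_lift_iff.1 hc
    refine (ih c hc').trans ?_
    rw [Ordinal.lift_le]
    exact Ordinal.opow_le_opow_right (pos_iff_ne_zero.2 ha) hc'.le

theorem IsExpIndecomposable.lift {l : Ordinal.{0}} (hl : IsExpIndecomposable l) :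
    IsExpIndecomposable (Ordinal.lift.{u} l) := by
  refine ⟨by rw [← Ordinal.lift_omega0.{u, 0}, Ordinal.lift_le]; exact hl.1, ?_⟩
  intro β hβ γ hγ
  obtain ⟨β, hβ', rfl⟩ := Ordinal.lt_lift_iff.1 hβ
  obtain ⟨γ, hγ', rfl⟩ := Ordinal.lt_lift_iff.1 hγ
  rcases eq_or_ne β 0 with rfl | h0
  · rw [Ordinal.lift_zero]
    rcases eq_or_ne (Ordinal.lift.{u} γ) 0 with h | h
    · rw [h, Ordinal.opow_zero, ← Ordinal.lift_one.{0, u}, Ordinal.lift_lt]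
      exact one_lt_two.trans hl.two_lt
    · rw [Ordinal.zero_opow h]
      exact (bot_le).trans_lt hγ
  · exact (lift_opow_le β γ h0).trans_lt (Ordinal.lift_lt.2 (hl.2 β hβ' γ hγ'))

theorem IsExpIndecomposable.exists_lt_opow {l ρ : Ordinal.{u}} (hl : IsExpIndecomposable l)
    (hω : ω < l) (h : ρ < l) : ∃ β : Ordinal.{u}, ρ < ω ^ β ∧ ω ^ β < l := by
  refine ⟨ρ + 1, ?_, hl.2 _ hω _ (hl.add_one_lt h)⟩
  exact (Order.lt_add_one_iff.2 le_rfl).trans_le (Ordinal.right_le_opow _ Ordinal.one_lt_omega0)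

theorem IsExpIndecomposable.two_mul {l : Ordinal.{u}} (hl : IsExpIndecomposable l) : 2 * l = l := by
  refine (Ordinal.isPrincipal_mul_iff_mul_left_eq.1 fun a b ha hb => hl.mul_lt ha hb) 2 ?_ hl.two_lt
  exact two_pos

/-! ### Ranks of families from above and from below -/

/-- `RankLE l step ρ F`: the derivation tree of the family `F`, whose children are the families
`step i F`, has rank at most `ρ`, where at each node an `l`-negligible set of `i` is disregarded
and empty families count for nothing. -/
def RankLE {ι β : Type*} (l : Filter ι) (step : ι → Set β → Set β)
    (ρ : Ordinal.{u}) (F : Set β) : Prop :=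
  ∀ᶠ i in l, (step i F).Nonempty → ∃ ρ', ∃ _ : ρ' < ρ, RankLE l step ρ' (step i F)
termination_by ρ

section RankLE

variable {ι β : Type*} {l : Filter ι} {step : ι → Set β → Set β}

theorem rankLE_iff {ρ : Ordinal.{u}} {F : Set β} : RankLE l step ρ F ↔
    ∀ᶠ i in l, (step i F).Nonempty → ∃ ρ' < ρ, RankLE l step ρ' (step i F) := by
  rw [RankLE]
  simp only [exists_prop]

theorem RankLE.mono {ρ σ : Ordinal.{u}} {F : Set β} (h : RankLE l step ρ F) (hρ : ρ ≤ σ) :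
    RankLE l step σ F := by
  rw [rankLE_iff] at h ⊢
  filter_upwards [h] with i hi hne
  obtain ⟨ρ', h1, h2⟩ := hi hne
  exact ⟨ρ', h1.trans_le hρ, h2⟩

theorem RankLE.subset (hstep : ∀ i F G, F ⊆ G → step i F ⊆ step i G) {ρ : Ordinal.{u}}
    {F G : Set β} (h : RankLE l step ρ G) (hF : F ⊆ G) : RankLE l step ρ F := by
  induction ρ using WellFoundedLT.induction generalizing F G with
  | ind ρ ih =>
    rw [rankLE_iff] at h ⊢
    filter_upwards [h] with i hi hne
    obtain ⟨ρ', h1, h2⟩ := hi (hne.mono (hstep i F G hF))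
    exact ⟨ρ', h1, ih ρ' h1 h2 (hstep i F G hF)⟩

theorem RankLE.union (hstep : ∀ i F G, step i (F ∪ G) ⊆ step i F ∪ step i G)
    (hmono : ∀ i F G, F ⊆ G → step i F ⊆ step i G) {ρ : Ordinal.{u}}
    {F G : Set β} (hF : RankLE l step ρ F) (hG : RankLE l step ρ G) :
    RankLE l step ρ (F ∪ G) := by
  induction ρ using WellFoundedLT.induction generalizing F G with
  | ind ρ ih =>
    have hF' := hF
    have hG' := hG
    rw [rankLE_iff] at hF hG ⊢
    filter_upwards [hF, hG] with i h1 h2 hne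
    rcases (step i F).eq_empty_or_nonempty with e1 | e1 <;>
      rcases (step i G).eq_empty_or_nonempty with e2 | e2
    · have := hne.mono (hstep i F G)
      simp [e1, e2] at this
    · obtain ⟨ρ', h3, h4⟩ := h2 e2
      refine ⟨ρ', h3, h4.subset hmono ((hstep i F G).trans ?_)⟩
      simp [e1]
    · obtain ⟨ρ', h3, h4⟩ := h1 e1
      refine ⟨ρ', h3, h4.subset hmono ((hstep i F G).trans ?_)⟩
      simp [e2]
    · obtain ⟨ρ₁, h3, h4⟩ := h1 e1
      obtain ⟨ρ₂, h5, h6⟩ := h2 e2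
      exact ⟨max ρ₁ ρ₂, max_lt h3 h5,
        (ih _ (max_lt h3 h5) (h4.mono (le_max_left _ _)) (h6.mono (le_max_right _ _))).subset
          hmono (hstep i F G)⟩

theorem RankLE.of_lift {ρ : Ordinal.{0}} {F : Set β}
    (h : RankLE l step (Ordinal.lift.{u} ρ) F) : RankLE l step ρ F := by
  induction ρ using WellFoundedLT.induction generalizing F with
  | ind ρ ih =>
    rw [rankLE_iff] at h ⊢
    filter_upwards [h] with i hi hne
    obtain ⟨ρ', h1, h2⟩ := hi hne
    obtain ⟨ρ', h3, rfl⟩ := Ordinal.lt_lift_iff.1 h1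
    exact ⟨ρ', h3, ih ρ' h3 h2⟩

theorem rankLE_empty (hstep : ∀ i, step i ∅ = ∅) {ρ : Ordinal.{u}} : RankLE l step ρ ∅ := by
  rw [rankLE_iff]
  exact Eventually.of_forall fun i h => by simp [hstep] at h

theorem RankLE.iUnion_lt (hstep : ∀ i F G, step i (F ∪ G) ⊆ step i F ∪ step i G)
    (hmono : ∀ i F G, F ⊆ G → step i F ⊆ step i G) (hempty : ∀ i, step i ∅ = ∅)
    {ρ : Ordinal.{u}} (hρ : 0 < ρ)
    (F : ℕ → Set β) (n : ℕ)
    (h : ∀ k < n, (F k).Nonempty → ∃ ρ' < ρ, RankLE l step ρ' (F k)) :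
    ∃ ρ' < ρ, RankLE l step ρ' (⋃ k < n, F k) := by
  induction n with
  | zero => exact ⟨0, hρ, by simpa using rankLE_empty hempty⟩
  | succ n ih =>
    obtain ⟨ρ₁, h1, h2⟩ := ih fun k hk => h k (hk.trans (Nat.lt_succ_self n))
    have h3 : ∃ ρ' < ρ, RankLE l step ρ' (F n) := by
      rcases (F n).eq_empty_or_nonempty with e | e
      · exact ⟨0, hρ, by simpa [e] using rankLE_empty hempty⟩
      · exact h n (Nat.lt_succ_self n) e
    obtain ⟨ρ₂, h4, h5⟩ := h3
    refine ⟨max ρ₁ ρ₂, max_lt h1 h4, ?_⟩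
    rw [Set.biUnion_lt_succ]
    exact RankLE.union hstep hmono (h2.mono (le_max_left _ _)) (h5.mono (le_max_right _ _))

end RankLE

theorem section_mono (n : ℕ) {F G : Set (Finset ℕ)} (h : F ⊆ G) : section_ F n ⊆ section_ G n :=
  fun _ hs => ⟨hs.1, h hs.2⟩

theorem section_union (n : ℕ) (F G : Set (Finset ℕ)) :
    section_ (F ∪ G) n ⊆ section_ F n ∪ section_ G n := by
  rintro s ⟨h1, h2 | h2⟩
  · exact Or.inl ⟨h1, h2⟩
  · exact Or.inr ⟨h1, h2⟩

theorem section_empty (n : ℕ) : section_ (∅ : Set (Finset ℕ)) n = ∅ := by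
  ext s; simp [section_]

/-- The tree of the sections of the family `F` of finite sets of integers has rank at most `ρ`. -/
abbrev SecRankLE (ρ : Ordinal.{u}) (F : Set (Finset ℕ)) : Prop :=
  RankLE (⊤ : Filter ℕ) (fun n F => section_ F n) ρ F

theorem secRankLE_iff {ρ : Ordinal.{u}} {F : Set (Finset ℕ)} : SecRankLE ρ F ↔
    ∀ n, (section_ F n).Nonempty → ∃ ρ' < ρ, SecRankLE ρ' (section_ F n) := by
  rw [SecRankLE, rankLE_iff, eventually_top]

theorem SecRankLE.subset {ρ : Ordinal.{u}} {F G : Set (Finset ℕ)} (h : SecRankLE ρ G)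
    (hF : F ⊆ G) : SecRankLE ρ F :=
  RankLE.subset (fun n _ _ h => section_mono n h) h hF

theorem SecRankLE.union {ρ : Ordinal.{u}} {F G : Set (Finset ℕ)} (h : SecRankLE ρ F)
    (hG : SecRankLE ρ G) : SecRankLE ρ (F ∪ G) :=
  RankLE.union (fun n F G => section_union n F G) (fun n _ _ h => section_mono n h) h hG

theorem SecRankLE.iUnion_lt {ρ : Ordinal.{u}} (hρ : 0 < ρ) (F : ℕ → Set (Finset ℕ)) (n : ℕ)
    (h : ∀ k < n, (F k).Nonempty → ∃ ρ' < ρ, SecRankLE ρ' (F k)) :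
    ∃ ρ' < ρ, SecRankLE ρ' (⋃ k < n, F k) :=
  RankLE.iUnion_lt (fun n F G => section_union n F G) (fun n _ _ h => section_mono n h)
    section_empty hρ F n h

/-- The tree of the sections of `F` has rank at least `ρ`, even if at each node finitely many
integers are disregarded. -/
def SecRankGE (ρ : Ordinal.{u}) (F : Set (Finset ℕ)) : Prop :=
  ∅ ∈ F ∧ ∀ ρ', ∀ _ : ρ' < ρ, ∃ N, ∀ n, N ≤ n → SecRankGE ρ' (section_ F n)
termination_by ρ

theorem secRankGE_iff {ρ : Ordinal.{u}} {F : Set (Finset ℕ)} : SecRankGE ρ F ↔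
    ∅ ∈ F ∧ ∀ ρ' < ρ, ∃ N, ∀ n, N ≤ n → SecRankGE ρ' (section_ F n) := by
  rw [SecRankGE]

theorem SecRankGE.mono {ρ σ : Ordinal.{u}} {F G : Set (Finset ℕ)} (h : SecRankGE ρ F)
    (hσ : σ ≤ ρ) (hF : F ⊆ G) : SecRankGE σ G := by
  induction ρ using WellFoundedLT.induction generalizing F G σ with
  | ind ρ ih =>
    rw [secRankGE_iff] at h ⊢
    refine ⟨hF h.1, fun ρ' h' => ?_⟩
    obtain ⟨N, hN⟩ := h.2 ρ' (h'.trans_le hσ)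
    exact ⟨N, fun n hn => ih ρ' (h'.trans_le hσ) (hN n hn) le_rfl (section_mono n hF)⟩

theorem secRankGE_zero {F : Set (Finset ℕ)} (h : ∅ ∈ F) : SecRankGE (0 : Ordinal.{u}) F := by
  rw [secRankGE_iff]
  exact ⟨h, fun ρ' h' => absurd h' (by simp)⟩

theorem SecRankGE.preimage {ρ : Ordinal.{u}} {F : Set (Finset ℕ)} (h : SecRankGE ρ F)
    {φ : ℕ → ℕ} (hφ : StrictMono φ) : SecRankGE ρ {s | s.image φ ∈ F} := by
  induction ρ using WellFoundedLT.induction generalizing F with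
  | ind ρ ih =>
    rw [secRankGE_iff] at h ⊢
    refine ⟨by simpa using h.1, fun ρ' h' => ?_⟩
    obtain ⟨N, hN⟩ := h.2 ρ' h'
    refine ⟨N, fun n hn => (ih ρ' h' (hN (φ n) (hn.trans hφ.le_apply))).mono le_rfl ?_⟩
    rintro s ⟨h1, h2⟩
    refine ⟨fun m hm => hφ.lt_iff_lt.1 (h1 _ (Finset.mem_image_of_mem φ hm)), ?_⟩
    simpa [Finset.image_insert] using h2

theorem SecRankGE.restrict_Ici {ρ : Ordinal.{u}} {F : Set (Finset ℕ)} (h : SecRankGE ρ F)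
    (k : ℕ) : SecRankGE ρ {s ∈ F | ∀ m ∈ s, k ≤ m} := by
  induction ρ using WellFoundedLT.induction generalizing F with
  | ind ρ ih =>
    rw [secRankGE_iff] at h ⊢
    refine ⟨⟨h.1, by simp⟩, fun ρ' h' => ?_⟩
    obtain ⟨N, hN⟩ := h.2 ρ' h'
    refine ⟨max N k, fun n hn => (ih ρ' h' (hN n (le_of_max_le_left hn))).mono le_rfl ?_⟩
    rintro s ⟨⟨h1, h2⟩, h3⟩
    refine ⟨h1, h2, ?_⟩
    intro m hm
    rcases Finset.mem_insert.1 hm with rfl | hm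
    · exact le_of_max_le_right hn
    · exact h3 m hm

/-! ### A chain of hereditary, spreading, uniform families -/

/-- Every `s ∈ U` is mapped into `U` by the maps that are increasing on `s` and lie above the
identity on `s`. -/
def SpreadsMaps (U : Set (Finset ℕ)) : Prop :=
  ∀ s ∈ U, ∀ g : ℕ → ℕ, StrictMonoOn g s → (∀ x ∈ s, x ≤ g x) → s.image g ∈ U

theorem SpreadsMaps.isSpreading {U : Set (Finset ℕ)} (h : SpreadsMaps U) : IsSpreading U := by
  intro k m n hm hn hmn hU
  have key : ∀ i, Function.extend m n 0 (m i) = n i := fun i => hm.injective.extend_apply n 0 i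
  have := h _ hU (Function.extend m n 0) ?_ ?_
  · rw [Finset.image_image] at this
    convert this using 2
    ext i
    simp [key]
  · intro x hx y hy hxy
    simp only [Finset.coe_image, Finset.coe_univ, image_univ, mem_range] at hx hy
    obtain ⟨i, rfl⟩ := hx
    obtain ⟨j, rfl⟩ := hy
    rw [key, key]
    exact hn (hm.lt_iff_lt.1 hxy)
  · intro x hx
    simp only [Finset.mem_image, Finset.mem_univ, true_and] at hx
    obtain ⟨i, rfl⟩ := hx
    rw [key]
    exact hmn i

/-- A hereditary and spreading family all of whose tails are `ρ`-uniform. -/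
structure IsGood (ρ : Ordinal.{0}) (U : Set (Finset ℕ)) : Prop where
  empty_mem : ∅ ∈ U
  hereditary : IsHereditary U
  spreads : SpreadsMaps U
  uniform : ∀ k, IsUniform ρ {m | k ≤ m} {s ∈ U | ∀ m ∈ s, k ≤ m}

/-- The sections of `U` eventually contain the tails of `V`. -/
def Dominates (U V : Set (Finset ℕ)) : Prop :=
  ∃ p, ∀ n, p ≤ n → ∀ s ∈ V, (∀ m ∈ s, n < m) → insert n s ∈ U

theorem Dominates.exists_tail_subset {U V : Set (Finset ℕ)} (h : Dominates U V)
    (hV : IsHereditary V) (hU : ∅ ∈ U) : ∃ p, ∀ s ∈ V, (∀ m ∈ s, p ≤ m) → s ∈ U := by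
  obtain ⟨p, hp⟩ := h
  refine ⟨p, fun s hs hsp => ?_⟩
  rcases s.eq_empty_or_nonempty with rfl | hne
  · exact hU
  · have hmin := s.min'_mem hne
    have := hp (s.min' hne) (hsp _ hmin) (s.erase (s.min' hne)) (hV s hs _ (Finset.erase_subset _ _))
      (fun m hm => Finset.min'_lt_of_mem_erase_min' s hne hm)
    rwa [Finset.insert_erase hmin] at this

/-- The family whose section at `n` consists of the members of `f n` beyond `n`. -/
def consFamily (f : ℕ → Set (Finset ℕ)) : Set (Finset ℕ) :=
  {s | s = ∅ ∨ ∃ n, ∃ t ∈ f n, (∀ m ∈ t, n < m) ∧ s = insert n t}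

theorem insert_eq_insert_of_lt {n n' : ℕ} {s t : Finset ℕ} (hs : ∀ m ∈ s, n < m)
    (ht : ∀ m ∈ t, n' < m) (h : insert n s = insert n' t) : n = n' ∧ s = t := by
  have hns : n ∉ s := fun h' => lt_irrefl _ (hs n h')
  have hnt : n' ∉ t := fun h' => lt_irrefl _ (ht n' h')
  have h1 : n ∈ insert n' t := h ▸ Finset.mem_insert_self n s
  have h2 : n' ∈ insert n s := h ▸ Finset.mem_insert_self n' t
  have hnn : n = n' := by
    rcases Finset.mem_insert.1 h1 with h1 | h1
    · exact h1
    rcases Finset.mem_insert.1 h2 with h2 | h2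
    · exact h2.symm
    exact absurd (hs _ h2) (ht _ h1).not_gt
  subst hnn
  refine ⟨rfl, ?_⟩
  rw [← Finset.erase_insert hns, h, Finset.erase_insert hnt]

theorem insert_mem_consFamily {f : ℕ → Set (Finset ℕ)} {n : ℕ} {s : Finset ℕ}
    (hs : ∀ m ∈ s, n < m) : insert n s ∈ consFamily f ↔ s ∈ f n := by
  constructor
  · rintro (h | ⟨n', t, ht, h1, h2⟩)
    · exact absurd h (Finset.insert_ne_empty _ _)
    · obtain ⟨rfl, rfl⟩ := insert_eq_insert_of_lt hs h1 h2
      exact ht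
  · exact fun h => Or.inr ⟨n, s, h, hs, rfl⟩

section cons

variable {f : ℕ → Set (Finset ℕ)}
  (hf : ∀ n n' : ℕ, n ≤ n' → ∀ s ∈ f n, (∀ m ∈ s, n' < m) → s ∈ f n')
include hf

theorem IsHereditary.consFamily (hher : ∀ n, IsHereditary (f n)) :
    IsHereditary (consFamily f) := by
  rintro s (rfl | ⟨n, t, ht, h1, rfl⟩) u hu
  · exact Or.inl (Finset.subset_empty.1 hu)
  rcases u.eq_empty_or_nonempty with rfl | hne
  · exact Or.inl rfl
  have hmin := u.min'_mem hne
  have hlt : ∀ m ∈ u.erase (u.min' hne), u.min' hne < m :=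
    fun m hm => Finset.min'_lt_of_mem_erase_min' u hne hm
  have hn : n ≤ u.min' hne := by
    rcases Finset.mem_insert.1 (hu hmin) with h | h
    · exact h.ge
    · exact (h1 _ h).le
  rw [← Finset.insert_erase hmin, insert_mem_consFamily hlt]
  refine hf n _ hn _ (hher n t ht _ ?_) hlt
  intro m hm
  rcases Finset.mem_insert.1 (hu (Finset.mem_of_mem_erase hm)) with h | h
  · exact absurd (hlt m hm) (by rw [h]; exact hn.not_gt)
  · exact h

theorem SpreadsMaps.consFamily (hspr : ∀ n, SpreadsMaps (f n)) :
    SpreadsMaps (consFamily f) := by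
  rintro s (rfl | ⟨n, t, ht, h1, rfl⟩) g hg hle
  · exact Or.inl (by simp)
  have hgt : ∀ m ∈ t.image g, g n < m := by
    intro m hm
    obtain ⟨x, hx, rfl⟩ := Finset.mem_image.1 hm
    exact hg (by simp) (by simp [hx]) (h1 x hx)
  rw [Finset.image_insert, insert_mem_consFamily hgt]
  refine hf n _ (hle n (by simp)) _ (hspr n t ht g (hg.mono (by simp)) ?_) hgt
  exact fun x hx => hle x (by simp [hx])

end cons

theorem section_consFamily (f : ℕ → Set (Finset ℕ)) {k n : ℕ} (hkn : k ≤ n) :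
    section_ {s ∈ consFamily f | ∀ m ∈ s, k ≤ m} n = {s ∈ f n | ∀ m ∈ s, n + 1 ≤ m} := by
  ext s
  constructor
  · rintro ⟨h1, h2, h3⟩
    exact ⟨(insert_mem_consFamily h1).1 h2, h1⟩
  · rintro ⟨h1, h2⟩
    refine ⟨h2, (insert_mem_consFamily h2).2 h1, ?_⟩
    intro m hm
    rcases Finset.mem_insert.1 hm with rfl | hm
    · exact hkn
    · exact hkn.trans ((Nat.le_succ n).trans (h2 m hm))

theorem setOf_le_and_lt {k n : ℕ} (hkn : k ≤ n) :
    {m | m ∈ {m | k ≤ m} ∧ n < m} = {m | n + 1 ≤ m} := by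
  ext m
  simp only [mem_ofPred_eq]
  omega

theorem isGood_zero : IsGood 0 {∅} where
  empty_mem := rfl
  hereditary := by
    rintro s rfl t ht
    exact Finset.subset_empty.1 ht
  spreads := by
    rintro s rfl g _ _
    simp
  uniform k := by
    convert IsUniform.zero {m | k ≤ m} using 1
    ext s
    simp only [mem_singleton_iff, mem_ofPred_eq, and_iff_left_iff_imp]
    rintro rfl
    simp

theorem IsGood.add_one {ρ : Ordinal.{0}} {U : Set (Finset ℕ)} (h : IsGood ρ U) :
    IsGood (ρ + 1) (consFamily fun _ => U) where
  empty_mem := Or.inl rfl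
  hereditary := IsHereditary.consFamily (fun _ _ _ _ hs _ => hs) fun _ => h.hereditary
  spreads := SpreadsMaps.consFamily (fun _ _ _ _ hs _ => hs) fun _ => h.spreads
  uniform k := by
    refine IsUniform.succ ρ _ _ (fun s hs m hm => hs.2 m hm) ⟨Or.inl rfl, by simp⟩ ?_
    intro n hn
    rw [section_consFamily _ hn, setOf_le_and_lt hn]
    exact h.uniform (n + 1)

theorem exists_seq_cofinal {ρ : Ordinal.{0}} (hρ : ρ < ω_ 1) (h0 : 0 < ρ) :
    ∃ b : ℕ → Ordinal.{0}, Monotone b ∧ (∀ n, b n < ρ) ∧ ∀ β < ρ, ∃ n, β ≤ b n := by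
  have hc : (Iio ρ).Countable := by
    rw [← Cardinal.le_aleph0_iff_set_countable, Cardinal.mk_Iio_ordinal,
      ← Cardinal.lift_aleph0.{1, 0}, Cardinal.lift_le]
    rw [Cardinal.lt_omega_iff_card_lt] at hρ
    exact Cardinal.lt_aleph_one_iff.1 hρ
  obtain ⟨e, he⟩ := hc.exists_eq_range ⟨0, h0⟩
  have heρ : ∀ n, e n < ρ := fun n => by
    have : e n ∈ Iio ρ := he ▸ mem_range_self n
    exact this
  refine ⟨partialSups e, (partialSups e).monotone, fun n => ?_, fun β hβ => ?_⟩
  · induction n with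
    | zero => simpa using heρ 0
    | succ n ih =>
      rw [← Order.succ_eq_add_one, partialSups_succ]
      exact max_lt ih (heρ _)
  · have : β ∈ range e := he ▸ hβ
    obtain ⟨n, rfl⟩ := this
    exact ⟨n, le_partialSups e n⟩

/-- The diagonal construction at limit stages. -/
theorem exists_isGood_limit {ρ : Ordinal.{0}} (hρ : ρ < ω_ 1) (hlim : Order.IsSuccLimit ρ)
    (U : Ordinal.{0} → Set (Finset ℕ)) (hU : ∀ β < ρ, IsGood β (U β))
    (hdom : ∀ γ < ρ, ∀ β < γ, Dominates (U γ) (U β)) :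
    ∃ V, IsGood ρ V ∧ ∀ β < ρ, Dominates V (U β) := by
  obtain ⟨b, hb, hbρ, hcof⟩ := exists_seq_cofinal hρ hlim.bot_lt
  have hAI : ∀ γ < ρ, ∀ β ≤ γ, ∃ p, ∀ s ∈ U β, (∀ m ∈ s, p ≤ m) → s ∈ U γ := by
    intro γ hγ β hβ
    rcases hβ.eq_or_lt with rfl | hβ
    · exact ⟨0, fun s hs _ => hs⟩
    · exact (hdom γ hγ β hβ).exists_tail_subset (hU β (hβ.trans hγ)).hereditary (hU γ hγ).empty_mem
  choose p hp using fun i => hAI (b (i + 1)) (hbρ _) (b i) (hb (Nat.le_succ i))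
  -- the index `g n` grows so slowly that the first `g n` inclusions are valid beyond `n`
  let g : ℕ → ℕ := fun n => Nat.findGreatest (fun j => ∀ i < j, p i ≤ n) n
  have hg : ∀ n, ∀ i < g n, p i ≤ n := fun n =>
    Nat.findGreatest_spec (P := fun j => ∀ i < j, p i ≤ n) (Nat.zero_le n) (by simp)
  have hgm : Monotone g := by
    intro n n' h
    exact Nat.findGreatest_mono (fun j hj i hi => (hj i hi).trans h) h
  have hgu : ∀ j, ∃ N, ∀ n, N ≤ n → j ≤ g n := by
    intro j
    refine ⟨j + ∑ i ∈ Finset.range j, p i, fun n hn => ?_⟩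
    refine Nat.le_findGreatest (by omega) fun i hi => ?_
    have := Finset.single_le_sum (f := p) (fun _ _ => Nat.zero_le _) (Finset.mem_range.2 hi)
    omega
  have hchain : ∀ n j, j ≤ g n → ∀ s ∈ U (b j), (∀ m ∈ s, n < m) → s ∈ U (b (g n)) := by
    intro n j hj s hs hm
    induction hj using Nat.decreasingInduction with
    | self => exact hs
    | of_succ i hi ih => exact ih (hp i s hs fun m hm' => (hg n i hi).trans (hm m hm').le)
  have hf : ∀ n n' : ℕ, n ≤ n' → ∀ s ∈ U (b (g n)), (∀ m ∈ s, n' < m) → s ∈ U (b (g n')) :=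
    fun n n' h s hs hm => hchain n' (g n) (hgm h) s hs hm
  refine ⟨consFamily fun n => U (b (g n)), ⟨Or.inl rfl, ?_, ?_, ?_⟩, ?_⟩
  · exact IsHereditary.consFamily hf fun n => (hU _ (hbρ _)).hereditary
  · exact SpreadsMaps.consFamily hf fun n => (hU _ (hbρ _)).spreads
  · intro k
    refine IsUniform.limit ρ _ _ (fun n => b (g n)) hlim (fun s hs m hm => hs.2 m hm)
      ⟨Or.inl rfl, by simp⟩ ((hb.comp hgm).monotoneOn _) (fun n _ => hbρ _) ?_ ?_
    · intro β hβ
      obtain ⟨j, hj⟩ := hcof _ (hlim.add_one_lt hβ)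
      obtain ⟨N, hN⟩ := hgu j
      refine ⟨max k N, le_max_left k N, ?_⟩
      exact (Order.lt_add_one_iff.2 le_rfl).trans_le (hj.trans (hb (hN _ (le_max_right _ _))))
    · intro n hn
      rw [section_consFamily _ hn, setOf_le_and_lt hn]
      exact (hU _ (hbρ _)).uniform (n + 1)
  · intro β hβ
    obtain ⟨j, hj⟩ := hcof β hβ
    obtain ⟨q, hq⟩ := hAI (b j) (hbρ j) β hj
    obtain ⟨N, hN⟩ := hgu j
    refine ⟨max q N, fun n hn s hs hm => ?_⟩
    rw [insert_mem_consFamily hm]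
    exact hchain n j (hN n (le_of_max_le_right hn)) s
      (hq s hs fun m hm' => (le_of_max_le_left hn).trans (hm m hm').le) hm

/-- A transfinite sequence of hereditary, spreading and uniform families, each of which dominates
its predecessors. Domination is what allows the construction to be continued at limit stages. -/
theorem exists_isGood_chain : ∃ U : Ordinal.{0} → Set (Finset ℕ), ∀ ρ < ω_ 1,
    IsGood ρ (U ρ) ∧ ∀ β < ρ, Dominates (U ρ) (U β) := by
  classical
  let step : ∀ ρ : Ordinal.{0}, (∀ β, β < ρ → Set (Finset ℕ)) → Set (Finset ℕ) := fun ρ W =>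
    if h : ∃ V, IsGood ρ V ∧ ∀ β (hβ : β < ρ), Dominates V (W β hβ) then h.choose else ∅
  let U : Ordinal.{0} → Set (Finset ℕ) := WellFoundedLT.fix step
  have hU : ∀ ρ, U ρ = step ρ fun β _ => U β := fun ρ => WellFoundedLT.fix_eq step ρ
  have hstep : ∀ ρ, (∃ V, IsGood ρ V ∧ ∀ β < ρ, Dominates V (U β)) →
      IsGood ρ (U ρ) ∧ ∀ β < ρ, Dominates (U ρ) (U β) := by
    intro ρ h
    have h' : U ρ = h.choose := by
      rw [hU]
      exact dif_pos h
    rw [h']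
    exact h.choose_spec
  refine ⟨U, fun ρ => ?_⟩
  induction ρ using WellFoundedLT.induction with
  | ind ρ ih =>
    intro hρ
    apply hstep
    have ih' : ∀ β < ρ, IsGood β (U β) ∧ ∀ γ < β, Dominates (U β) (U γ) :=
      fun β hβ => ih β hβ (hβ.trans hρ)
    rcases Ordinal.zero_or_succ_or_isSuccLimit ρ with rfl | ⟨σ, rfl⟩ | hlim
    · exact ⟨{∅}, isGood_zero, fun β hβ => absurd hβ (by simp)⟩
    · have hσ := ih' σ (Order.lt_succ σ)
      refine ⟨consFamily fun _ => U σ, hσ.1.add_one, fun β hβ => ?_⟩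
      rcases (Order.lt_succ_iff.1 hβ).eq_or_lt with rfl | hβ'
      · exact ⟨0, fun n _ s hs hm => (insert_mem_consFamily hm).2 hs⟩
      · obtain ⟨p, hp⟩ := (hσ.2 β hβ').exists_tail_subset (ih' β hβ).1.hereditary hσ.1.empty_mem
        refine ⟨p, fun n hn s hs hm => (insert_mem_consFamily hm).2 ?_⟩
        exact hp s hs fun m hm' => hn.trans (hm m hm').le
    · exact exists_isGood_limit hρ hlim U (fun β hβ => (ih' β hβ).1) fun γ hγ => (ih' γ hγ).2

theorem IsUniform.secRankLE {ρ : Ordinal.{0}} {M : Set ℕ} {F : Set (Finset ℕ)}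
    (h : IsUniform ρ M F) : SecRankLE ρ F := by
  induction h with
  | zero M =>
    rw [secRankLE_iff]
    rintro n ⟨s, -, hs⟩
    exact absurd hs (Finset.insert_ne_empty _ _)
  | succ β M F hM _ _ ih =>
    rw [secRankLE_iff]
    rintro n ⟨s, hs⟩
    exact ⟨β, Order.lt_add_one_iff.2 le_rfl, ih n (hM _ hs.2 (by simp))⟩
  | limit α M F a _ hM _ _ hlt _ _ ih =>
    rw [secRankLE_iff]
    rintro n ⟨s, hs⟩
    have hn : n ∈ M := hM _ hs.2 (by simp)
    exact ⟨a n, hlt n hn, ih n hn⟩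

theorem IsGood.uniform_univ {ρ : Ordinal.{0}} {U : Set (Finset ℕ)} (h : IsGood ρ U) :
    IsUniform ρ univ U := by
  have := h.uniform 0
  simpa using this

theorem IsGood.mem_uniformFamilies {ρ : Ordinal.{0}} {U : Set (Finset ℕ)} (h : IsGood ρ U)
    (hρ : ρ < ω_ 1) : U ∈ uniformFamilies :=
  ⟨h.hereditary, h.spreads.isSpreading, ρ, hρ, h.uniform_univ⟩

/-- Any family of rank at most `ρ` is carried into the `ρ`-th family of the chain by a sufficiently
fast increasing map. -/
theorem exists_strictMono_image_mem {U : Ordinal.{0} → Set (Finset ℕ)}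
    (hU : ∀ ρ < ω_ 1, IsGood ρ (U ρ) ∧ ∀ β < ρ, Dominates (U ρ) (U β)) {ρ : Ordinal.{0}}
    (hρ : ρ < ω_ 1) {F : Set (Finset ℕ)} (hF : SecRankLE ρ F) :
    ∃ φ : ℕ → ℕ, StrictMono φ ∧ ∀ s ∈ F, s.image φ ∈ U ρ := by
  induction ρ using WellFoundedLT.induction generalizing F with
  | ind ρ ih =>
    rw [secRankLE_iff] at hF
    have key : ∀ n, ∃ (φ : ℕ → ℕ) (p : ℕ), ∀ s ∈ section_ F n, ∀ g : ℕ → ℕ, StrictMono g →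
        (∀ m ∈ s, φ m ≤ g m) → p ≤ g n → insert (g n) (s.image g) ∈ U ρ := by
      intro n
      rcases (section_ F n).eq_empty_or_nonempty with e | e
      · exact ⟨id, 0, fun s hs => by simp [e] at hs⟩
      obtain ⟨ρ', h1, h2⟩ := hF n e
      obtain ⟨φ, hφ, hφF⟩ := ih ρ' h1 (h1.trans hρ) h2
      obtain ⟨p, hp⟩ := (hU ρ hρ).2 ρ' h1
      refine ⟨φ, p, fun s hs g hg hge hpg => hp (g n) hpg _ ?_ ?_⟩
      · -- `s.image g` is a spread of `s.image φ`
        have key : ∀ i, Function.extend φ g 0 (φ i) = g i :=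
          fun i => hφ.injective.extend_apply g 0 i
        have := (hU ρ' (h1.trans hρ)).1.spreads _ (hφF s hs) (Function.extend φ g 0) ?_ ?_
        · rw [Finset.image_image] at this
          convert this using 2
          ext i
          simp [key]
        · intro x hx y hy hxy
          simp only [Finset.coe_image, mem_image, Finset.mem_coe] at hx hy
          obtain ⟨i, -, rfl⟩ := hx
          obtain ⟨j, -, rfl⟩ := hy
          rw [key, key]
          exact hg (hφ.lt_iff_lt.1 hxy)
        · intro x hx
          obtain ⟨i, hi, rfl⟩ := Finset.mem_image.1 hx
          rw [key]
          exact hge i hi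
      · intro m hm
        obtain ⟨x, hx, rfl⟩ := Finset.mem_image.1 hm
        exact hg (hs.1 x hx)
    choose φ p h using key
    let g : ℕ → ℕ := fun i =>
      ∑ l ∈ Finset.range (i + 1), (∑ j ∈ Finset.range (l + 1), φ j l + p l + 1)
    have hg : StrictMono g := by
      refine strictMono_nat_of_lt_succ fun i => ?_
      simp only [g]
      rw [Finset.sum_range_succ _ (i + 1)]
      omega
    have hge : ∀ i, ∑ j ∈ Finset.range (i + 1), φ j i + p i ≤ g i := by
      intro i
      have := Finset.sum_range_succ (fun l => ∑ j ∈ Finset.range (l + 1), φ j l + p l + 1) i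
      simp only [g]
      omega
    refine ⟨g, hg, fun s hs => ?_⟩
    rcases s.eq_empty_or_nonempty with rfl | hne
    · simpa using (hU ρ hρ).1.empty_mem
    have hmin := s.min'_mem hne
    have hlt : ∀ m ∈ s.erase (s.min' hne), s.min' hne < m :=
      fun m hm => Finset.min'_lt_of_mem_erase_min' s hne hm
    have := h (s.min' hne) (s.erase (s.min' hne))
      ⟨hlt, by rwa [Finset.insert_erase hmin]⟩ g hg ?_ ?_
    · rwa [← Finset.image_insert, Finset.insert_erase hmin] at this
    · intro m hm
      have h1 := Finset.single_le_sum (f := fun j => φ j m) (fun _ _ => Nat.zero_le _)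
        (Finset.mem_range.2 ((hlt m hm).trans (Nat.lt_succ_self m)))
      exact h1.trans ((Nat.le_add_right _ _).trans (hge m))
    · have h2 := hge (s.min' hne)
      omega

/-- A family of rank at least `n` has a member of size `n`. -/
theorem SecRankGE.exists_card {n : ℕ} {F : Set (Finset ℕ)} {ρ : Ordinal.{u}}
    (h : SecRankGE ρ F) (hn : (n : Ordinal.{u}) ≤ ρ) : ∃ s ∈ F, s.card = n := by
  induction n generalizing F ρ with
  | zero =>
    rw [secRankGE_iff] at h
    exact ⟨∅, h.1, rfl⟩
  | succ n ih =>
    rw [secRankGE_iff] at h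
    have hn' : (n : Ordinal.{u}) < ρ := lt_of_lt_of_le (by exact_mod_cast Nat.lt_succ_self n) hn
    obtain ⟨N, hN⟩ := h.2 n hn'
    obtain ⟨s, hs, hc⟩ := ih (hN N le_rfl) le_rfl
    refine ⟨insert N s, hs.2, ?_⟩
    rw [Finset.card_insert_of_notMem fun h' => lt_irrefl _ (hs.1 N h'), hc]

/-! ### The rank of the Schreier families -/

/-- `w` is the union of `k` successive nonempty members of `F`. -/
inductive IsSuccUnion (F : Set (Finset ℕ)) : ℕ → Finset ℕ → Prop
  | nil : IsSuccUnion F 0 ∅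
  | cons (k : ℕ) (s w : Finset ℕ) (hs : s ∈ F) (hne : s.Nonempty) (hw : IsSuccUnion F k w)
      (hlt : ∀ p ∈ s, ∀ q ∈ w, p < q) : IsSuccUnion F (k + 1) (s ∪ w)

theorem isSuccUnion_biUnion {F : Set (Finset ℕ)} (n : ℕ) (s : Fin n → Finset ℕ)
    (hs : ∀ i, (s i).Nonempty) (hF : ∀ i, s i ∈ F)
    (hlt : ∀ i j, i < j → ∀ p ∈ s i, ∀ q ∈ s j, p < q) :
    IsSuccUnion F n (Finset.univ.biUnion s) := by
  induction n with
  | zero => exact IsSuccUnion.nil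
  | succ n ih =>
    have : Finset.univ.biUnion s = s 0 ∪ Finset.univ.biUnion (fun i : Fin n => s i.succ) := by
      ext x
      simp [Fin.exists_fin_succ]
    rw [this]
    refine IsSuccUnion.cons n _ _ (hF 0) (hs 0) (ih _ (fun i => hs _) (fun i => hF _)
      fun i j hij => hlt _ _ (Fin.succ_lt_succ_iff.2 hij)) ?_
    intro p hp q hq
    obtain ⟨i, -, hi⟩ := Finset.mem_biUnion.1 hq
    exact hlt 0 i.succ (Fin.succ_pos i) p hp q hi

theorem IsSuccUnion.exists_fin {F : Set (Finset ℕ)} {k : ℕ} {w : Finset ℕ}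
    (h : IsSuccUnion F k w) : ∃ s : Fin k → Finset ℕ, (∀ i, (s i).Nonempty) ∧ (∀ i, s i ∈ F) ∧
      (∀ i j, i < j → ∀ p ∈ s i, ∀ q ∈ s j, p < q) ∧ w = Finset.univ.biUnion s := by
  induction h with
  | nil => exact ⟨Fin.elim0, fun i => i.elim0, fun i => i.elim0, fun i => i.elim0, rfl⟩
  | cons k s w hs hne hw hlt ih =>
    obtain ⟨t, h1, h2, h3, rfl⟩ := ih
    refine ⟨Fin.cons s t, ?_, ?_, ?_, ?_⟩
    · intro i
      refine Fin.cases ?_ (fun i => ?_) i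
      · simpa using hne
      · simpa using h1 i
    · intro i
      refine Fin.cases ?_ (fun i => ?_) i
      · simpa using hs
      · simpa using h2 i
    · intro i j
      refine Fin.cases ?_ (fun j => ?_) j
      · intro h
        exact absurd h (Fin.not_lt_zero i)
      · refine Fin.cases ?_ (fun i => ?_) i
        · intro _ p hp q hq
          exact hlt p (by simpa using hp) q (Finset.mem_biUnion.2 ⟨j, Finset.mem_univ j, by
            simpa using hq⟩)
        · intro hij p hp q hq
          exact h3 i j (Fin.succ_lt_succ_iff.1 hij) p (by simpa using hp) q (by simpa using hq)
    · ext x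
      simp [Fin.exists_fin_succ]

theorem mem_prodFamily_schreier {F : Set (Finset ℕ)} {w : Finset ℕ} :
    w ∈ prodFamily F schreier ↔ ∃ k, IsSuccUnion F k w ∧ ∀ x ∈ w, k ≤ x := by
  constructor
  · rintro ⟨n, s, hs, hF, hlt, hmin, rfl⟩
    refine ⟨n, isSuccUnion_biUnion n s hs hF hlt, fun x hx => ?_⟩
    obtain ⟨i, -, hi⟩ := Finset.mem_biUnion.1 hx
    have hinj : Function.Injective fun i => (s i).min' (hs i) := by
      refine StrictMono.injective fun i j hij => ?_
      exact hlt i j hij _ (Finset.min'_mem _ _) _ (Finset.min'_mem _ _)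
    have := hmin _ (Finset.mem_image_of_mem _ (Finset.mem_univ i))
    rw [Finset.card_image_of_injective _ hinj, Finset.card_univ, Fintype.card_fin] at this
    exact this.trans (Finset.min'_le _ _ hi)
  · rintro ⟨k, hk, hle⟩
    obtain ⟨s, hs, hF, hlt, rfl⟩ := hk.exists_fin
    refine ⟨k, s, hs, hF, hlt, ?_, rfl⟩
    intro m hm
    obtain ⟨i, -, rfl⟩ := Finset.mem_image.1 hm
    refine Finset.card_image_le.trans ?_
    rw [Finset.card_univ, Fintype.card_fin]
    exact hle _ (Finset.mem_biUnion.2 ⟨i, Finset.mem_univ i, Finset.min'_mem _ _⟩)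

/-- The unions `s ∪ t` of a member of `F` and a later member of `G`. -/
def succSum (F G : Set (Finset ℕ)) : Set (Finset ℕ) :=
  {w | ∃ s ∈ F, ∃ t ∈ G, (∀ p ∈ s, ∀ q ∈ t, p < q) ∧ w = s ∪ t}

theorem section_succSum_subset (F G : Set (Finset ℕ)) (n : ℕ) :
    section_ (succSum F G) n ⊆ succSum (section_ F n) G ∪ section_ G n := by
  rintro w ⟨hw, s, hs, t, ht, hlt, h⟩
  have hnw : n ∉ w := fun h' => lt_irrefl _ (hw n h')
  by_cases hns : n ∈ s
  · left
    have hnt : n ∉ t := fun h' => lt_irrefl _ (hlt n hns n h')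
    refine ⟨s.erase n, ⟨?_, by rwa [Finset.insert_erase hns]⟩, t, ht,
      fun p hp => hlt p (Finset.mem_of_mem_erase hp), ?_⟩
    · intro m hm
      have : m ∈ insert n w := h ▸ Finset.mem_union_left t (Finset.mem_of_mem_erase hm)
      exact hw m (Finset.mem_of_mem_insert_of_ne this (Finset.ne_of_mem_erase hm))
    · rw [← Finset.erase_insert hnw, h, Finset.erase_union_distrib, Finset.erase_eq_of_notMem hnt]
  · right
    have hnt : n ∈ t := by
      have : n ∈ s ∪ t := h ▸ Finset.mem_insert_self n w
      exact (Finset.mem_union.1 this).resolve_left hns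
    have hs0 : s = ∅ := by
      refine Finset.eq_empty_of_forall_notMem fun p hp => ?_
      have h1 := hlt p hp n hnt
      have : p ∈ insert n w := h ▸ Finset.mem_union_left t hp
      rcases Finset.mem_insert.1 this with rfl | h2
      · exact lt_irrefl _ h1
      · exact absurd (hw p h2) h1.not_gt
    refine ⟨hw, ?_⟩
    rw [h, hs0, Finset.empty_union]
    exact ht

/-- The rank is additive in the reverse order: the members of `F` come first, so that `ρ` is used up
before `σ`. -/
theorem SecRankLE.succSum {ρ σ : Ordinal.{u}} {F G : Set (Finset ℕ)} (hF : SecRankLE ρ F)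
    (hG : SecRankLE σ G) : SecRankLE (σ + ρ) (succSum F G) := by
  induction ρ using WellFoundedLT.induction generalizing F with
  | ind ρ ih =>
    rw [secRankLE_iff] at hF ⊢
    intro n hne
    have hG' := secRankLE_iff.1 hG n
    rcases (section_ F n).eq_empty_or_nonempty with e | e
    · have hsub : section_ (LongTsirelson.succSum F G) n ⊆ section_ G n := by
        refine (section_succSum_subset F G n).trans (union_subset ?_ subset_rfl)
        rintro w ⟨s, hs, -⟩
        simp [e] at hs
      obtain ⟨σ', h1, h2⟩ := hG' (hne.mono hsub)
      exact ⟨σ', h1.trans_le le_self_add, h2.subset hsub⟩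
    · obtain ⟨ρ', h1, h2⟩ := hF n e
      refine ⟨σ + ρ', by gcongr, SecRankLE.subset (SecRankLE.union (ih ρ' h1 h2) ?_)
        (section_succSum_subset F G n)⟩
      rcases (section_ G n).eq_empty_or_nonempty with e' | e'
      · rw [e']
        exact rankLE_empty section_empty
      · obtain ⟨σ', h3, h4⟩ := hG' e'
        exact h4.mono (h3.le.trans le_self_add)

theorem SecRankLE.isSuccUnion {ρ : Ordinal.{u}} {F : Set (Finset ℕ)} (hF : SecRankLE ρ F)
    (k : ℕ) : SecRankLE (ρ * k) {w | IsSuccUnion F k w} := by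
  induction k with
  | zero =>
    rw [secRankLE_iff]
    rintro n ⟨s, -, hs⟩
    have : ∀ k w, IsSuccUnion F k w → k = 0 → w = ∅ := by
      intro k w h hk
      cases h with
      | nil => rfl
      | cons k => exact absurd hk (Nat.succ_ne_zero k)
    exact absurd (this _ _ hs rfl) (Finset.insert_ne_empty _ _)
  | succ k ih =>
    have := hF.succSum ih
    rw [← mul_add_one] at this
    refine SecRankLE.subset (by exact_mod_cast this) ?_
    intro w hw
    cases hw with
    | cons k s w hs hne hw hlt => exact ⟨s, hs, w, hw, hlt, rfl⟩

theorem SecRankGE.succSum {ρ σ : Ordinal.{u}} {F G : Set (Finset ℕ)} (hF : SecRankGE ρ F)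
    (hG : SecRankGE σ G) : SecRankGE (σ + ρ) (succSum F G) := by
  induction ρ using WellFoundedLT.induction generalizing F G with
  | ind ρ ih =>
    have hF' := secRankGE_iff.1 hF
    have hG' := secRankGE_iff.1 hG
    rcases eq_or_ne ρ 0 with rfl | h0
    · rw [add_zero]
      refine hG.mono le_rfl fun t ht => ⟨∅, hF'.1, t, ht, by simp, by simp⟩
    rw [secRankGE_iff]
    refine ⟨⟨∅, hF'.1, ∅, hG'.1, by simp, by simp⟩, fun τ hτ => ?_⟩
    obtain ⟨ρ', h1, h2⟩ := (Ordinal.lt_add_iff h0).1 hτ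
    obtain ⟨N, hN⟩ := hF'.2 ρ' h1
    refine ⟨N, fun n hn => (ih ρ' h1 (hN n hn) (hG.restrict_Ici (n + 1))).mono h2 ?_⟩
    rintro w ⟨s, ⟨hs, hsF⟩, t, ⟨ht, htn⟩, hlt, rfl⟩
    refine ⟨?_, insert n s, hsF, t, ht, ?_, ?_⟩
    · intro m hm
      rcases Finset.mem_union.1 hm with hm | hm
      · exact hs m hm
      · exact htn m hm
    · intro p hp q hq
      rcases Finset.mem_insert.1 hp with rfl | hp
      · exact htn q hq
      · exact hlt p hp q hq
    · rw [Finset.insert_union]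

theorem SecRankGE.isSuccUnion {ρ : Ordinal.{u}} {F : Set (Finset ℕ)} (hF : SecRankGE ρ F)
    (k : ℕ) : SecRankGE (ρ * k) {w | ∃ j ≤ k, IsSuccUnion F j w} := by
  induction k with
  | zero =>
    rw [Nat.cast_zero, mul_zero]
    exact secRankGE_zero ⟨0, le_rfl, IsSuccUnion.nil⟩
  | succ k ih =>
    have := hF.succSum ih
    rw [← mul_add_one] at this
    refine SecRankGE.mono this (by push_cast; exact le_rfl) ?_
    rintro w ⟨s, hs, t, ⟨j, hj, ht⟩, hlt, rfl⟩
    rcases s.eq_empty_or_nonempty with rfl | hne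
    · exact ⟨j, hj.trans (Nat.le_succ k), by simpa using ht⟩
    · exact ⟨j + 1, Nat.succ_le_succ hj, IsSuccUnion.cons j s t hs hne ht hlt⟩

namespace IsSchreierSequence

variable {S : Ordinal.{0} → Set (Finset ℕ)} (hS : IsSchreierSequence S)
include hS

/-- Together with `IsSchreierSequence.secRankGE`: the family `S α` has rank `ω ^ α`. -/
theorem secRankLE {α : Ordinal.{0}} (hα : α < ω_ 1) : SecRankLE (ω ^ α) (S α) := by
  induction α using Ordinal.limitRecOn with
  | zero =>
    rw [hS.1, Ordinal.opow_zero, secRankLE_iff]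
    rintro n -
    refine ⟨0, zero_lt_one, ?_⟩
    rw [secRankLE_iff]
    rintro m ⟨s, hs, h1, h2⟩
    have hm := h1 m (Finset.mem_insert_self m s)
    have hms : m ∉ s := fun h' => lt_irrefl _ (hs m h')
    have hns : n ∉ insert m s := fun h' => lt_irrefl _ (h1 n h')
    rw [mem_ofPred_eq, Finset.card_insert_of_notMem hns, Finset.card_insert_of_notMem hms] at h2
    omega
  | add_one α ih =>
    have hα' : α < ω_ 1 := (Order.lt_add_one_iff.2 le_rfl).trans hα
    have ih := ih hα'
    rw [hS.2.1 α hα', secRankLE_iff]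
    rintro n -
    have h := SecRankLE.iUnion_lt (ρ := ω ^ (α + 1)) (Ordinal.opow_pos _ Ordinal.omega0_pos)
      (fun k => {w | IsSuccUnion (S α) k w}) (n + 1) fun k _ _ =>
        ⟨ω ^ α * k, by
          rw [Ordinal.opow_add_one]
          exact mul_lt_mul_of_pos_left (Ordinal.natCast_lt_omega0 k)
            (Ordinal.opow_pos _ Ordinal.omega0_pos), ih.isSuccUnion k⟩
    obtain ⟨ρ', h1, h2⟩ := h
    -- the rank of a section is at most the rank of the family
    refine ⟨ρ', h1, ?_⟩
    have h3 := h2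
    rw [secRankLE_iff] at h3
    rcases (section_ (⋃ k < n + 1, {w | IsSuccUnion (S α) k w}) n).eq_empty_or_nonempty with e | e
    · refine SecRankLE.subset (rankLE_empty section_empty) (G := ∅) ?_
      rw [← e]
      rintro w ⟨hw, hm⟩
      obtain ⟨k, hk, hle⟩ := mem_prodFamily_schreier.1 hm
      refine ⟨hw, ?_⟩
      simp only [mem_iUnion]
      exact ⟨k, Nat.lt_succ_of_le (hle n (by simp)), hk⟩
    · obtain ⟨ρ'', h4, h5⟩ := h3 n e
      refine SecRankLE.subset (h5.mono h4.le) ?_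
      rintro w ⟨hw, hm⟩
      obtain ⟨k, hk, hle⟩ := mem_prodFamily_schreier.1 hm
      refine ⟨hw, ?_⟩
      simp only [mem_iUnion]
      exact ⟨k, Nat.lt_succ_of_le (hle n (by simp)), hk⟩
  | limit α hlim ih =>
    obtain ⟨a, ha, -, hSα⟩ := hS.2.2 α hα hlim
    rw [secRankLE_iff]
    rintro n -
    have h := SecRankLE.iUnion_lt (ρ := ω ^ α) (Ordinal.opow_pos _ Ordinal.omega0_pos)
      (fun k => section_ (S (a k)) n) (n + 1) fun k _ hne => by
        obtain ⟨ρ', h1, h2⟩ := secRankLE_iff.1 (ih (a k) (ha k) ((ha k).trans hα)) n hne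
        exact ⟨ρ', h1.trans_le (Ordinal.opow_le_opow_right Ordinal.omega0_pos (ha k).le), h2⟩
    obtain ⟨ρ', h1, h2⟩ := h
    refine ⟨ρ', h1, h2.subset ?_⟩
    rintro s ⟨hs, hm⟩
    rw [hSα] at hm
    obtain ⟨k, hk, hle⟩ := hm
    simp only [mem_iUnion]
    exact ⟨k, Nat.lt_succ_of_le (hle n (by simp)), hs, hk⟩

theorem secRankGE {α : Ordinal.{0}} (hα : α < ω_ 1) : SecRankGE (ω ^ α) (S α) := by
  induction α using Ordinal.limitRecOn with
  | zero =>
    rw [hS.1, Ordinal.opow_zero, secRankGE_iff]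
    refine ⟨by simp, fun ρ' h => ⟨0, fun n _ => ?_⟩⟩
    rw [Order.lt_one_iff.1 h]
    exact secRankGE_zero ⟨by simp, by simp⟩
  | add_one α ih =>
    have hα' : α < ω_ 1 := (Order.lt_add_one_iff.2 le_rfl).trans hα
    have ih := ih hα'
    rw [hS.2.1 α hα', secRankGE_iff]
    refine ⟨mem_prodFamily_schreier.2 ⟨0, IsSuccUnion.nil, by simp⟩, fun ρ' h => ?_⟩
    rw [← Order.succ_eq_add_one] at h
    obtain ⟨m, hm⟩ := Ordinal.lt_omega0_opow_succ.1 h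
    obtain ⟨N, hN⟩ := (secRankGE_iff.1 ih).2 0 (Ordinal.opow_pos _ Ordinal.omega0_pos)
    refine ⟨max N (m + 1), fun n hn =>
      ((ih.isSuccUnion m).restrict_Ici (n + 1)).mono hm.le ?_⟩
    rintro w ⟨⟨j, hj, hw⟩, hwn⟩
    refine ⟨hwn, mem_prodFamily_schreier.2 ⟨j + 1, ?_, ?_⟩⟩
    · have h1 := (secRankGE_iff.1 (hN n (le_of_max_le_left hn))).1.2
      rw [Finset.insert_eq]
      exact IsSuccUnion.cons j {n} w (by simpa using h1) (by simp) hw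
        (by simpa using fun q hq => hwn q hq)
    · intro x hx
      have h2 := le_of_max_le_right hn
      rcases Finset.mem_insert.1 hx with rfl | hx
      · omega
      · have := hwn x hx
        omega
  | limit α hlim ih =>
    obtain ⟨a, ha, hcof, hSα⟩ := hS.2.2 α hα hlim
    rw [secRankGE_iff]
    have ih' : ∀ n, SecRankGE (ω ^ a n) (S (a n)) := fun n => ih _ (ha n) ((ha n).trans hα)
    refine ⟨?_, fun ρ' h => ?_⟩
    · rw [hSα]
      exact ⟨0, (secRankGE_iff.1 (ih' 0)).1, by simp⟩
    obtain ⟨β, hβ, h1⟩ := (Ordinal.lt_opow_of_isSuccLimit Ordinal.omega0_ne_zero hlim).1 h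
    obtain ⟨j, hj⟩ := hcof β hβ
    obtain ⟨N, hN⟩ := (secRankGE_iff.1 (ih' j)).2 ρ'
      (h1.trans_le (Ordinal.opow_le_opow_right Ordinal.omega0_pos hj.le))
    refine ⟨max N j, fun n hn => (hN n (le_of_max_le_left hn)).mono le_rfl ?_⟩
    rintro s ⟨hs, hm⟩
    refine ⟨hs, ?_⟩
    rw [hSα]
    refine ⟨j, hm, fun m hm' => ?_⟩
    have h2 := le_of_max_le_right hn
    rcases Finset.mem_insert.1 hm' with rfl | hm'
    · exact h2
    · exact h2.trans (hs m hm').le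

end IsSchreierSequence

/-! ### Cantor-Bendixson ranks and ranks of trees -/

open CantorBendixson

theorem relDerivedSet_inter_isOpen {X : Type u} [TopologicalSpace X] (B : Set X) {U : Set X}
    (hU : IsOpen U) : relDerivedSet (B ∩ U) = relDerivedSet B ∩ U := by
  ext x
  simp only [relDerivedSet_apply, mem_inter_iff, mem_derivedSet]
  constructor
  · rintro ⟨h1, h2, h3⟩
    exact ⟨⟨h1.mono (principal_mono.2 inter_subset_left), h2⟩, h3⟩
  · rintro ⟨⟨h1, h2⟩, h3⟩
    refine ⟨?_, h2, h3⟩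
    rw [inter_comm]
    exact h1.nhds_inter (hU.mem_nhds h3)

theorem iteratedDerivedSet_inter_isOpen {X : Type u} [TopologicalSpace X] (B : Set X) {U : Set X}
    (hU : IsOpen U) (a : Ordinal.{u}) :
    iteratedDerivedSet (B ∩ U) a = iteratedDerivedSet B a ∩ U := by
  induction a using Ordinal.limitRecOn with
  | zero => simp
  | add_one a ih => rw [iteratedDerivedSet_succ, iteratedDerivedSet_succ, ih,
      relDerivedSet_inter_isOpen _ hU]
  | limit a ha ih =>
    rw [iteratedDerivedSet_limit ha, iteratedDerivedSet_limit ha]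
    ext x
    simp only [mem_iInter, mem_inter_iff]
    constructor
    · intro h
      refine ⟨fun b => ?_, ?_⟩
      · have := h b
        rw [ih b b.2] at this
        exact this.1
      · have := h ⟨0, ha.bot_lt⟩
        rw [ih 0 ha.bot_lt] at this
        exact this.2
    · rintro ⟨h1, h2⟩ b
      rw [ih b b.2]
      exact ⟨h1 b, h2⟩

theorem relDerivedSet_eq_empty_of_subset_singleton {X : Type u} [TopologicalSpace X] {B : Set X}
    {x : X} (h : B ⊆ {x}) : relDerivedSet B = ∅ := by
  refine eq_empty_of_forall_notMem fun y hy => ?_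
  obtain ⟨z, hz, hne⟩ := accPt_iff_nhds.1 hy.1 univ univ_mem
  exact hne ((h hz.2).trans (h hy.2).symm)

theorem iteratedDerivedSet_subset_self {X : Type u} [TopologicalSpace X] (B : Set X)
    (a : Ordinal.{u}) : iteratedDerivedSet B a ⊆ B := by
  have := iteratedDerivedSet_antitone B (zero_le (a := a))
  rwa [iteratedDerivedSet_zero] at this

theorem rk_le_of_iteratedDerivedSet_eq_empty {I : Type u} {F : Set (Finset I)} {ρ : Ordinal.{u}}
    (h : iteratedDerivedSet (charSet F) (ρ + 1) = ∅) : rk F ≤ ρ := by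
  rw [rk, Ordinal.pred_le_iff_le_succ]
  refine csInf_le' ?_
  rw [mem_ofPred_eq, Order.succ_eq_add_one, iteratedDerivedSet_succ, h, relDerivedSet_apply,
    inter_empty]

theorem rk_singleton_empty {I : Type u} : rk ({∅} : Set (Finset I)) ≤ 0 := by
  apply rk_le_of_iteratedDerivedSet_eq_empty
  rw [iteratedDerivedSet_succ, iteratedDerivedSet_zero, charSet, image_singleton]
  exact relDerivedSet_eq_empty_of_subset_singleton subset_rfl

/-- The set of the points of `2^ω` whose restriction to `[0, b)` is the characteristic function
of `v`. -/
def initialCylinder (v : Finset ℕ) (b : ℕ) : Set (ℕ → Bool) :=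
  {x | ∀ i < b, x i = decide (i ∈ v)}

theorem isOpen_initialCylinder (v : Finset ℕ) (b : ℕ) : IsOpen (initialCylinder v b) := by
  have : initialCylinder v b = ⋂ i ∈ Finset.range b, {x | x i = decide (i ∈ v)} := by
    ext x
    simp [initialCylinder]
  rw [this]
  refine isOpen_biInter_finset fun i _ => ?_
  exact (isOpen_discrete {decide (i ∈ v)}).preimage
    (continuous_apply i : Continuous fun x : ℕ → Bool => x i)

theorem boolIndicator_eq_decide {I : Type*} (s : Finset I) (i : I) [Decidable (i ∈ s)] :
    (s : Set I).boolIndicator i = decide (i ∈ s) := by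
  rw [Bool.eq_iff_iff, ← Set.mem_iff_boolIndicator]
  simp

/-- The members of `F` that begin with `v` correspond to a clopen set; after `ρ` derivations at most
the point `v` remains of it, if the rank of the family of the continuations of `v` is at most `ρ`. -/
theorem iteratedDerivedSet_cylinder_subset {F : Set (Finset ℕ)} {ρ : Ordinal.{0}}
    (v : Finset ℕ) (b : ℕ) (hv : ∀ i ∈ v, i < b)
    (h : SecRankLE ρ {s | (∀ m ∈ s, b ≤ m) ∧ s ∪ v ∈ F}) :
    iteratedDerivedSet (charSet F ∩ initialCylinder v b) ρ ⊆ {(v : Set ℕ).boolIndicator} := by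
  induction ρ using WellFoundedLT.induction generalizing v b with
  | ind ρ ih =>
    intro x hx
    by_contra hne
    have hxA := iteratedDerivedSet_subset_self _ _ hx
    obtain ⟨⟨s, hs, rfl⟩, hcyl⟩ := hxA
    have hcyl' : ∀ i < b, (i ∈ s ↔ i ∈ v) := by
      intro i hi
      have := hcyl i hi
      simp only [boolIndicator_eq_decide] at this
      exact decide_eq_decide.1 this
    have hvs : v ⊆ s := fun i hi => (hcyl' i (hv i hi)).2 hi
    have hsv : (s \ v).Nonempty := by
      rw [Finset.sdiff_nonempty]
      intro hsub
      exact hne (by rw [Finset.Subset.antisymm hsub hvs]; rfl)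
    set n := (s \ v).min' hsv with hn
    have hnm : n ∈ s \ v := Finset.min'_mem _ _
    rw [Finset.mem_sdiff] at hnm
    have hbn : b ≤ n := by
      by_contra hlt
      exact hnm.2 ((hcyl' n (not_le.1 hlt)).1 hnm.1)
    have hmin : ∀ i ∈ s, i < n → i ∈ v := by
      intro i hi hin
      by_contra hiv
      exact absurd (Finset.min'_le _ i (Finset.mem_sdiff.2 ⟨hi, hiv⟩)) hin.not_ge
    have hsec : {t | (∀ m ∈ t, n + 1 ≤ m) ∧ t ∪ insert n v ∈ F} ⊆
        section_ {s | (∀ m ∈ s, b ≤ m) ∧ s ∪ v ∈ F} n := by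
      rintro t ⟨ht, htF⟩
      refine ⟨ht, ?_, ?_⟩
      · intro m hm
        rcases Finset.mem_insert.1 hm with rfl | hm
        · exact hbn
        · exact hbn.trans ((Nat.le_succ n).trans (ht m hm))
      · rwa [Finset.insert_union, ← Finset.union_insert]
    have hts : (s \ insert n v) ∪ insert n v = s :=
      Finset.sdiff_union_of_subset (Finset.insert_subset hnm.1 hvs)
    have hmem : s \ insert n v ∈ {t | (∀ m ∈ t, n + 1 ≤ m) ∧ t ∪ insert n v ∈ F} := by
      refine ⟨fun m hm => ?_, by rwa [hts]⟩
      rw [Finset.mem_sdiff, Finset.mem_insert, not_or] at hm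
      by_contra hlt
      exact hm.2.2 (hmin m hm.1 (by omega))
    obtain ⟨ρ', h1, h2⟩ := secRankLE_iff.1 h n ⟨_, hsec hmem⟩
    have h3 := ih ρ' h1 (insert n v) (n + 1) (by
      intro i hi
      rcases Finset.mem_insert.1 hi with rfl | hi
      · omega
      · have := hv i hi
        omega) (h2.subset hsec)
    have h4 : iteratedDerivedSet (charSet F ∩ initialCylinder (insert n v) (n + 1)) ρ = ∅ := by
      have h5 := iteratedDerivedSet_antitone (charSet F ∩ initialCylinder (insert n v) (n + 1))
        (Order.add_one_le_of_lt h1)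
      rw [iteratedDerivedSet_succ, relDerivedSet_eq_empty_of_subset_singleton h3] at h5
      exact Set.subset_empty_iff.1 h5
    have h6 : (s : Set ℕ).boolIndicator ∈ initialCylinder (insert n v) (n + 1) := by
      intro i hi
      simp only [boolIndicator_eq_decide]
      rw [decide_eq_decide, Finset.mem_insert]
      constructor
      · intro his
        rcases (Nat.lt_succ_iff.1 hi).eq_or_lt with rfl | hlt
        · exact Or.inl rfl
        · exact Or.inr (hmin i his hlt)
      · rintro (rfl | hi')
        · exact hnm.1
        · exact hvs hi'
    have h7 : (s : Set ℕ).boolIndicator ∈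
        iteratedDerivedSet (charSet F ∩ initialCylinder (insert n v) (n + 1)) ρ := by
      rw [iteratedDerivedSet_inter_isOpen _ (isOpen_initialCylinder _ _)] at hx ⊢
      exact ⟨hx.1, h6⟩
    rw [h4] at h7
    exact h7

/-- The rank defined by sections bounds the Cantor–Bendixson rank of a family on `ℕ`. -/
theorem SecRankLE.rk_le {F : Set (Finset ℕ)} {ρ : Ordinal.{0}} (h : SecRankLE ρ F) : rk F ≤ ρ := by
  apply rk_le_of_iteratedDerivedSet_eq_empty
  have h1 := iteratedDerivedSet_cylinder_subset (F := F) ∅ 0 (by simp) (ρ := ρ) (by simpa using h)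
  have h2 : initialCylinder ∅ 0 = univ := by
    ext x
    simp [initialCylinder]
  rw [h2, inter_univ] at h1
  rw [iteratedDerivedSet_succ]
  exact relDerivedSet_eq_empty_of_subset_singleton h1

theorem restrict_univ {I : Type u} (F : Set (Finset I)) : restrict F univ = F := by
  simp [restrict]

theorem srk_le_rk {P : Type u} [LinearOrder P] [Infinite P] (F : Set (Finset P)) :
    srk F ≤ rk F :=
  csInf_le' ⟨univ, infinite_univ, isChain_of_trichotomous _, by rw [restrict_univ]⟩

/-- The link `{t : {ξ} ∪ t ∈ F}` of the point `ξ` in the family `F`. -/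
def link {I : Type*} [DecidableEq I] (ξ : I) (F : Set (Finset I)) : Set (Finset I) :=
  {t | insert ξ t ∈ F}

section link

variable {I : Type*} [DecidableEq I]

theorem link_mono (ξ : I) (F G : Set (Finset I)) (h : F ⊆ G) : link ξ F ⊆ link ξ G :=
  fun _ ht => h ht

theorem link_union (ξ : I) (F G : Set (Finset I)) : link ξ (F ∪ G) ⊆ link ξ F ∪ link ξ G :=
  subset_rfl

theorem link_empty (ξ : I) : link ξ (∅ : Set (Finset I)) = ∅ := rfl

end link

theorem exists_maximal_of_isClosed {I : Type u} {B : Set (I → Bool)} (hB : IsClosed B)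
    (hne : B.Nonempty) : ∃ m, Maximal (· ∈ B) m := by
  obtain ⟨x, hx⟩ := hne
  have key : ∀ c ⊆ B, IsChain (· ≤ ·) c → ∀ y ∈ c, ∃ ub ∈ B, ∀ z ∈ c, z ≤ ub := by
    intro c hc hchain y hy
    classical
    let z : I → Bool := fun i => decide (∃ x ∈ c, x i = true)
    refine ⟨z, ?_, fun x hx i => ?_⟩
    · have : Nonempty c := ⟨⟨y, hy⟩⟩
      have : IsDirectedOrder c := ⟨fun a b => by
        rcases hchain.total a.2 b.2 with h | h
        · exact ⟨b, h, le_rfl⟩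
        · exact ⟨a, le_rfl, h⟩⟩
      have ht : Tendsto (fun x : c => (x : I → Bool)) atTop (𝓝 z) := by
        rw [tendsto_pi_nhds]
        intro i
        refine tendsto_nhds_of_eventually_eq ?_
        by_cases hi : ∃ x ∈ c, x i = true
        · obtain ⟨x, hxc, hxi⟩ := hi
          filter_upwards [eventually_ge_atTop (⟨x, hxc⟩ : c)] with w hw
          have h1 : x i ≤ w.1 i := hw i
          rw [hxi] at h1
          have h2 : w.1 i = true := by
            revert h1
            cases w.1 i <;> simp
          rw [h2]
          exact (decide_eq_true ⟨x, hxc, hxi⟩).symm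
        · refine Eventually.of_forall fun w => ?_
          have h1 : z i = false := decide_eq_false hi
          rw [h1]
          by_contra h2
          exact hi ⟨w, w.2, by simpa using h2⟩
      exact hB.mem_of_tendsto ht (Eventually.of_forall fun w => hc w.2)
    · by_cases hi : x i = true
      · have : z i = true := decide_eq_true ⟨x, hx, hi⟩
        rw [this]
        exact Bool.le_true _
      · rw [Bool.not_eq_true] at hi
        rw [hi]
        exact Bool.false_le _
  obtain ⟨m, -, hm⟩ := zorn_le_nonempty₀ B key x hx
  exact ⟨m, hm⟩

theorem isOpen_setOf_apply_eq_true {I : Type u} (ξ : I) : IsOpen {x : I → Bool | x ξ = true} :=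
  (isOpen_discrete {true}).preimage (continuous_apply ξ : Continuous fun x : I → Bool => x ξ)

/-- A closed set of finite sets is scattered: its maximal elements are isolated. -/
theorem eq_empty_of_relDerivedSet_eq {I : Type u} {B : Set (I → Bool)} (hB : IsClosed B)
    (hfin : ∀ x ∈ B, {i | x i = true}.Finite) (h : relDerivedSet B = B) : B = ∅ := by
  by_contra hne
  obtain ⟨m, hm, hmax⟩ := exists_maximal_of_isClosed hB (nonempty_iff_ne_empty.2 hne)
  have hm' : m ∈ B := hm
  rw [← h] at hm'
  have hU : (⋂ i ∈ {i | m i = true}, {x : I → Bool | x i = true}) ∈ 𝓝 m := by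
    refine ((hfin m hm).isOpen_biInter fun i _ => isOpen_setOf_apply_eq_true i).mem_nhds ?_
    simp
  obtain ⟨y, ⟨hyU, hyB⟩, hym⟩ := accPt_iff_nhds.1 hm'.1 _ hU
  have hle : m ≤ y := by
    intro i
    by_cases hi : m i = true
    · have : y i = true := by
        simp only [mem_iInter] at hyU
        exact hyU i hi
      rw [this]
      exact Bool.le_true _
    · rw [Bool.not_eq_true] at hi
      rw [hi]
      exact Bool.false_le _
  exact hym (le_antisymm (hmax hyB hle) hle)

theorem finite_of_mem_charSet {I : Type u} {F : Set (Finset I)} {x : I → Bool}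
    (hx : x ∈ charSet F) : {i | x i = true}.Finite := by
  obtain ⟨s, -, rfl⟩ := hx
  refine s.finite_toSet.subset fun i hi => ?_
  exact (Set.mem_iff_boolIndicator _ _).2 hi

theorem iteratedDerivedSet_rk_add_one {I : Type u} {F : Set (Finset I)}
    (hF : IsCompactFamily F) : iteratedDerivedSet (charSet F) (rk F + 1) = ∅ := by
  have hne : {α | iteratedDerivedSet (charSet F) (α + 1) =
      iteratedDerivedSet (charSet F) α}.Nonempty := by
    obtain ⟨a, ha⟩ := iteratedDerivedSet_mem_fixedPoints (charSet F)
    exact ⟨a, by rw [mem_ofPred_eq, iteratedDerivedSet_succ]; exact ha⟩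
  have h1 : iteratedDerivedSet (charSet F) (cbRank (charSet F) + 1) =
      iteratedDerivedSet (charSet F) (cbRank (charSet F)) := csInf_mem hne
  have h2 : iteratedDerivedSet (charSet F) (cbRank (charSet F)) = ∅ := by
    refine eq_empty_of_relDerivedSet_eq (isClosed_iteratedDerivedSet hF _) (fun x hx => ?_) ?_
    · exact finite_of_mem_charSet (iteratedDerivedSet_subset_self _ _ hx)
    · rw [← iteratedDerivedSet_succ, h1]
  have h3 := iteratedDerivedSet_antitone (charSet F)
    (Ordinal.self_le_succ_pred (cbRank (charSet F)))
  rw [h2] at h3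
  exact Set.subset_empty_iff.1 h3

/-- A closed set of finite sets whose derivative of order `ρ + 1` is empty has a tree of links of
rank at most `ρ`. -/
theorem rankLE_link_of_iteratedDerivedSet_eq_empty {I : Type u} [DecidableEq I] {ρ : Ordinal.{u}}
    {B : Set (I → Bool)} (hB : IsClosed B) (hfin : ∀ x ∈ B, {i | x i = true}.Finite)
    (h : iteratedDerivedSet B (ρ + 1) = ∅) (v : Finset I) :
    RankLE cofinite link ρ {t : Finset I | ((t ∪ v : Finset I) : Set I).boolIndicator ∈ B} := by
  induction ρ using WellFoundedLT.induction generalizing B v with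
  | ind ρ ih =>
    have hcl := isClosed_iteratedDerivedSet hB ρ
    have hfinite : (iteratedDerivedSet B ρ).Finite := by
      by_contra hinf
      obtain ⟨x, hx, hacc⟩ :=
        Set.Infinite.exists_accPt_of_subset_isCompact hinf hcl.isCompact subset_rfl
      have : x ∈ iteratedDerivedSet B (ρ + 1) := by
        rw [iteratedDerivedSet_succ]
        exact ⟨hacc, hx⟩
      rw [h] at this
      exact this
    have hA : (⋃ x ∈ iteratedDerivedSet B ρ, {i | x i = true}).Finite :=
      hfinite.biUnion fun x hx => hfin x (iteratedDerivedSet_subset_self _ _ hx)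
    rw [rankLE_iff]
    filter_upwards [hA.compl_mem_cofinite] with ξ hξ hne
    have hlink : link ξ {t : Finset I | ((t ∪ v : Finset I) : Set I).boolIndicator ∈ B} =
        {t : Finset I | ((t ∪ insert ξ v : Finset I) : Set I).boolIndicator ∈
          B ∩ {x | x ξ = true}} := by
      ext t
      simp only [link, mem_ofPred_eq, mem_inter_iff]
      rw [Finset.insert_union, ← Finset.union_insert]
      refine (and_iff_left ?_).symm
      exact (Set.mem_iff_boolIndicator _ _).1 (by simp)
    set B' := B ∩ {x : I → Bool | x ξ = true} with hB'
    have hB'c : IsClosed B' :=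
      hB.inter ((isClosed_discrete {true}).preimage
        (continuous_apply ξ : Continuous fun x : I → Bool => x ξ))
    have hB'e : iteratedDerivedSet B' ρ = ∅ := by
      rw [hB', iteratedDerivedSet_inter_isOpen _ (isOpen_setOf_apply_eq_true ξ)]
      refine eq_empty_of_forall_notMem fun x hx => hξ ?_
      exact mem_biUnion hx.1 hx.2
    have hB'ne : B'.Nonempty := by
      rw [hlink] at hne
      obtain ⟨t, ht⟩ := hne
      exact ⟨_, ht⟩
    -- the least stage at which the derivatives of `B'` vanish is a successor, by compactness
    set γ := sInf {a | iteratedDerivedSet B' a = ∅} with hγ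
    have hγe : iteratedDerivedSet B' γ = ∅ :=
      csInf_mem (s := {a | iteratedDerivedSet B' a = ∅}) ⟨ρ, hB'e⟩
    have hγρ : γ ≤ ρ := csInf_le' hB'e
    have hlt : ∀ b < γ, (iteratedDerivedSet B' b).Nonempty := by
      intro b hb
      rw [nonempty_iff_ne_empty]
      exact notMem_of_lt_csInf' (s := {a | iteratedDerivedSet B' a = ∅}) hb
    obtain ⟨ρ', h1, h2⟩ : ∃ ρ' < ρ, iteratedDerivedSet B' (ρ' + 1) = ∅ := by
      rcases Ordinal.zero_or_succ_or_isSuccLimit γ with h0 | ⟨ρ', h0⟩ | hlim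
      · rw [h0, iteratedDerivedSet_zero] at hγe
        exact absurd hγe hB'ne.ne_empty
      · refine ⟨ρ', (Order.lt_succ ρ').trans_le (h0.trans_le hγρ), ?_⟩
        rw [← Order.succ_eq_add_one, h0, hγe]
      · rw [iteratedDerivedSet_limit hlim] at hγe
        have : Nonempty (Iio γ) := ⟨⟨0, hlim.bot_lt⟩⟩
        have := IsCompact.nonempty_iInter_of_directed_nonempty_isCompact_isClosed
          (fun b : Iio γ => iteratedDerivedSet B' b)
          (fun a b => ⟨max a b, iteratedDerivedSet_antitone _ (le_max_left _ _),
            iteratedDerivedSet_antitone _ (le_max_right _ _)⟩)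
          (fun b => hlt b b.2) (fun b => (isClosed_iteratedDerivedSet hB'c b).isCompact)
          (fun b => isClosed_iteratedDerivedSet hB'c b)
        rw [hγe] at this
        exact absurd this (by simp)
    refine ⟨ρ', h1, ?_⟩
    rw [hlink]
    exact ih ρ' h1 hB'c (fun x hx => hfin x hx.1) h2 (insert ξ v)

theorem IsCompactFamily.rankLE_link {I : Type u} [DecidableEq I] {F : Set (Finset I)}
    (hF : IsCompactFamily F) : RankLE cofinite link (rk F) F := by
  have h := rankLE_link_of_iteratedDerivedSet_eq_empty hF
    (fun x hx => finite_of_mem_charSet hx) (iteratedDerivedSet_rk_add_one hF) ∅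
  refine RankLE.subset (fun i F G h => link_mono i F G h) h fun t ht => ?_
  exact ⟨t, ht, by simp⟩

/-! ### Small averages along trees -/

section Averages

variable {I : Type*} {E : Type*} [AddCommGroup E] [Module ℝ E]

/-- The rank function of a hereditary family whose tree of links has a rank. -/
noncomputable def linkRank [DecidableEq I] (l : Filter I) (F : Set (Finset I))
    (t : Finset I) : Ordinal.{u} :=
  sInf {ρ | RankLE l link ρ {s | s ∪ t ∈ F}}

section linkRank

variable [DecidableEq I] {l : Filter I} {F : Set (Finset I)} (hF : IsHereditary F)
include hF

theorem rankLE_linkRank {ρ : Ordinal.{u}} (h : RankLE l link ρ F) (t : Finset I) :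
    RankLE l link (linkRank.{u} l F t) {s | s ∪ t ∈ F} := by
  refine csInf_mem (s := {ρ : Ordinal.{u} | RankLE l link ρ {s | s ∪ t ∈ F}}) ⟨ρ, ?_⟩
  exact RankLE.subset (fun i F G h => link_mono i F G h) h
    fun _ hs => hF _ hs _ Finset.subset_union_left

theorem linkRank_anti {ρ : Ordinal.{u}} (h : RankLE l link ρ F) {u t : Finset I} (hut : u ⊆ t) :
    linkRank.{u} l F t ≤ linkRank.{u} l F u :=
  csInf_le' (RankLE.subset (fun i F G h => link_mono i F G h) (rankLE_linkRank hF h u)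
    fun _ hs => hF _ hs _ (Finset.union_subset_union_right hut))

/-- Almost every one-point extension of `t` inside `F` lowers the rank of `t`. -/
theorem eventually_linkRank_insert_lt {ρ : Ordinal.{u}} (h : RankLE l link ρ F) (t : Finset I) :
    ∀ᶠ ξ in l, insert ξ t ∈ F → linkRank.{u} l F (insert ξ t) < linkRank.{u} l F t := by
  filter_upwards [rankLE_iff.1 (rankLE_linkRank hF h t)] with ξ hξ hmem
  have hlink : link ξ {s | s ∪ t ∈ F} = {s | s ∪ insert ξ t ∈ F} := by
    ext s
    simp only [link, mem_ofPred_eq]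
    rw [Finset.insert_union, ← Finset.union_insert]
  rw [hlink] at hξ
  obtain ⟨ρ', h1, h2⟩ := hξ ⟨∅, by simpa using hmem⟩
  exact (csInf_le' (s := {ρ | RankLE l link ρ {s | s ∪ insert ξ t ∈ F}}) h2).trans_lt h1

end linkRank

/-- The mass that the finitely supported vector `π z` gives to the finite set `t`. -/
noncomputable def mass (π : E →ₗ[ℝ] (I →₀ ℝ)) (z : E) (t : Finset I) : ℝ := ∑ ξ ∈ t, |π z ξ|

theorem mass_add_le (π : E →ₗ[ℝ] (I →₀ ℝ)) (y z : E) (t : Finset I) :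
    mass π (y + z) t ≤ mass π y t + mass π z t := by
  rw [mass, mass, mass, ← Finset.sum_add_distrib]
  refine Finset.sum_le_sum fun ξ _ => ?_
  rw [map_add, Finsupp.add_apply]
  exact abs_add_le _ _

theorem mass_smul (π : E →ₗ[ℝ] (I →₀ ℝ)) {a : ℝ} (ha : 0 ≤ a) (z : E) (t : Finset I) :
    mass π (a • z) t = a * mass π z t := by
  rw [mass, mass, Finset.mul_sum]
  refine Finset.sum_congr rfl fun ξ _ => ?_
  rw [map_smul, Finsupp.smul_apply, smul_eq_mul, abs_mul, abs_of_nonneg ha]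

theorem mass_eq_zero (π : E →ₗ[ℝ] (I →₀ ℝ)) {z : E} {t : Finset I}
    (h : ∀ ξ ∈ t, π z ξ = 0) : mass π z t = 0 :=
  Finset.sum_eq_zero fun ξ hξ => by rw [h ξ hξ, abs_zero]

/-- An abstract tree of finite sets of vectors of `K`: `D ρ L` says that the set `L` of vectors
already chosen has rank at least `ρ` in the tree. Vectors may be replaced by convex combinations,
and a new vector may be chosen with support in any member of the filter `l`. -/
structure IsVectorTree (π : E →ₗ[ℝ] (I →₀ ℝ)) (l : Filter I) (K : Set E)
    (D : Ordinal.{u} → Set E → Prop) : Prop where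
  mono : ∀ ρ ρ' L L', D ρ L → ρ' ≤ ρ → L' ⊆ convexHull ℝ L → D ρ' L'
  extend : ∀ ρ ρ' L, D ρ L → ρ' < ρ → ∀ U ∈ l,
    ∃ z ∈ K, (∀ ξ, π z ξ ≠ 0 → ξ ∈ U) ∧ D ρ' (insert z L)

/-- Finitely many strict inequalities below `ω ^ β` hold below `ω ^ β' * k` for a common `β' < β`
and a common `k`. -/
theorem exists_opow_mul_bound {J : Type*} (𝒰 : Finset J) (r σ : J → Ordinal.{u}) {β : Ordinal.{u}}
    (hβ : β ≠ 0) (h : ∀ p ∈ 𝒰, r p < σ p + ω ^ β) :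
    ∃ β' < β, ∃ k : ℕ, ∀ p ∈ 𝒰, r p < σ p + ω ^ β' * k := by
  have key : ∀ p ∈ 𝒰, ∃ c < β, ∃ n : ℕ, r p < σ p + ω ^ c * n := by
    intro p hp
    obtain ⟨d, hd, h1⟩ := (Ordinal.lt_add_iff (Ordinal.opow_pos _ Ordinal.omega0_pos).ne').1 (h p hp)
    obtain ⟨c, hc, n, hn⟩ := (Ordinal.lt_omega0_opow hβ).1 hd
    exact ⟨c, hc, n, h1.trans_lt (by gcongr)⟩
  choose! c hc n hn using key
  refine ⟨𝒰.sup c, (Finset.sup_lt_iff (bot_lt_iff_ne_bot.2 hβ)).2 hc, 𝒰.sup n, fun p hp => ?_⟩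
  refine (hn p hp).trans_le ?_
  refine add_le_add le_rfl (mul_le_mul' ?_ ?_)
  · exact Ordinal.opow_le_opow_right Ordinal.omega0_pos (Finset.le_sup (f := c) hp)
  · exact_mod_cast Finset.le_sup (f := n) hp

/-- In a tree of rank `ω ^ β` there is an average which is small on each member `t ⊇ u` of the
family `F`, unless `t` already meets the support of the average so often that the rank of the part
of `t` seen so far has dropped below the prescribed threshold `σ`. -/
theorem exists_average_mass_le_or_rank_lt [DecidableEq I] {π : E →ₗ[ℝ] (I →₀ ℝ)} {l : Filter I}
    {K : Set E} {D : Ordinal.{u} → Set E → Prop} (hD : IsVectorTree π l K D) (hK : Convex ℝ K)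
    {F : Set (Finset I)} (hF : IsHereditary F) {M : ℝ} (hM : 0 ≤ M)
    (hKM : ∀ z ∈ K, ∀ t ∈ F, mass π z t ≤ M) {r : Finset I → Ordinal.{u}}
    (hanti : ∀ u t, u ⊆ t → r t ≤ r u)
    (hr : ∀ u, ∀ᶠ ξ in l, insert ξ u ∈ F → r (insert ξ u) < r u)
    (β τ : Ordinal.{u}) (L : Set E) (hL : D (τ + ω ^ β) L) (U : Set I) (hU : U ∈ l)
    (ε : ℝ) (hε : 0 < ε) (𝒰 : Finset (Finset I × Ordinal.{u}))
    (h𝒰 : ∀ p ∈ 𝒰, r p.1 < p.2 + ω ^ β) :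
    ∃ w ∈ K, ∃ S : Finset I, (S : Set I) ⊆ U ∧ (∀ ξ, π w ξ ≠ 0 → ξ ∈ S) ∧ D τ (insert w L) ∧
      ∀ p ∈ 𝒰, ∀ t ∈ F, p.1 ⊆ t → mass π w t ≤ ε ∨ r (p.1 ∪ (t ∩ S)) < p.2 := by
  classical
  induction β using WellFoundedLT.induction generalizing τ L U ε 𝒰 with
  | ind β ih =>
  rcases eq_or_ne β 0 with rfl | hβ
  · have hU' : U ∩ {ξ | ∀ p ∈ 𝒰, insert ξ p.1 ∈ F → r (insert ξ p.1) < r p.1} ∈ l :=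
      inter_mem hU ((Filter.eventually_all_finset 𝒰).2 fun p _ => hr p.1)
    obtain ⟨z, hz, hzU, hzD⟩ := hD.extend (τ + ω ^ (0 : Ordinal.{u})) τ L hL (by simp) _ hU'
    refine ⟨z, hz, (π z).support, ?_, fun ξ hξ => Finsupp.mem_support_iff.2 hξ, hzD, ?_⟩
    · intro ξ hξ
      exact (hzU ξ (Finsupp.mem_support_iff.1 hξ)).1
    · intro p hp t ht hpt
      rcases (t ∩ (π z).support).eq_empty_or_nonempty with e | ⟨ξ, hξ⟩
      · left
        rw [mass_eq_zero π]
        · exact hε.le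
        · intro ξ hξ
          by_contra h
          have : ξ ∈ t ∩ (π z).support := Finset.mem_inter.2 ⟨hξ, Finsupp.mem_support_iff.2 h⟩
          rw [e] at this
          simp at this
      · right
        have hξ' := Finset.mem_inter.1 hξ
        have h1 := (hzU ξ (Finsupp.mem_support_iff.1 hξ'.2)).2 p hp
          (hF t ht _ (Finset.insert_subset hξ'.1 hpt))
        have h2 : r (p.1 ∪ (t ∩ (π z).support)) ≤ r (insert ξ p.1) :=
          hanti _ _ (Finset.insert_subset (Finset.mem_union_right _ hξ) Finset.subset_union_left)
        have h3 := h𝒰 p hp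
        rw [Ordinal.opow_zero] at h3
        exact (h2.trans_lt h1).trans_le (Order.lt_add_one_iff.1 h3)
  · obtain ⟨β', hβ', k, hk⟩ := exists_opow_mul_bound 𝒰 (fun p => r p.1) (fun p => p.2) hβ h𝒰
    obtain ⟨n, hn⟩ := exists_nat_ge (2 * ((k + 1) * M) / ε)
    -- each of the `n` averages added is small on `t`, up to at most `k` exceptions
    have key : ∀ i q : ℕ, n = q + i → ∃ m ∈ K, ∃ S : Finset I, (S : Set I) ⊆ U ∧
        (∀ ξ, π m ξ ≠ 0 → ξ ∈ S) ∧ D (τ + ω ^ β' * q) (insert m L) ∧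
        ∀ p ∈ 𝒰, ∀ t ∈ F, p.1 ⊆ t → ∃ j ≤ k, r (p.1 ∪ (t ∩ S)) < p.2 + ω ^ β' * j ∧
          (0 < j → (i + 1 : ℝ) * mass π m t ≤ (k - j + 1) * M + i * (ε / 2)) := by
      intro i
      induction i with
      | zero =>
        intro q _
        have hlt : τ + ω ^ β' * (q : Ordinal.{u}) < τ + ω ^ β := by
          gcongr
          exact (Ordinal.lt_omega0_opow hβ).2 ⟨β', hβ', q + 1, by
            have := Ordinal.opow_pos β' Ordinal.omega0_pos
            gcongr
            exact Nat.lt_succ_self q⟩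
        obtain ⟨z, hz, hzU, hzD⟩ := hD.extend _ _ L hL hlt U hU
        refine ⟨z, hz, (π z).support, fun ξ hξ => hzU ξ (Finsupp.mem_support_iff.1 hξ),
          fun ξ hξ => Finsupp.mem_support_iff.2 hξ, hzD, fun p hp t ht hpt => ⟨k, le_rfl, ?_, ?_⟩⟩
        · exact (hanti _ _ Finset.subset_union_left).trans_lt (hk p hp)
        · intro _
          have := hKM z hz t ht
          simp only [Nat.cast_zero]
          linarith
      | succ i ihi =>
        rintro q hq
        obtain ⟨m, hm, S, hSU, hmS, hmD, hinv⟩ := ihi (q + 1) (by omega)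
        let 𝒰' : Finset (Finset I × Ordinal.{u}) :=
          ((𝒰 ×ˢ (Finset.range k ×ˢ S.powerset)).image
            fun x => (x.1.1 ∪ x.2.2, x.1.2 + ω ^ β' * (x.2.1 : Ordinal.{u}))).filter
              fun p => r p.1 < p.2 + ω ^ β'
        have hmD' : D ((τ + ω ^ β' * q) + ω ^ β') (insert m L) := by
          rw [add_assoc, ← mul_add_one]
          exact_mod_cast hmD
        obtain ⟨z, hz, S', hS'U, hzS', hzD, hz𝒰⟩ := ih β' hβ' _ _ hmD' U hU (ε / 2) (half_pos hε) 𝒰'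
          (fun p hp => (Finset.mem_filter.1 hp).2)
        have hi : (0 : ℝ) < i + 2 := by positivity
        have hcomb : ∀ s : Set E, Convex ℝ s → m ∈ s → z ∈ s →
            ((i + 1 : ℝ) / (i + 2)) • m + ((1 : ℝ) / (i + 2)) • z ∈ s := by
          intro s hs h1 h2
          refine hs h1 h2 (by positivity) (by positivity) ?_
          field_simp
          ring
        refine ⟨_, hcomb K hK hm hz, S ∪ S', ?_, ?_, ?_, ?_⟩
        · rw [Finset.coe_union]
          exact union_subset hSU hS'U
        · intro ξ hξ
          rw [Finset.mem_union]
          by_contra hnot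
          rw [not_or] at hnot
          have h1 : π m ξ = 0 := by_contra fun h => hnot.1 (hmS ξ h)
          have h2 : π z ξ = 0 := by_contra fun h => hnot.2 (hzS' ξ h)
          apply hξ
          simp [h1, h2]
        · refine hD.mono _ _ _ _ hzD le_rfl (insert_subset ?_ ?_)
          · exact hcomb _ (convex_convexHull ℝ _) (subset_convexHull ℝ _ (by simp))
              (subset_convexHull ℝ _ (by simp))
          · exact (fun x hx => subset_convexHull ℝ _ (by simp [hx]))
        · intro p hp t ht hpt
          obtain ⟨j, hj, hrj, hbound⟩ := hinv p hp t ht hpt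
          have hx : p.1 ∪ (t ∩ S) ⊆ t := Finset.union_subset hpt Finset.inter_subset_left
          have hunion : p.1 ∪ (t ∩ (S ∪ S')) = (p.1 ∪ (t ∩ S)) ∪ (t ∩ S') := by
            rw [Finset.inter_union_distrib_left, Finset.union_assoc]
          have hmass : ((i + 1 : ℕ) + 1 : ℝ) *
              mass π (((i + 1 : ℝ) / (i + 2)) • m + ((1 : ℝ) / (i + 2)) • z) t ≤
              (i + 1) * mass π m t + mass π z t := by
            have h1 := mass_add_le π (((i + 1 : ℝ) / (i + 2)) • m) (((1 : ℝ) / (i + 2)) • z) t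
            rw [mass_smul π (by positivity), mass_smul π (by positivity)] at h1
            have h2 := mul_le_mul_of_nonneg_left h1 hi.le
            have h3 : ((i : ℝ) + 2) * ((i + 1) / (i + 2) * mass π m t + 1 / (i + 2) * mass π z t) =
                (i + 1) * mass π m t + mass π z t := by
              field_simp
            rw [h3] at h2
            refine le_trans (le_of_eq ?_) h2
            push_cast
            ring
          rw [hunion]
          have hle : r ((p.1 ∪ (t ∩ S)) ∪ (t ∩ S')) ≤ r (p.1 ∪ (t ∩ S)) :=
            hanti _ _ Finset.subset_union_left
          rcases Nat.eq_zero_or_pos j with rfl | hjpos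
          · exact ⟨0, Nat.zero_le k, hle.trans_lt hrj, fun h => absurd h (lt_irrefl _)⟩
          obtain ⟨j', rfl⟩ : ∃ j', j = j' + 1 := ⟨j - 1, by omega⟩
          have hb := hbound hjpos
          have hmem : (p.1 ∪ (t ∩ S), p.2 + ω ^ β' * (j' : Ordinal.{u})) ∈ 𝒰' := by
            refine Finset.mem_filter.2 ⟨Finset.mem_image.2 ⟨(p, j', t ∩ S), ?_, rfl⟩, ?_⟩
            · simp only [Finset.mem_product, Finset.mem_range, Finset.mem_powerset]
              exact ⟨hp, by omega, Finset.inter_subset_right⟩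
            · simp only
              rw [add_assoc, ← mul_add_one]
              exact_mod_cast hrj
          rcases hz𝒰 _ hmem t ht hx with h | h
          · refine ⟨j' + 1, hj, hle.trans_lt hrj, fun _ => ?_⟩
            push_cast at hb hmass ⊢
            linarith
          · refine ⟨j', by omega, h, fun _ => ?_⟩
            have h1 := hKM z hz t ht
            push_cast at hb hmass ⊢
            nlinarith
    obtain ⟨m, hm, S, hSU, hmS, hmD, hinv⟩ := key n 0 (by simp)
    refine ⟨m, hm, S, hSU, hmS, by simpa using hmD, fun p hp t ht hpt => ?_⟩
    obtain ⟨j, hj, hrj, hbound⟩ := hinv p hp t ht hpt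
    rcases Nat.eq_zero_or_pos j with rfl | hjpos
    · right
      simpa using hrj
    · left
      have hb := hbound hjpos
      have hn' : 2 * ((k + 1) * M) ≤ n * ε := by
        rwa [div_le_iff₀ hε] at hn
      have hjM : 0 ≤ (j : ℝ) * M := by positivity
      have h2 : (n + 1 : ℝ) * mass π m t ≤ (n + 1) * ε := by nlinarith
      exact le_of_mul_le_mul_left h2 (by positivity)

/-- In a tree of rank `ω ^ β` there is an average which is small on every member of a given
hereditary family of rank less than `ω ^ β`. -/
theorem IsVectorTree.exists_average [DecidableEq I] {π : E →ₗ[ℝ] (I →₀ ℝ)} {l : Filter I}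
    {K : Set E} {D : Ordinal.{u} → Set E → Prop} (hD : IsVectorTree π l K D) (hK : Convex ℝ K)
    {F : Set (Finset I)} (hF : IsHereditary F) {M : ℝ} (hM : 0 ≤ M)
    (hKM : ∀ z ∈ K, ∀ t ∈ F, mass π z t ≤ M) {ρ β : Ordinal.{u}} (hρ : RankLE l link ρ F)
    (hβ : ρ < ω ^ β) {τ : Ordinal.{u}} {L : Set E} (hL : D (τ + ω ^ β) L) {U : Set I} (hU : U ∈ l)
    {ε : ℝ} (hε : 0 < ε) :
    ∃ w ∈ K, (∀ ξ, π w ξ ≠ 0 → ξ ∈ U) ∧ D τ (insert w L) ∧ ∀ t ∈ F, mass π w t ≤ ε := by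
  obtain ⟨w, hw, S, hSU, hwS, hwD, h⟩ := exists_average_mass_le_or_rank_lt hD hK hF hM hKM
    (r := linkRank l F) (fun u t hut => linkRank_anti hF hρ hut)
    (fun u => eventually_linkRank_insert_lt hF hρ u) β τ L hL U hU ε hε {(∅, 0)} (by
      intro p hp
      rw [Finset.mem_singleton] at hp
      subst hp
      rw [zero_add]
      refine lt_of_le_of_lt (csInf_le' ?_) hβ
      simpa using hρ)
  refine ⟨w, hw, fun ξ hξ => hSU (hwS ξ hξ), hwD, fun t ht => ?_⟩
  rcases h (∅, 0) (by simp) t ht (by simp) with h | h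
  · exact h
  · exact absurd h (by simp)

end Averages

/-! ### Trees of vectors with lower `ℓ₁` estimates -/

section BlockTree

variable {E : Type*} [NormedAddCommGroup E] [NormedSpace ℝ E]

/-- The finite set `L` of vectors has rank at least `ρ` in the tree of the finite sets of vectors
of the unit ball all of whose convex combinations have norm at least `c`. Here a new vector can be
found in any member of `𝒱`, a base of the sets of vectors that are considered as far out. -/
def BlockTree (𝒱 : Set (Set E)) (c : ℝ) (ρ : Ordinal.{u}) (L : Set E) : Prop :=
  (∀ z ∈ convexHull ℝ L, c ≤ ‖z‖) ∧
    ∀ ρ', ∀ _ : ρ' < ρ, ∀ V ∈ 𝒱, ∃ z ∈ V, ‖z‖ ≤ 1 ∧ BlockTree 𝒱 c ρ' (insert z L)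
termination_by ρ

theorem blockTree_iff {𝒱 : Set (Set E)} {c : ℝ} {ρ : Ordinal.{u}} {L : Set E} :
    BlockTree 𝒱 c ρ L ↔ (∀ z ∈ convexHull ℝ L, c ≤ ‖z‖) ∧
      ∀ ρ' < ρ, ∀ V ∈ 𝒱, ∃ z ∈ V, ‖z‖ ≤ 1 ∧ BlockTree 𝒱 c ρ' (insert z L) := by
  rw [BlockTree]

theorem BlockTree.mono {𝒱 : Set (Set E)} {c c' : ℝ} {ρ ρ' : Ordinal.{u}} {L L' : Set E}
    (h : BlockTree 𝒱 c ρ L) (hc : c' ≤ c) (hρ : ρ' ≤ ρ) (hL : L' ⊆ convexHull ℝ L) :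
    BlockTree 𝒱 c' ρ' L' := by
  induction ρ' using WellFoundedLT.induction generalizing ρ L L' with
  | ind ρ' ih =>
    rw [blockTree_iff] at h ⊢
    refine ⟨fun z hz => hc.trans (h.1 z (convexHull_min hL (convex_convexHull ℝ L) hz)),
      fun σ hσ V hV => ?_⟩
    obtain ⟨z, hz, hz1, hzB⟩ := h.2 σ (hσ.trans_le hρ) V hV
    refine ⟨z, hz, hz1, ih σ hσ hzB le_rfl (insert_subset ?_ ?_)⟩
    · exact subset_convexHull ℝ _ (mem_insert z L)
    · exact hL.trans (convexHull_mono (subset_insert z L))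

variable {𝒱 : Set (Set E)} (hconv : ∀ V ∈ 𝒱, Convex ℝ V)
  (hdir : ∀ V ∈ 𝒱, ∀ V' ∈ 𝒱, ∃ W ∈ 𝒱, W ⊆ V ∩ V')
include hconv hdir

/-- If no tree of rank `σ` has the constant `d`, then a tree of rank `σ` of vectors chosen from `M`
on has a convex combination of norm less than `d`. -/
theorem BlockTree.exists_norm_lt {c d : ℝ} {V : Set E} (hV : V ∈ 𝒱) {τ σ : Ordinal.{u}}
    {L M : Set E} (hM : M ⊆ V) (h : BlockTree 𝒱 c (τ + σ) (L ∪ M))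
    (hnot : ¬ BlockTree 𝒱 d σ M) : ∃ w ∈ V, ‖w‖ < d ∧ BlockTree 𝒱 c τ (insert w L) := by
  induction σ using WellFoundedLT.induction generalizing M with
  | ind σ ih =>
    rw [blockTree_iff, not_and_or] at hnot
    rcases hnot with hnot | hnot
    · push Not at hnot
      obtain ⟨w, hw, hwd⟩ := hnot
      refine ⟨w, convexHull_min hM (hconv V hV) hw, hwd, h.mono le_rfl le_self_add ?_⟩
      refine insert_subset (convexHull_mono subset_union_right hw) ?_
      exact (subset_union_left).trans (subset_convexHull ℝ _)
    · push Not at hnot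
      obtain ⟨σ', hσ', V', hV', hno⟩ := hnot
      obtain ⟨W, hW, hWsub⟩ := hdir V hV V' hV'
      obtain ⟨z, hz, hz1, hzB⟩ := (blockTree_iff.1 h).2 (τ + σ') (by gcongr) W hW
      rw [← union_insert] at hzB
      exact ih σ' hσ' (insert_subset (hWsub hz).1 hM) hzB (hno z (hWsub hz).2 hz1)

open scoped Pointwise in
/-- James' argument: in a tree of rank `σ * ρ` with constant `d ^ 2` either there is a subtree of
rank `σ` with constant `d`, or normalized convex combinations form a tree of rank `ρ` with
constant `d`. -/
theorem BlockTree.smul_inv (hscale : ∀ V ∈ 𝒱, ∀ a : ℝ, 0 < a → ∃ W ∈ 𝒱, ∀ w ∈ W, a • w ∈ V)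
    {d : ℝ} (hd : 0 < d) {σ ρ : Ordinal.{u}} (hnot : ¬ BlockTree 𝒱 d σ ∅) {L : Set E}
    (h : BlockTree 𝒱 (d * d) (σ * ρ) L) : BlockTree 𝒱 d ρ (d⁻¹ • L) := by
  induction ρ using WellFoundedLT.induction generalizing L with
  | ind ρ ih =>
    rw [blockTree_iff]
    constructor
    · intro z hz
      rw [convexHull_smul] at hz
      obtain ⟨y, hy, rfl⟩ := hz
      have := (blockTree_iff.1 h).1 y hy
      simp only
      rw [norm_smul, norm_inv, Real.norm_of_nonneg hd.le, inv_mul_eq_div, le_div_iff₀ hd]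
      exact this
    · intro ρ' hρ' V hV
      obtain ⟨W, hW, hWV⟩ := hscale V hV d⁻¹ (inv_pos.2 hd)
      have hle : σ * ρ' + σ ≤ σ * ρ := by
        rw [← mul_add_one]
        gcongr
        exact Order.add_one_le_of_lt hρ'
      obtain ⟨w, hwW, hwd, hwB⟩ := BlockTree.exists_norm_lt hconv hdir hW (τ := σ * ρ') (σ := σ)
        (L := L) (M := ∅) (empty_subset _)
        (h.mono le_rfl hle (by rw [union_empty]; exact subset_convexHull ℝ L)) hnot
      refine ⟨d⁻¹ • w, hWV w hwW, ?_, ?_⟩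
      · rw [norm_smul, norm_inv, Real.norm_of_nonneg hd.le, inv_mul_eq_div, div_le_one hd]
        exact hwd.le
      · have := ih ρ' hρ' hwB
        rwa [Set.smul_set_insert] at this

theorem BlockTree.sqrt (hscale : ∀ V ∈ 𝒱, ∀ a : ℝ, 0 < a → ∃ W ∈ 𝒱, ∀ w ∈ W, a • w ∈ V)
    {d : ℝ} (hd : 0 < d) {σ : Ordinal.{u}} (h : BlockTree 𝒱 (d * d) (σ * σ) ∅) :
    BlockTree 𝒱 d σ ∅ := by
  by_contra hnot
  apply hnot
  have := BlockTree.smul_inv hconv hdir hscale hd hnot h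
  rwa [Set.smul_set_empty] at this

/-- By repeated use of James' argument the constant of a tree can be brought close to `1`, at the
cost of passing from the rank `σ ^ (2 ^ j)` to the rank `σ`. -/
theorem BlockTree.improve (hscale : ∀ V ∈ 𝒱, ∀ a : ℝ, 0 < a → ∃ W ∈ 𝒱, ∀ w ∈ W, a • w ∈ V)
    {σ : Ordinal.{u}} (j : ℕ) {d : ℝ} (hd : 0 < d)
    (h : BlockTree 𝒱 (d ^ 2 ^ j) (σ ^ ((2 ^ j : ℕ) : Ordinal.{u})) ∅) : BlockTree 𝒱 d σ ∅ := by
  induction j with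
  | zero => simpa using h
  | succ j ih =>
    apply ih
    have h1 : d ^ 2 ^ (j + 1) = d ^ 2 ^ j * d ^ 2 ^ j := by
      rw [← pow_add, pow_succ, mul_two]
    have h2 : σ ^ ((2 ^ (j + 1) : ℕ) : Ordinal.{u}) =
        σ ^ ((2 ^ j : ℕ) : Ordinal.{u}) * σ ^ ((2 ^ j : ℕ) : Ordinal.{u}) := by
      rw [← Ordinal.opow_add, pow_succ, mul_two, Nat.cast_add]
    rw [h1, h2] at h
    exact BlockTree.sqrt hconv hdir hscale (by positivity) h

end BlockTree

/-! ### The norm on finitely supported vectors -/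

/-- Norming functionals of the Tsirelson space of the family `H`: the coordinate functionals, and
the halves of sums of functionals `f p`, `p ∈ P`, where `P ∈ H` and the support of `f p` lies
between `p` and the next element of `P`. -/
inductive TsFunctional (H : Set (Finset ℕ)) : (ℕ →₀ ℝ) → Prop
  | unit (n : ℕ) : TsFunctional H (Finsupp.single n 1)
  | node (P : Finset ℕ) (hP : P ∈ H) (f : ℕ → ℕ →₀ ℝ) (hf : ∀ p ∈ P, TsFunctional H (f p))
      (hlow : ∀ p ∈ P, ∀ x, f p x ≠ 0 → p ≤ x)
      (hup : ∀ p ∈ P, ∀ p' ∈ P, p < p' → ∀ x, f p x ≠ 0 → x < p') :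
      TsFunctional H ((1 / 2 : ℝ) • ∑ p ∈ P, f p)

theorem eq_of_ne_zero_of_ne_zero {P : Finset ℕ} {f : ℕ → ℕ →₀ ℝ}
    (hlow : ∀ p ∈ P, ∀ x, f p x ≠ 0 → p ≤ x)
    (hup : ∀ p ∈ P, ∀ p' ∈ P, p < p' → ∀ x, f p x ≠ 0 → x < p') {p p' : ℕ} (hp : p ∈ P)
    (hp' : p' ∈ P) {x : ℕ} (h : f p x ≠ 0) (h' : f p' x ≠ 0) : p = p' := by
  rcases lt_trichotomy p p' with hlt | heq | hlt
  · exact absurd (hup p hp p' hp' hlt x h) (hlow p' hp' x h').not_gt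
  · exact heq
  · exact absurd (hup p' hp' p hp hlt x h') (hlow p hp x h).not_gt

theorem TsFunctional.bounds {H : Set (Finset ℕ)} {f : ℕ →₀ ℝ} (hf : TsFunctional H f) (i : ℕ) :
    0 ≤ f i ∧ f i ≤ 1 := by
  induction hf with
  | unit n =>
    rw [Finsupp.single_apply]
    split_ifs <;> simp
  | node P hP f hf hlow hup ih =>
    rw [Finsupp.smul_apply, Finsupp.finsetSum_apply, smul_eq_mul]
    have h0 : 0 ≤ ∑ p ∈ P, f p i := Finset.sum_nonneg fun p hp => (ih p hp).1
    refine ⟨by positivity, ?_⟩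
    have h1 : ∑ p ∈ P, f p i ≤ 1 := by
      by_cases h : ∃ p ∈ P, f p i ≠ 0
      · obtain ⟨p, hp, hpi⟩ := h
        rw [Finset.sum_eq_single_of_mem p hp]
        · exact (ih p hp).2
        · intro p' hp' hne
          by_contra hpi'
          exact hne (eq_of_ne_zero_of_ne_zero hlow hup hp' hp hpi' hpi)
      · push Not at h
        rw [Finset.sum_eq_zero h]
        exact zero_le_one
    linarith

theorem TsFunctional.filter_le {H : Set (Finset ℕ)} (hH : ∅ ∈ H) {f : ℕ →₀ ℝ}
    (hf : TsFunctional H f) (a : ℕ) : TsFunctional H (f.filter (a ≤ ·)) := by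
  have hzero : TsFunctional H 0 := by
    have := TsFunctional.node (H := H) ∅ hH 0 (by simp) (by simp) (by simp)
    simpa using this
  induction hf with
  | unit n =>
    by_cases h : a ≤ n
    · rw [Finsupp.filter_single_of_pos (a ≤ ·) h]
      exact TsFunctional.unit n
    · rw [Finsupp.filter_single_of_neg (a ≤ ·) h]
      exact hzero
  | node P hP f hf hlow hup ih =>
    have : Finsupp.filter (a ≤ ·) ((1 / 2 : ℝ) • ∑ p ∈ P, f p) =
        (1 / 2 : ℝ) • ∑ p ∈ P, (f p).filter (a ≤ ·) := by
      ext i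
      simp only [Finsupp.filter_apply, Finsupp.smul_apply, Finsupp.finsetSum_apply]
      split_ifs <;> simp
    rw [this]
    have hne : ∀ p x, (f p).filter (a ≤ ·) x ≠ 0 → f p x ≠ 0 := by
      intro p x h h0
      apply h
      rw [Finsupp.filter_apply]
      split_ifs
      · exact h0
      · rfl
    exact TsFunctional.node P hP _ ih (fun p hp x hx => hlow p hp x (hne p x hx))
      fun p hp p' hp' hlt x hx => hup p hp p' hp' hlt x (hne p x hx)

/-- The value of the functional `f` at the sequence `a`. -/
noncomputable def ev (f : ℕ →₀ ℝ) (a : ℕ → ℝ) : ℝ := ∑ i ∈ f.support, f i * a i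

theorem ev_eq_linearCombination (f : ℕ →₀ ℝ) (a : ℕ → ℝ) :
    ev f a = Finsupp.linearCombination ℝ a f := rfl

theorem ev_node (P : Finset ℕ) (f : ℕ → ℕ →₀ ℝ) (a : ℕ → ℝ) :
    ev ((1 / 2 : ℝ) • ∑ p ∈ P, f p) a = 1 / 2 * ∑ p ∈ P, ev (f p) a := by
  simp only [ev_eq_linearCombination, map_smul, map_sum, smul_eq_mul]

theorem ev_unit (n : ℕ) (a : ℕ → ℝ) : ev (Finsupp.single n 1) a = a n := by
  simp [ev_eq_linearCombination]

section famNorm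

variable {I : Type u}

/-- `∑ |x ξ|`. -/
noncomputable def oneNorm (x : I →₀ ℝ) : ℝ := ∑ ξ ∈ x.support, |x ξ|

theorem sum_abs_le_oneNorm (x : I →₀ ℝ) (t : Finset I) : ∑ ξ ∈ t, |x ξ| ≤ oneNorm x := by
  classical
  rw [oneNorm, ← Finset.sum_filter_ne_zero]
  refine Finset.sum_le_sum_of_subset_of_nonneg ?_ fun _ _ _ => abs_nonneg _
  intro ξ hξ
  rw [Finset.mem_filter, abs_ne_zero] at hξ
  exact Finsupp.mem_support_iff.2 hξ.2

/-- The norm of `x` given by the family `F`: the largest `ℓ₁`-norm of `x` on a member of `F`. -/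
noncomputable def famNorm (F : Set (Finset I)) (x : I →₀ ℝ) : ℝ := ⨆ t : F, ∑ ξ ∈ t.1, |x ξ|

variable {F : Set (Finset I)}

theorem le_famNorm (x : I →₀ ℝ) {t : Finset I} (ht : t ∈ F) : ∑ ξ ∈ t, |x ξ| ≤ famNorm F x :=
  le_ciSup (f := fun t : F => ∑ ξ ∈ t.1, |x ξ|)
    ⟨oneNorm x, by rintro _ ⟨t, rfl⟩; exact sum_abs_le_oneNorm x t.1⟩ ⟨t, ht⟩

theorem famNorm_le {x : I →₀ ℝ} {C : ℝ} (hC : 0 ≤ C) (h : ∀ t ∈ F, ∑ ξ ∈ t, |x ξ| ≤ C) :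
    famNorm F x ≤ C :=
  Real.iSup_le (fun t => h t.1 t.2) hC

theorem famNorm_nonneg (x : I →₀ ℝ) : 0 ≤ famNorm F x :=
  Real.iSup_nonneg fun _ => Finset.sum_nonneg fun _ _ => abs_nonneg _

theorem famNorm_mono {x y : I →₀ ℝ} (h : ∀ ξ, |x ξ| ≤ |y ξ|) : famNorm F x ≤ famNorm F y :=
  famNorm_le (famNorm_nonneg y) fun _ ht =>
    (Finset.sum_le_sum fun ξ _ => h ξ).trans (le_famNorm y ht)

theorem famNorm_add_le (x y : I →₀ ℝ) : famNorm F (x + y) ≤ famNorm F x + famNorm F y := by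
  refine famNorm_le (add_nonneg (famNorm_nonneg x) (famNorm_nonneg y)) fun t ht => ?_
  refine le_trans ?_ (add_le_add (le_famNorm x ht) (le_famNorm y ht))
  rw [← Finset.sum_add_distrib]
  exact Finset.sum_le_sum fun ξ _ => abs_add_le _ _

theorem famNorm_smul_le (a : ℝ) (x : I →₀ ℝ) : famNorm F (a • x) ≤ |a| * famNorm F x := by
  refine famNorm_le (mul_nonneg (abs_nonneg a) (famNorm_nonneg x)) fun t ht => ?_
  refine le_trans (le_of_eq ?_) (mul_le_mul_of_nonneg_left (le_famNorm x ht) (abs_nonneg a))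
  rw [Finset.mul_sum]
  exact Finset.sum_congr rfl fun ξ _ => abs_mul _ _

end famNorm

/-- The families from which a space is built: hereditary families `fam n` on `I`, the first of
which contains the singletons, and a hereditary family `adm` of integers of admissible sets. -/
structure TsData (I : Type u) where
  /-- The families measuring the size of vectors. -/
  fam : ℕ → Set (Finset I)
  fam_hereditary : ∀ n, IsHereditary (fam n)
  singleton_mem : ∀ ξ, {ξ} ∈ fam 0
  /-- The admissible sets of the Tsirelson norm. -/
  adm : Set (Finset ℕ)
  adm_hereditary : IsHereditary adm
  empty_mem_adm : ∅ ∈ adm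

/-- The space of finitely supported vectors, to be normed by the data `d`. -/
def C00 {I : Type u} (_d : TsData I) : Type u := I →₀ ℝ

namespace C00

variable {I : Type u} {d : TsData I}

noncomputable instance : AddCommGroup (C00 d) := inferInstanceAs (AddCommGroup (I →₀ ℝ))

noncomputable instance : Module ℝ (C00 d) := inferInstanceAs (Module ℝ (I →₀ ℝ))

/-- The vector as a finitely supported function. -/
noncomputable def toFinsupp : C00 d ≃ₗ[ℝ] (I →₀ ℝ) := LinearEquiv.refl ℝ (I →₀ ℝ)

/-- The coordinates of a vector. -/
noncomputable instance : CoeFun (C00 d) (fun _ => I → ℝ) := ⟨fun x => toFinsupp x⟩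

@[ext]
theorem ext {x y : C00 d} (h : ∀ ξ, x ξ = y ξ) : x = y :=
  toFinsupp.injective (Finsupp.ext h)

@[simp] theorem add_apply (x y : C00 d) (ξ : I) : (x + y) ξ = x ξ + y ξ := rfl

@[simp] theorem smul_apply (a : ℝ) (x : C00 d) (ξ : I) : (a • x) ξ = a * x ξ := rfl

@[simp] theorem neg_apply (x : C00 d) (ξ : I) : (-x) ξ = -x ξ := rfl

@[simp] theorem sub_apply (x y : C00 d) (ξ : I) : (x - y) ξ = x ξ - y ξ := by
  rw [sub_eq_add_neg, add_apply, neg_apply, sub_eq_add_neg]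

theorem sum_apply {ι : Type*} (s : Finset ι) (x : ι → C00 d) (ξ : I) :
    (∑ i ∈ s, x i) ξ = ∑ i ∈ s, x i ξ := by
  rw [map_sum, Finsupp.finsetSum_apply]

/-- The support of a vector. -/
noncomputable def supp (x : C00 d) : Finset I := (toFinsupp x).support

theorem mem_supp {x : C00 d} {ξ : I} : ξ ∈ supp x ↔ x ξ ≠ 0 := Finsupp.mem_support_iff

/-- The norms given by the families, with weights making them summable. -/
noncomputable def q (n : ℕ) (x : C00 d) : ℝ := (1 / 2) ^ n * famNorm (d.fam n) (toFinsupp x)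

theorem q_nonneg (n : ℕ) (x : C00 d) : 0 ≤ q n x :=
  mul_nonneg (by positivity) (famNorm_nonneg _)

theorem q_mono (n : ℕ) {x y : C00 d} (h : ∀ ξ, |x ξ| ≤ |y ξ|) : q n x ≤ q n y :=
  mul_le_mul_of_nonneg_left (famNorm_mono h) (by positivity)

theorem q_add_le (n : ℕ) (x y : C00 d) : q n (x + y) ≤ q n x + q n y := by
  rw [q, q, q, ← mul_add, map_add]
  exact mul_le_mul_of_nonneg_left (famNorm_add_le _ _) (by positivity)

theorem q_smul_le (n : ℕ) (a : ℝ) (x : C00 d) : q n (a • x) ≤ |a| * q n x := by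
  rw [q, q, mul_left_comm, map_smul]
  exact mul_le_mul_of_nonneg_left (famNorm_smul_le _ _) (by positivity)

theorem sum_abs_le_q (n : ℕ) (x : C00 d) {t : Finset I} (ht : t ∈ d.fam n) :
    (1 / 2) ^ n * ∑ ξ ∈ t, |x ξ| ≤ q n x :=
  mul_le_mul_of_nonneg_left (le_famNorm _ ht) (by positivity)

theorem q_le_oneNorm (n : ℕ) (x : C00 d) : q n x ≤ (1 / 2) ^ n * oneNorm (toFinsupp x) := by
  refine mul_le_mul_of_nonneg_left (famNorm_le ?_ fun t _ => sum_abs_le_oneNorm _ t)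
    (by positivity)
  exact Finset.sum_nonneg fun _ _ => abs_nonneg _

theorem summable_q (x : C00 d) : Summable fun n => q n x :=
  Summable.of_nonneg_of_le (fun n => q_nonneg n x) (fun n => q_le_oneNorm n x)
    (summable_geometric_two.mul_right _)

theorem exists_sum_q_le (x : C00 d) {ε : ℝ} (hε : 0 < ε) :
    ∃ b : ℕ, ∀ s : Finset ℕ, (∀ i ∈ s, b < i) → ∑ i ∈ s, q i x ≤ ε := by
  obtain ⟨t, ht⟩ := summable_iff_vanishing_norm.mp (summable_q x) ε hε
  refine ⟨t.sup id, fun s hs => ?_⟩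
  have := ht s (Finset.disjoint_left.2 fun i hi hit =>
    absurd (Finset.le_sup (f := id) hit) (hs i hi).not_ge)
  exact (le_abs_self _).trans this.le

theorem ev_le_sum (f : ℕ →₀ ℝ) (hf : TsFunctional d.adm f) (x : C00 d) :
    ev f (fun n => q n x) ≤ ∑ i ∈ f.support, q i x :=
  Finset.sum_le_sum fun i _ => mul_le_of_le_one_left (q_nonneg i x) (hf.bounds i).2

theorem ev_nonneg {f : ℕ →₀ ℝ} (hf : TsFunctional d.adm f) (x : C00 d) :
    0 ≤ ev f (fun n => q n x) :=
  Finset.sum_nonneg fun i _ => mul_nonneg (hf.bounds i).1 (q_nonneg i x)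

theorem ev_mono {f : ℕ →₀ ℝ} (hf : TsFunctional d.adm f) {a b : ℕ → ℝ}
    (h : ∀ i, f i ≠ 0 → a i ≤ b i) : ev f a ≤ ev f b :=
  Finset.sum_le_sum fun i hi =>
    mul_le_mul_of_nonneg_left (h i (Finsupp.mem_support_iff.1 hi)) (hf.bounds i).1

theorem ev_add_le {f : ℕ →₀ ℝ} (hf : TsFunctional d.adm f) (x y : C00 d) :
    ev f (fun n => q n (x + y)) ≤ ev f (fun n => q n x) + ev f (fun n => q n y) := by
  refine (ev_mono hf (b := fun n => q n x + q n y) fun i _ => q_add_le i x y).trans (le_of_eq ?_)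
  rw [ev, ev, ev, ← Finset.sum_add_distrib]
  exact Finset.sum_congr rfl fun i _ => mul_add _ _ _

theorem ev_smul_le {f : ℕ →₀ ℝ} (hf : TsFunctional d.adm f) (a : ℝ) (x : C00 d) :
    ev f (fun n => q n (a • x)) ≤ |a| * ev f (fun n => q n x) := by
  refine (ev_mono hf (b := fun n => |a| * q n x) fun i _ => q_smul_le i a x).trans (le_of_eq ?_)
  rw [ev, ev, Finset.mul_sum]
  exact Finset.sum_congr rfl fun i _ => mul_left_comm _ _ _

/-- The norm of the sequence `(q n x)` in the Tsirelson space of the family `d.adm`. -/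
noncomputable def tsNorm (x : C00 d) : ℝ :=
  ⨆ f : {f : ℕ →₀ ℝ // TsFunctional d.adm f}, ev f.1 (fun n => q n x)

theorem ev_le_tsNorm {f : ℕ →₀ ℝ} (hf : TsFunctional d.adm f) (x : C00 d) :
    ev f (fun n => q n x) ≤ tsNorm x := by
  refine le_ciSup (f := fun f : {f : ℕ →₀ ℝ // TsFunctional d.adm f} => ev f.1 (fun n => q n x))
    ⟨∑' n, q n x, ?_⟩ ⟨f, hf⟩
  rintro _ ⟨g, rfl⟩
  exact (ev_le_sum g.1 g.2 x).trans ((summable_q x).sum_le_tsum _ fun n _ => q_nonneg n x)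

theorem tsNorm_le {x : C00 d} {C : ℝ} (hC : 0 ≤ C)
    (h : ∀ f, TsFunctional d.adm f → ev f (fun n => q n x) ≤ C) : tsNorm x ≤ C :=
  Real.iSup_le (fun f => h f.1 f.2) hC

theorem tsNorm_nonneg (x : C00 d) : 0 ≤ tsNorm x :=
  Real.iSup_nonneg fun f => ev_nonneg f.2 x

theorem q_le_tsNorm (n : ℕ) (x : C00 d) : q n x ≤ tsNorm x := by
  have := ev_le_tsNorm (TsFunctional.unit n) x
  rwa [ev_unit] at this

theorem abs_apply_le_tsNorm (x : C00 d) (ξ : I) : |x ξ| ≤ tsNorm x := by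
  refine le_trans ?_ (q_le_tsNorm 0 x)
  have := sum_abs_le_q 0 x (d.singleton_mem ξ)
  simpa using this

theorem tsNorm_smul_le (a : ℝ) (x : C00 d) : tsNorm (a • x) ≤ |a| * tsNorm x :=
  tsNorm_le (mul_nonneg (abs_nonneg a) (tsNorm_nonneg x)) fun _ hf =>
    (ev_smul_le hf a x).trans (mul_le_mul_of_nonneg_left (ev_le_tsNorm hf x) (abs_nonneg a))

noncomputable instance : NormedAddCommGroup (C00 d) :=
  AddGroupNorm.toNormedAddCommGroup
    { toFun := tsNorm
      map_zero' := by
        refine le_antisymm ?_ (tsNorm_nonneg 0)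
        have := tsNorm_smul_le 0 (0 : C00 d)
        rwa [zero_smul, abs_zero, zero_mul] at this
      add_le' := fun x y =>
        tsNorm_le (add_nonneg (tsNorm_nonneg x) (tsNorm_nonneg y)) fun _ hf =>
          (ev_add_le hf x y).trans (add_le_add (ev_le_tsNorm hf x) (ev_le_tsNorm hf y))
      neg' := fun x => by
        have key : ∀ x : C00 d, tsNorm (-x) ≤ tsNorm x := fun x => by
          have := tsNorm_smul_le (-1) x
          rwa [neg_one_smul, abs_neg, abs_one, one_mul] at this
        exact le_antisymm (key x) (by simpa using key (-x))
      eq_zero_of_map_eq_zero' := fun x hx => by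
        ext ξ
        have := abs_apply_le_tsNorm x ξ
        rw [hx] at this
        exact abs_nonpos_iff.1 this }

noncomputable instance : NormedSpace ℝ (C00 d) where
  norm_smul_le a x := tsNorm_smul_le a x

theorem ev_le_norm {f : ℕ →₀ ℝ} (hf : TsFunctional d.adm f) (x : C00 d) :
    ev f (fun n => q n x) ≤ ‖x‖ := ev_le_tsNorm hf x

theorem norm_le {x : C00 d} {C : ℝ} (hC : 0 ≤ C)
    (h : ∀ f, TsFunctional d.adm f → ev f (fun n => q n x) ≤ C) : ‖x‖ ≤ C := tsNorm_le hC h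

theorem q_le_norm (n : ℕ) (x : C00 d) : q n x ≤ ‖x‖ := q_le_tsNorm n x

theorem abs_apply_le_norm (x : C00 d) (ξ : I) : |x ξ| ≤ ‖x‖ := abs_apply_le_tsNorm x ξ

theorem norm_mono {x y : C00 d} (h : ∀ ξ, |x ξ| ≤ |y ξ|) : ‖x‖ ≤ ‖y‖ :=
  norm_le (norm_nonneg y) fun _ hf => (ev_mono hf fun i _ => q_mono i h).trans (ev_le_norm hf y)

theorem norm_congr_abs {x y : C00 d} (h : ∀ ξ, |x ξ| = |y ξ|) : ‖x‖ = ‖y‖ :=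
  le_antisymm (norm_mono fun ξ => (h ξ).le) (norm_mono fun ξ => (h ξ).ge)

theorem exists_lt_ev (x : C00 d) {C : ℝ} (hC : 0 ≤ C) (h : C < ‖x‖) :
    ∃ f, TsFunctional d.adm f ∧ C < ev f (fun n => q n x) := by
  by_contra hno
  push Not at hno
  exact h.not_ge (norm_le hC hno)

open scoped Classical in
/-- The restriction of a vector to a set of coordinates. -/
noncomputable def proj (A : Set I) : C00 d →ₗ[ℝ] C00 d where
  toFun x := toFinsupp.symm (Finsupp.filter (· ∈ A) (toFinsupp x))
  map_add' x y := by rw [map_add, Finsupp.filter_add, map_add]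
  map_smul' a x := by rw [map_smul, Finsupp.filter_smul, map_smul, RingHom.id_apply]

open scoped Classical in
theorem proj_apply (A : Set I) (x : C00 d) (ξ : I) : proj A x ξ = if ξ ∈ A then x ξ else 0 :=
  Finsupp.filter_apply (· ∈ A) (toFinsupp x) ξ

theorem proj_apply_of_mem {A : Set I} {ξ : I} (h : ξ ∈ A) (x : C00 d) : proj A x ξ = x ξ := by
  rw [proj_apply, if_pos h]

theorem proj_apply_of_notMem {A : Set I} {ξ : I} (h : ξ ∉ A) (x : C00 d) : proj A x ξ = 0 := by
  rw [proj_apply, if_neg h]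

theorem abs_proj_apply_le (A : Set I) (x : C00 d) (ξ : I) : |proj A x ξ| ≤ |x ξ| := by
  by_cases h : ξ ∈ A
  · rw [proj_apply_of_mem h]
  · rw [proj_apply_of_notMem h, abs_zero]
    exact abs_nonneg _

theorem norm_proj_le (A : Set I) (x : C00 d) : ‖proj A x‖ ≤ ‖x‖ := norm_mono (abs_proj_apply_le A x)

theorem proj_add_proj_compl (A : Set I) (x : C00 d) : proj A x + proj Aᶜ x = x := by
  ext ξ
  by_cases h : ξ ∈ A
  · simp [proj_apply_of_mem h, proj_apply_of_notMem (A := Aᶜ) (ξ := ξ) (by simpa using h)]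
  · simp [proj_apply_of_notMem h, proj_apply_of_mem (A := Aᶜ) (ξ := ξ) (by simpa using h)]

end C00

/-! ### Lower `ℓ₁`-estimates of sequences -/

/-- The sequence `x` satisfies a lower `ℓ₁`-estimate with constant `c` on the members of `F`. -/
def LowerEstimate (F : Set (Finset ℕ)) (c : ℝ) {X : Type u} [NormedAddCommGroup X]
    [NormedSpace ℝ X] (x : ℕ → X) : Prop :=
  ∀ s ∈ F, ∀ a : ℕ → ℝ, c * ∑ n ∈ s, |a n| ≤ ‖∑ n ∈ s, a n • x n‖

section LowerEstimate

variable {X Y : Type u} [NormedAddCommGroup X] [NormedSpace ℝ X] [NormedAddCommGroup Y]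
  [NormedSpace ℝ Y] {F G : Set (Finset ℕ)} {c : ℝ} {x y : ℕ → X}

theorem LowerEstimate.comp (h : LowerEstimate G c x) {φ : ℕ → ℕ} (hφ : Function.Injective φ)
    (hF : ∀ s ∈ F, s.image φ ∈ G) : LowerEstimate F c (x ∘ φ) := by
  intro s hs a
  have := h _ (hF s hs) (a ∘ Function.invFun φ)
  rw [Finset.sum_image hφ.injOn, Finset.sum_image hφ.injOn] at this
  simpa only [Function.comp_apply, Function.leftInverse_invFun hφ _] using this

theorem LowerEstimate.comp_strictMono (h : LowerEstimate F c x) (hF : SpreadsMaps F)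
    {φ : ℕ → ℕ} (hφ : StrictMono φ) : LowerEstimate F c (x ∘ φ) :=
  h.comp hφ.injective fun s hs => hF s hs φ (hφ.strictMonoOn _) fun k _ => hφ.id_le k

theorem LowerEstimate.of_norm_sub_le (h : LowerEstimate F c x) {e : ℝ}
    (he : ∀ n, ‖x n - y n‖ ≤ e) : LowerEstimate F (c - e) y := by
  intro s hs a
  have h1 := h s hs a
  have h2 : ‖∑ n ∈ s, a n • (x n - y n)‖ ≤ e * ∑ n ∈ s, |a n| := by
    rw [Finset.mul_sum]
    refine norm_sum_le_of_le s fun n _ => ?_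
    rw [norm_smul, Real.norm_eq_abs, mul_comm]
    exact mul_le_mul_of_nonneg_right (he n) (abs_nonneg _)
  have h3 : ∑ n ∈ s, a n • x n = ∑ n ∈ s, a n • (x n - y n) + ∑ n ∈ s, a n • y n := by
    rw [← Finset.sum_add_distrib]
    exact Finset.sum_congr rfl fun n _ => by rw [← smul_add, sub_add_cancel]
  have h4 := norm_add_le (∑ n ∈ s, a n • (x n - y n)) (∑ n ∈ s, a n • y n)
  rw [← h3] at h4
  rw [sub_mul]
  linarith

theorem LowerEstimate.mono_const (h : LowerEstimate F c x) {c' : ℝ} (hc : c' ≤ c) :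
    LowerEstimate F c' x := fun s hs a =>
  (mul_le_mul_of_nonneg_right hc (Finset.sum_nonneg fun _ _ => abs_nonneg _)).trans (h s hs a)

/-- A lower estimate passes to preimages under linear maps. -/
theorem LowerEstimate.of_map (T : X →ₗ[ℝ] Y) {M : ℝ} (hM : 0 < M) (hT : ∀ v, ‖T v‖ ≤ M * ‖v‖)
    (h : LowerEstimate F c fun n => T (x n)) : LowerEstimate F (c / M) x := by
  intro s hs a
  have h1 := h s hs a
  have h2 := hT (∑ n ∈ s, a n • x n)
  rw [map_sum] at h2
  simp only [map_smul] at h2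
  rw [div_mul_eq_mul_div, div_le_iff₀ hM, mul_comm ‖_‖]
  exact h1.trans h2

end LowerEstimate

/-! ### Choosing sequences of disjoint blocks -/

/-- Sets with the property `p` that avoid any given finite set can be chosen one after another. -/
theorem exists_disjoint_seq {I : Type u} {p : Finset I → Prop}
    (h : ∀ A : Finset I, ∃ B, Disjoint A B ∧ p B) :
    ∃ B : ℕ → Finset I, Pairwise (Function.onFun Disjoint B) ∧ ∀ k, p (B k) := by
  classical
  choose B hB hp using h
  let A : ℕ → Finset I := fun k => Nat.rec ∅ (fun _ A => A ∪ B A) k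
  have hA : ∀ k, A (k + 1) = A k ∪ B (A k) := fun _ => rfl
  have hmono : Monotone A := monotone_nat_of_le_succ fun k => by
    rw [hA]
    exact Finset.subset_union_left
  have hlt : ∀ i j, i < j → Disjoint (B (A i)) (B (A j)) := fun i j hij =>
    (hB (A j)).mono_left (le_trans (by rw [hA]; exact Finset.subset_union_right)
      (hmono (Nat.succ_le_of_lt hij)))
  refine ⟨fun k => B (A k), fun i j hij => ?_, fun k => hp _⟩
  rcases lt_or_gt_of_ne hij with h | h
  · exact hlt i j h
  · exact (hlt j i h).symm

/-! ### Disjoint blocks and sequences without Cauchy subsequences -/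

namespace C00

variable {I : Type u} {d : TsData I}

theorem q_smul (n : ℕ) (a : ℝ) (x : C00 d) : q n (a • x) = |a| * q n x := by
  refine le_antisymm (q_smul_le n a x) ?_
  rcases eq_or_ne a 0 with rfl | ha
  · rw [abs_zero, zero_mul]
    exact q_nonneg _ _
  · have := q_smul_le n a⁻¹ (a • x)
    rw [inv_smul_smul₀ ha, abs_inv] at this
    have h := mul_le_mul_of_nonneg_left this (abs_nonneg a)
    rwa [mul_inv_cancel_left₀ (abs_pos.2 ha).ne'] at h

/-- The unit vectors. -/
noncomputable def unitVec (ξ : I) : C00 d := toFinsupp.symm (Finsupp.single ξ 1)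

open scoped Classical in
theorem unitVec_apply (ξ η : I) : (unitVec ξ : C00 d) η = if ξ = η then 1 else 0 :=
  Finsupp.single_apply

/-- The vector with the coordinates `g ξ` for `ξ ∈ A`. -/
noncomputable def cut (g : I → ℝ) (A : Finset I) : C00 d := ∑ ξ ∈ A, g ξ • unitVec ξ

open scoped Classical in
theorem cut_apply (g : I → ℝ) (A : Finset I) (ξ : I) :
    (cut g A : C00 d) ξ = if ξ ∈ A then g ξ else 0 := by
  rw [cut, sum_apply]
  simp only [smul_apply, unitVec_apply]
  simp

theorem proj_eq_cut (A : Finset I) (x : C00 d) : proj (A : Set I) x = cut x A := by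
  classical
  ext ξ
  rw [proj_apply, cut_apply]
  simp only [Finset.mem_coe]

theorem tendsto_cut {f : ℕ → I → ℝ} {g : I → ℝ} (h : ∀ ξ, Tendsto (fun k => f k ξ) atTop (𝓝 (g ξ)))
    (A : Finset I) : Tendsto (fun k => (cut (f k) A : C00 d)) atTop (𝓝 (cut g A)) :=
  tendsto_finsetSum A fun ξ _ => (h ξ).smul_const _

theorem norm_cut_le_of_tendsto {y : ℕ → C00 d} {K : ℝ} (hK : ∀ k, ‖y k‖ ≤ K) {g : I → ℝ}
    (h : ∀ ξ, Tendsto (fun k => y k ξ) atTop (𝓝 (g ξ))) (A : Finset I) :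
    ‖(cut g A : C00 d)‖ ≤ K :=
  le_of_tendsto (tendsto_cut h A).norm <| Eventually.of_forall fun k => by
    rw [← proj_eq_cut]
    exact (norm_proj_le _ _).trans (hK k)

/-- Bounded sequences have coordinatewise convergent subsequences. -/
theorem exists_tendsto_apply {y : ℕ → C00 d} {K : ℝ} (hK : ∀ k, ‖y k‖ ≤ K) :
    ∃ φ : ℕ → ℕ, StrictMono φ ∧ ∃ g : I → ℝ, ∀ ξ, Tendsto (fun k => y (φ k) ξ) atTop (𝓝 (g ξ)) := by
  classical
  let J : Set I := ⋃ k, (supp (y k) : Set I)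
  have hJ : Countable J := (countable_iUnion fun k => (supp (y k)).countable_toSet).to_subtype
  have hcomp : IsCompact (Set.univ.pi fun _ : J => Set.Icc (-K) K) :=
    isCompact_univ_pi fun _ => isCompact_Icc
  obtain ⟨g, -, φ, hφ, hg⟩ := hcomp.tendsto_subseq (x := fun k (ξ : J) => y k ξ) fun k ξ _ =>
    abs_le.1 ((abs_apply_le_norm (y k) ξ).trans (hK k))
  rw [tendsto_pi_nhds] at hg
  refine ⟨φ, hφ, fun ξ => if h : ξ ∈ J then g ⟨ξ, h⟩ else 0, fun ξ => ?_⟩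
  by_cases h : ξ ∈ J
  · simp only [h, dif_pos]
    exact hg ⟨ξ, h⟩
  · simp only [h, dif_neg, not_false_eq_true]
    refine tendsto_const_nhds.congr fun k => ?_
    by_contra hne
    exact h (mem_iUnion.2 ⟨φ k, Finset.mem_coe.2 (mem_supp.2 (Ne.symm hne))⟩)

theorem exists_lt_sum {n : ℕ} {x : C00 d} {C : ℝ} (hC : 0 ≤ C) (h : C < q n x) :
    ∃ t ∈ d.fam n, t ⊆ supp x ∧ C < (1 / 2) ^ n * ∑ ξ ∈ t, |x ξ| := by
  classical
  by_contra hno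
  push Not at hno
  have h2 : (0 : ℝ) < (1 / 2) ^ n := by positivity
  refine h.not_ge ?_
  rw [q, ← le_div_iff₀' h2]
  refine famNorm_le (by positivity) fun t ht => ?_
  rw [le_div_iff₀' h2, ← Finset.sum_filter_ne_zero]
  refine hno _ (d.fam_hereditary n t ht _ (Finset.filter_subset _ _)) fun ξ hξ => ?_
  exact mem_supp.2 (abs_ne_zero.1 (Finset.mem_filter.1 hξ).2)

end C00

/-- The properties of the data that make every block sequence have an `ℓ₁`-subsequence on the
admissible sets: the family `fam (n + 1)` is a multiplication of `fam n` by `adm`, while `adm` is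
spreading and has members of every size. -/
structure TsData.IsMultiplicative {I : Type u} (d : TsData I) : Prop where
  exists_biUnion_mem : ∀ n, ∀ s : ℕ → Finset I, (∀ k, s k ∈ d.fam n) → ∃ φ : ℕ → ℕ, StrictMono φ ∧
    ∀ x ∈ d.adm, ∃ w ∈ d.fam (n + 1), (w : Set I) = ⋃ k ∈ x, (s (φ k) : Set I)
  spreads : SpreadsMaps d.adm
  exists_card : ∀ n, ∃ s ∈ d.adm, s.card = n

namespace C00

variable {I : Type u} {d : TsData I}

theorem sum_smul_apply_of_disjoint {z : ℕ → C00 d}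
    (hz : Pairwise (Function.onFun Disjoint fun k => supp (z k))) {s : Finset ℕ} (a : ℕ → ℝ)
    {k : ℕ} (hk : k ∈ s) {ξ : I} (hξ : ξ ∈ supp (z k)) :
    (∑ i ∈ s, a i • z i) ξ = a k * z k ξ := by
  rw [sum_apply, Finset.sum_eq_single_of_mem k hk, smul_apply]
  intro j _ hj
  rw [smul_apply]
  have : z j ξ = 0 := by
    by_contra hne
    exact Finset.disjoint_left.1 (hz hj) (mem_supp.2 hne) hξ
  rw [this, mul_zero]

theorem q_smul_le_q_sum {z : ℕ → C00 d}
    (hz : Pairwise (Function.onFun Disjoint fun k => supp (z k))) {s : Finset ℕ} (a : ℕ → ℝ)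
    {k : ℕ} (hk : k ∈ s) (n : ℕ) : |a k| * q n (z k) ≤ q n (∑ i ∈ s, a i • z i) := by
  rw [← q_smul]
  refine q_mono n fun ξ => ?_
  by_cases hξ : ξ ∈ supp (z k)
  · rw [sum_smul_apply_of_disjoint hz a hk hξ, smul_apply]
  · rw [smul_apply, not_not.1 (fun h => hξ (mem_supp.2 h)), mul_zero, abs_zero]
    exact abs_nonneg _

/-- Disjointly supported vectors on which some `q n` is bounded below have a subsequence with a
lower `ℓ₁`-estimate, measured by `q (n + 1)`. -/
theorem exists_lowerEstimate_of_le_q (hd : d.IsMultiplicative) {z : ℕ → C00 d}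
    (hz : Pairwise (Function.onFun Disjoint fun k => supp (z k))) {n : ℕ} {ε : ℝ} (hε : 0 < ε)
    (h : ∀ k, ε < q n (z k)) :
    ∃ φ : ℕ → ℕ, StrictMono φ ∧ LowerEstimate d.adm (ε / 2) (z ∘ φ) := by
  classical
  choose t ht htz hlt using fun k => exists_lt_sum hε.le (h k)
  obtain ⟨φ, hφ, hw⟩ := hd.exists_biUnion_mem n t ht
  refine ⟨φ, hφ, fun s hs a => ?_⟩
  have hzφ : Pairwise (Function.onFun Disjoint fun k => supp (z (φ k))) :=
    fun i j hij => hz (hφ.injective.ne hij)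
  obtain ⟨w, hwF, hws⟩ := hw s hs
  have hwb : w = s.biUnion fun k => t (φ k) := by
    rw [← Finset.coe_inj, hws, Finset.coe_biUnion]
    rfl
  set y : C00 d := ∑ k ∈ s, a k • z (φ k) with hy
  have h1 : (1 / 2 : ℝ) ^ (n + 1) * ∑ ξ ∈ w, |y ξ| ≤ ‖y‖ :=
    (sum_abs_le_q (n + 1) y hwF).trans (q_le_norm _ _)
  have h2 : ∑ ξ ∈ w, |y ξ| = ∑ k ∈ s, |a k| * ∑ ξ ∈ t (φ k), |z (φ k) ξ| := by
    rw [hwb, Finset.sum_biUnion]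
    · refine Finset.sum_congr rfl fun k hk => ?_
      rw [Finset.mul_sum]
      refine Finset.sum_congr rfl fun ξ hξ => ?_
      rw [hy, sum_smul_apply_of_disjoint (z := fun k => z (φ k)) hzφ a hk (htz _ hξ), abs_mul]
    · intro i _ j _ hij
      exact Finset.disjoint_of_subset_left (htz _) (Finset.disjoint_of_subset_right (htz _)
        (hzφ hij))
  refine le_trans ?_ h1
  rw [h2, Finset.mul_sum, Finset.mul_sum]
  refine Finset.sum_le_sum fun k _ => ?_
  have := hlt (φ k)
  have h3 := abs_nonneg (a k)
  rw [pow_succ]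
  nlinarith

theorem ev_filter_ge {f : ℕ →₀ ℝ} (hf : TsFunctional d.adm f) (p : ℕ) (x : C00 d) :
    ev f (fun n => q n x) ≤
      ev (f.filter (p ≤ ·)) (fun n => q n x) + ∑ i ∈ Finset.range p, q i x := by
  classical
  have h1 : ev (f.filter (p ≤ ·)) (fun n => q n x) =
      ∑ i ∈ f.support with p ≤ i, f i * q i x := by
    rw [ev, Finsupp.support_filter]
    exact Finset.sum_congr rfl fun i hi => by
      rw [Finsupp.filter_apply_pos _ _ (Finset.mem_filter.1 hi).2]
  rw [h1, ev, ← Finset.sum_filter_add_sum_filter_not f.support (p ≤ ·)]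
  refine add_le_add le_rfl ?_
  calc ∑ i ∈ f.support with ¬ p ≤ i, f i * q i x ≤ ∑ i ∈ f.support with ¬ p ≤ i, q i x :=
        Finset.sum_le_sum fun i _ => mul_le_of_le_one_left (q_nonneg i x) (hf.bounds i).2
    _ ≤ ∑ i ∈ Finset.range p, q i x :=
        Finset.sum_le_sum_of_subset_of_nonneg
          (fun i hi => Finset.mem_range.2 (not_le.1 (Finset.mem_filter.1 hi).2))
          fun i _ _ => q_nonneg i x

/-- Disjointly supported vectors on which every `q n` tends to zero have a subsequence with a
lower `ℓ₁`-estimate: functionals norming them can be chosen with successive supports, and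
admissibly many of these combine to a functional. -/
theorem exists_lowerEstimate_of_q_tendsto (hd : d.IsMultiplicative) {z : ℕ → C00 d}
    (hz : Pairwise (Function.onFun Disjoint fun k => supp (z k))) {δ : ℝ} (hδ : 0 < δ)
    (hle : ∀ k, δ < ‖z k‖) (h : ∀ n, Tendsto (fun k => q n (z k)) atTop (𝓝 0)) :
    ∃ φ : ℕ → ℕ, StrictMono φ ∧ LowerEstimate d.adm (δ / 4) (z ∘ φ) := by
  classical
  have step : ∀ mp : ℕ × ℕ, ∃ k, mp.1 < k ∧ ∃ g, TsFunctional d.adm g ∧ (∀ i, g i ≠ 0 → mp.2 ≤ i) ∧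
      δ / 2 ≤ ev g (fun n => q n (z k)) := by
    rintro ⟨m, p⟩
    have hsum : Tendsto (fun k => ∑ i ∈ Finset.range p, q i (z k)) atTop (𝓝 0) := by
      simpa using tendsto_finsetSum (Finset.range p) fun i _ => h i
    obtain ⟨k, hk, hmk⟩ := ((hsum.eventually_le_const (half_pos hδ)).and
      (eventually_gt_atTop m)).exists
    obtain ⟨f, hf, hlt⟩ := exists_lt_ev (z k) hδ.le (hle k)
    refine ⟨k, hmk, _, hf.filter_le d.empty_mem_adm p, fun i hi => ?_, ?_⟩
    · by_contra hpi
      exact hi (Finsupp.filter_apply_neg _ _ hpi)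
    · have := ev_filter_ge hf p (z k)
      linarith
  choose k hmk g hg hgp hev using step
  let st : ℕ → ℕ × ℕ := fun j =>
    Nat.rec (0, 0) (fun _ mp => (k mp, max mp.2 ((g mp).support.sup id) + 1)) j
  have hst : ∀ j, st (j + 1) = (k (st j), max (st j).2 ((g (st j)).support.sup id) + 1) :=
    fun _ => rfl
  have hφ : StrictMono fun j => k (st j) := strictMono_nat_of_lt_succ fun j => by
    have := hmk (st (j + 1))
    rwa [hst j] at this
  have hp : StrictMono fun j => (st j).2 := strictMono_nat_of_lt_succ fun j => by
    simp only [hst j]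
    omega
  have hgup : ∀ j j', j < j' → ∀ i, g (st j) i ≠ 0 → i < (st j').2 := by
    intro j j' hjj' i hi
    have h1 : i ≤ (g (st j)).support.sup id :=
      Finset.le_sup (f := id) (Finsupp.mem_support_iff.2 hi)
    have h2 : (st (j + 1)).2 ≤ (st j').2 := hp.monotone (Nat.succ_le_of_lt hjj')
    rw [hst j] at h2
    simp only at h2
    omega
  refine ⟨fun j => k (st j), hφ, fun s hs a => ?_⟩
  have hzφ : Pairwise (Function.onFun Disjoint fun j => supp (z (k (st j)))) :=
    fun i j hij => hz (hφ.injective.ne hij)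
  have hP : s.image (fun j => (st j).2) ∈ d.adm :=
    hd.spreads s hs _ (hp.strictMonoOn _) fun j _ => hp.id_le j
  -- `P` has the elements `(st j).2`, and the functional attached to this element is `g (st j)`.
  let f : ℕ → ℕ →₀ ℝ := fun p => g (st (Function.invFun (fun j => (st j).2) p))
  have hfj : ∀ j, f (st j).2 = g (st j) := fun j => by
    have := Function.leftInverse_invFun hp.injective j
    simp only [f]
    exact congrArg (fun j => g (st j)) this
  have hnode := TsFunctional.node _ hP f
    (fun p hp' => by
      obtain ⟨j, -, rfl⟩ := Finset.mem_image.1 hp'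
      rw [hfj]
      exact hg _)
    (fun p hp' x hx => by
      obtain ⟨j, -, rfl⟩ := Finset.mem_image.1 hp'
      rw [hfj] at hx
      exact hgp _ _ hx)
    (fun p hp' p' hp'' hlt x hx => by
      obtain ⟨j, -, rfl⟩ := Finset.mem_image.1 hp'
      obtain ⟨j', -, rfl⟩ := Finset.mem_image.1 hp''
      rw [hfj] at hx
      exact hgup j j' (hp.lt_iff_lt.1 hlt) x hx)
  refine le_trans ?_ (ev_le_norm hnode _)
  rw [ev_node, Finset.sum_image hp.injective.injOn, Finset.mul_sum, Finset.mul_sum]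
  refine Finset.sum_le_sum fun j hj => ?_
  rw [hfj]
  have h1 : |a j| * ev (g (st j)) (fun n => q n (z (k (st j)))) ≤
      ev (g (st j)) (fun n => q n (∑ i ∈ s, a i • z (k (st i)))) := by
    refine le_trans (le_of_eq ?_) (ev_mono (hg (st j)) fun i _ =>
      q_smul_le_q_sum (z := fun j => z (k (st j))) hzφ a hj i)
    rw [ev, ev, Finset.mul_sum]
    exact Finset.sum_congr rfl fun i _ => mul_left_comm _ _ _
  have h2 := mul_le_mul_of_nonneg_left (hev (st j)) (abs_nonneg (a j))
  simp only [Function.comp_apply]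
  linarith

/-- Disjointly supported vectors whose norms are bounded below have a subsequence with a lower
`ℓ₁`-estimate on the admissible sets. -/
theorem exists_lowerEstimate_of_disjoint (hd : d.IsMultiplicative) {z : ℕ → C00 d}
    (hz : Pairwise (Function.onFun Disjoint fun k => supp (z k))) {δ : ℝ} (hδ : 0 < δ)
    (hle : ∀ k, δ < ‖z k‖) :
    ∃ φ : ℕ → ℕ, StrictMono φ ∧ ∃ c, 0 < c ∧ LowerEstimate d.adm c (z ∘ φ) := by
  by_cases h : ∀ n, Tendsto (fun k => q n (z k)) atTop (𝓝 0)
  · obtain ⟨φ, hφ, hest⟩ := exists_lowerEstimate_of_q_tendsto hd hz hδ hle h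
    exact ⟨φ, hφ, δ / 4, by linarith, hest⟩
  · push Not at h
    obtain ⟨n, hn⟩ := h
    have : ∃ ε > 0, ∃ᶠ k in atTop, ε < q n (z k) := by
      by_contra hno
      push Not at hno
      refine hn (tendsto_order.2 ⟨fun a ha => Eventually.of_forall fun k =>
        ha.trans_le (q_nonneg n _), fun a ha => ?_⟩)
      have := hno (a / 2) (half_pos ha)
      filter_upwards [this] with k hk
      linarith
    obtain ⟨ε, hε, hfreq⟩ := this
    obtain ⟨ψ, hψ, hlt⟩ := extraction_of_frequently_atTop hfreq
    obtain ⟨φ, hφ, hest⟩ := exists_lowerEstimate_of_le_q hd (z := z ∘ ψ)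
      (fun i j hij => hz (hψ.injective.ne hij)) hε hlt
    exact ⟨ψ ∘ φ, hψ.comp hφ, ε / 2, by linarith, hest⟩

/-- The unit vectors are boundedly complete: arbitrarily many disjoint pieces of `g` of norm at
least `η` would span `ℓ₁^n`s, and their sums could not be bounded. -/
theorem exists_forall_norm_cut_le (hd : d.IsMultiplicative) {g : I → ℝ} {K : ℝ}
    (hK : ∀ A, ‖(cut g A : C00 d)‖ ≤ K) {η : ℝ} (hη : 0 < η) :
    ∃ A₀ : Finset I, ∀ A, Disjoint A₀ A → ‖(cut g A : C00 d)‖ ≤ η := by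
  classical
  by_contra hno
  push Not at hno
  obtain ⟨A, hA, hlt⟩ := exists_disjoint_seq (p := fun A => η < ‖(cut g A : C00 d)‖) hno
  have hsupp : ∀ k, supp (cut g (A k) : C00 d) ⊆ A k := fun k ξ hξ => by
    rw [mem_supp, cut_apply] at hξ
    by_contra hne
    exact hξ (if_neg hne)
  obtain ⟨φ, hφ, c, hc, hest⟩ := exists_lowerEstimate_of_disjoint hd
    (z := fun k => cut g (A k)) (fun i j hij => Finset.disjoint_of_subset_left (hsupp i)
      (Finset.disjoint_of_subset_right (hsupp j) (hA hij))) hη hlt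
  obtain ⟨n, hn⟩ := exists_nat_gt (K / c)
  obtain ⟨s, hs, rfl⟩ := hd.exists_card n
  have h1 := hest s hs fun _ => 1
  have h2 : ∑ k ∈ s, (1 : ℝ) • ((fun k => (cut g (A k) : C00 d)) ∘ φ) k =
      cut g (s.biUnion fun k => A (φ k)) := by
    simp only [one_smul, Function.comp_apply]
    rw [cut, Finset.sum_biUnion]
    · rfl
    · intro i _ j _ hij
      exact hA (hφ.injective.ne hij)
  rw [h2] at h1
  have h3 := h1.trans (hK _)
  simp only [abs_one, Finset.sum_const, nsmul_eq_mul, mul_one] at h3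
  rw [div_lt_iff₀ hc] at hn
  linarith

theorem eventually_apply_eq_zero {z : ℕ → C00 d}
    (hz : Pairwise (Function.onFun Disjoint fun k => supp (z k))) (ξ : I) :
    ∀ᶠ k in atTop, z k ξ = 0 := by
  by_cases h : ∃ i, z i ξ ≠ 0
  · obtain ⟨i, hi⟩ := h
    filter_upwards [eventually_gt_atTop i] with k hk
    by_contra hne
    exact Finset.disjoint_left.1 (hz hk.ne) (mem_supp.2 hi) (mem_supp.2 hne)
  · push Not at h
    exact Eventually.of_forall h

/-- A coordinatewise convergent sequence is a Cauchy sequence if its members are uniformly small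
off finite sets. -/
theorem cauchySeq_of_forall_eventually {y : ℕ → C00 d} {g : I → ℝ}
    (hg : ∀ ξ, Tendsto (fun k => y k ξ) atTop (𝓝 (g ξ)))
    (h : ∀ δ > 0, ∃ A : Finset I, ∀ᶠ k in atTop, ‖proj (A : Set I)ᶜ (y k)‖ ≤ δ) : CauchySeq y := by
  rw [Metric.cauchySeq_iff']
  intro ε hε
  obtain ⟨A, hA⟩ := h (ε / 5) (by linarith)
  have hcut := (tendsto_iff_norm_sub_tendsto_zero.1 (tendsto_cut (d := d) hg A))
  obtain ⟨N, hN⟩ := eventually_atTop.1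
    (hA.and (hcut.eventually_le_const (show (0 : ℝ) < ε / 5 by linarith)))
  refine ⟨N, fun k hk => ?_⟩
  obtain ⟨h1, h2⟩ := hN k hk
  obtain ⟨h3, h4⟩ := hN N le_rfl
  have key : ∀ x : C00 d, x = cut x A + proj (A : Set I)ᶜ x := fun x => by
    rw [← proj_eq_cut, proj_add_proj_compl]
  rw [dist_eq_norm, key (y k), key (y N)]
  have : cut (y k) A + proj (A : Set I)ᶜ (y k) - (cut (y N) A + proj (A : Set I)ᶜ (y N)) =
      (cut (y k) A - cut g A) + proj (A : Set I)ᶜ (y k) -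
        ((cut (y N) A - cut g A) + proj (A : Set I)ᶜ (y N)) := by abel
  rw [this]
  have h5 := norm_sub_le ((cut (y k) A - cut g A) + proj (A : Set I)ᶜ (y k))
    ((cut (y N) A - cut g A) + proj (A : Set I)ᶜ (y N))
  have h6 := norm_add_le (cut (y k) A - cut g A : C00 d) (proj (A : Set I)ᶜ (y k))
  have h7 := norm_add_le (cut (y N) A - cut g A : C00 d) (proj (A : Set I)ᶜ (y N))
  linarith

/-- A bounded coordinatewise convergent sequence which is not uniformly small off finite sets has a
subsequence consisting of disjointly supported vectors of large norm, pieces of the coordinatewise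
limit, and small errors. -/
theorem exists_blocks {y : ℕ → C00 d} {g : I → ℝ}
    (hg : ∀ ξ, Tendsto (fun k => y k ξ) atTop (𝓝 (g ξ))) {δ : ℝ}
    (h : ∀ A : Finset I, ∃ᶠ k in atTop, δ < ‖proj (A : Set I)ᶜ (y k)‖) :
    ∃ φ : ℕ → ℕ, StrictMono φ ∧ ∃ (A : ℕ → Finset I) (z : ℕ → C00 d),
      Pairwise (Function.onFun Disjoint fun k => supp (z k)) ∧ (∀ i, δ < ‖z i‖) ∧
      ∀ i, ‖y (φ i) - (z i + cut g (A i))‖ ≤ 1 / ((i : ℝ) + 1) := by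
  classical
  have step : ∀ (A : Finset I) (m i : ℕ), ∃ k, m < k ∧ δ < ‖proj (A : Set I)ᶜ (y k)‖ ∧
      ‖(cut (y k) A - cut g A : C00 d)‖ ≤ 1 / ((i : ℝ) + 1) := by
    intro A m i
    have hcut := (tendsto_iff_norm_sub_tendsto_zero.1 (tendsto_cut (d := d) hg A))
    obtain ⟨k, h1, h2, h3⟩ := ((h A).and_eventually ((hcut.eventually_le_const
      (show (0 : ℝ) < 1 / ((i : ℝ) + 1) by positivity)).and (eventually_gt_atTop m))).exists
    exact ⟨k, h3, h1, h2⟩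
  choose k hmk hkδ hkg using step
  let st : ℕ → Finset I × ℕ := fun j =>
    Nat.rec (∅, 0) (fun i Am => (Am.1 ∪ supp (y (k Am.1 Am.2 i)), k Am.1 Am.2 i)) j
  have hst : ∀ j, st (j + 1) = ((st j).1 ∪ supp (y (k (st j).1 (st j).2 j)),
    k (st j).1 (st j).2 j) := fun _ => rfl
  have hmono : Monotone fun j => (st j).1 := monotone_nat_of_le_succ fun j => by
    simp only [hst j]
    exact Finset.subset_union_left
  have hlt : ∀ i j, i < j → Disjoint
      (supp (proj ((st i).1 : Set I)ᶜ (y (k (st i).1 (st i).2 i))))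
      (supp (proj ((st j).1 : Set I)ᶜ (y (k (st j).1 (st j).2 j)))) := by
    intro i j hij
    refine Finset.disjoint_left.2 fun ξ hi hj => ?_
    have h1 : ξ ∈ (st j).1 := by
      refine hmono (Nat.succ_le_of_lt hij) ?_
      simp only [Nat.succ_eq_add_one, hst i]
      refine Finset.mem_union_right _ (mem_supp.2 fun h0 => mem_supp.1 hi ?_)
      have := abs_proj_apply_le ((st i).1 : Set I)ᶜ (y (k (st i).1 (st i).2 i)) ξ
      rw [h0, abs_zero] at this
      exact abs_nonpos_iff.1 this
    exact mem_supp.1 hj (proj_apply_of_notMem (by simpa using h1) _)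
  refine ⟨fun j => k (st j).1 (st j).2 j, strictMono_nat_of_lt_succ fun j => ?_,
    fun j => (st j).1, fun j => proj ((st j).1 : Set I)ᶜ (y (k (st j).1 (st j).2 j)),
    fun i j hij => ?_, fun i => hkδ _ _ _, fun i => ?_⟩
  · have := hmk (st (j + 1)).1 (st (j + 1)).2 (j + 1)
    rwa [hst j] at this ⊢
  · rcases lt_or_gt_of_ne hij with h | h
    · exact hlt i j h
    · exact (hlt j i h).symm
  · refine le_trans (le_of_eq ?_) (hkg (st i).1 (st i).2 i)
    congr 1
    have := proj_add_proj_compl ((st i).1 : Set I) (y (k (st i).1 (st i).2 i))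
    rw [proj_eq_cut] at this
    nth_rewrite 1 [← this]
    abel

/-- Every bounded sequence without Cauchy subsequences has a subsequence with a lower
`ℓ₁`-estimate on the admissible sets. -/
theorem exists_lowerEstimate (hd : d.IsMultiplicative) {y : ℕ → C00 d} {K : ℝ}
    (hK : ∀ k, ‖y k‖ ≤ K) (hy : ∀ φ : ℕ → ℕ, StrictMono φ → ¬ CauchySeq (y ∘ φ)) :
    ∃ φ : ℕ → ℕ, StrictMono φ ∧ ∃ c, 0 < c ∧ LowerEstimate d.adm c (y ∘ φ) := by
  classical
  obtain ⟨φ₁, hφ₁, g, hg⟩ := exists_tendsto_apply hK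
  have hδ : ∃ δ > 0, ∀ A : Finset I, ∃ᶠ k in atTop, δ < ‖proj (A : Set I)ᶜ ((y ∘ φ₁) k)‖ := by
    by_contra hno
    push Not at hno
    refine hy φ₁ hφ₁ (cauchySeq_of_forall_eventually hg fun δ hδ => ?_)
    obtain ⟨A, hA⟩ := hno δ hδ
    exact ⟨A, hA⟩
  obtain ⟨δ, hδ0, hδ⟩ := hδ
  obtain ⟨φ₂, hφ₂, A, z, hz, hzδ, hyz⟩ := exists_blocks (y := y ∘ φ₁) hg hδ
  obtain ⟨φ₃, hφ₃, c, hc, hest⟩ := exists_lowerEstimate_of_disjoint hd hz hδ0 hzδ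
  obtain ⟨A₀, hA₀⟩ := exists_forall_norm_cut_le hd
    (norm_cut_le_of_tendsto (y := y ∘ φ₁) (fun k => hK _) hg) (show 0 < c / 4 by linarith)
  -- From some index on, the blocks live off `A₀` and the errors are small.
  have hev : ∀ᶠ i in atTop, (∀ ξ ∈ A₀, z i ξ = 0) ∧ 1 / ((i : ℝ) + 1) ≤ c / 4 :=
    ((Finset.eventually_all A₀).2 fun ξ _ => eventually_apply_eq_zero hz ξ).and
      (tendsto_one_div_add_atTop_nhds_zero_nat.eventually_le_const (by linarith))
  obtain ⟨N, hN⟩ := eventually_atTop.1 hev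
  have hshift : StrictMono fun i : ℕ => i + N := fun i j h => Nat.add_lt_add_right h N
  refine ⟨fun i => φ₁ (φ₂ (φ₃ (i + N))), hφ₁.comp (hφ₂.comp (hφ₃.comp hshift)), c / 2 / 1,
    by linarith, ?_⟩
  refine LowerEstimate.of_map (proj (A₀ : Set I)ᶜ) zero_lt_one
    (fun v => by rw [one_mul]; exact norm_proj_le _ v) ?_
  have h1 : LowerEstimate d.adm c fun i => z (φ₃ (i + N)) := hest.comp_strictMono hd.spreads hshift
  refine (h1.of_norm_sub_le (e := c / 2) fun i => ?_).mono_const (by linarith)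
  obtain ⟨hz0, hsmall⟩ := hN (φ₃ (i + N)) ((Nat.le_add_left N i).trans (hφ₃.id_le _))
  set j := φ₃ (i + N)
  have hpz : proj (A₀ : Set I)ᶜ (z j) = z j := by
    ext ξ
    by_cases h : ξ ∈ A₀
    · rw [hz0 ξ h, proj_apply_of_notMem (by simpa using h)]
    · rw [proj_apply_of_mem (by simpa using h)]
  have hpc : proj (A₀ : Set I)ᶜ (cut g (A j) : C00 d) = cut g (A j \ A₀) := by
    ext ξ
    rw [cut_apply]
    by_cases h : ξ ∈ A₀
    · rw [proj_apply_of_notMem (by simpa using h), if_neg (by simp [h])]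
    · rw [proj_apply_of_mem (by simpa using h), cut_apply]
      simp [h]
  have h2 : z j - proj (A₀ : Set I)ᶜ (y (φ₁ (φ₂ j))) =
      -(proj (A₀ : Set I)ᶜ (y (φ₁ (φ₂ j)) - (z j + cut g (A j))) + cut g (A j \ A₀)) := by
    rw [map_sub, map_add, hpz, hpc]
    abel
  rw [Function.comp_apply, h2, norm_neg]
  refine (norm_add_le _ _).trans ?_
  have h3 := hA₀ (A j \ A₀) Finset.disjoint_sdiff
  have h4 := (norm_proj_le (A₀ : Set I)ᶜ (y (φ₁ (φ₂ j)) - (z j + cut g (A j)))).trans (hyz j)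
  linarith

end C00

/-! ### From lower `ℓ₁`-estimates to trees of vectors -/

namespace C00

variable {I : Type u} {d : TsData I}

/-- The sets of vectors vanishing on a finite set of coordinates. -/
def farSets (d : TsData I) : Set (Set (C00 d)) := {V | ∃ A : Finset I, V = {z | ∀ ξ ∈ A, z ξ = 0}}

/-- The sets of vectors on which `q 0`, ..., `q n` are small. -/
def thinSets (d : TsData I) : Set (Set (C00 d)) :=
  {V | ∃ n : ℕ, ∃ ε > 0, V = {z | ∀ i ≤ n, q i z ≤ ε}}

/-- The vectors close to a combination of the `y k`, `k ∈ u`, whose coefficients have alternating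
signs and a prescribed sum of absolute values. -/
def signedSet (y : ℕ → C00 d) (K c : ℝ) (u : Finset ℕ) : Set (C00 d) :=
  {w | ∃ a : ℕ → ℝ, (∀ k ∈ u, 0 ≤ (-1) ^ k * a k) ∧ ∑ k ∈ u, (-1) ^ k * a k = 1 / K ∧
    ‖w - ∑ k ∈ u, a k • y k‖ ≤ c / (2 * K)}

theorem signedSet_mono (y : ℕ → C00 d) (K c : ℝ) {u v : Finset ℕ} (huv : u ⊆ v) :
    signedSet y K c u ⊆ signedSet y K c v := by
  classical
  rintro w ⟨a, h1, h2, h3⟩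
  refine ⟨fun k => if k ∈ u then a k else 0, fun k _ => ?_, ?_, ?_⟩
  · dsimp only
    split_ifs with h
    · exact h1 k h
    · simp
  · rw [← h2, ← Finset.sum_subset huv]
    · exact Finset.sum_congr rfl fun k hk => by simp only [if_pos hk]
    · intro k _ hk
      simp only [if_neg hk, mul_zero]
  · have : ∑ k ∈ v, (if k ∈ u then a k else 0) • y k = ∑ k ∈ u, a k • y k := by
      rw [← Finset.sum_subset huv]
      · exact Finset.sum_congr rfl fun k hk => by rw [if_pos hk]
      · intro k _ hk
        rw [if_neg hk, zero_smul]
    rw [this]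
    exact h3

theorem convex_signedSet (y : ℕ → C00 d) (K c : ℝ) (u : Finset ℕ) :
    Convex ℝ (signedSet y K c u) := by
  rintro w ⟨a, h1, h2, h3⟩ w' ⟨a', h1', h2', h3'⟩ s t hs ht hst
  refine ⟨fun k => s * a k + t * a' k, fun k hk => ?_, ?_, ?_⟩
  · have e1 := mul_nonneg hs (h1 k hk)
    have e2 := mul_nonneg ht (h1' k hk)
    linarith
  · have : ∀ k, (-1 : ℝ) ^ k * (s * a k + t * a' k) =
        s * ((-1) ^ k * a k) + t * ((-1) ^ k * a' k) := fun k => by ring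
    simp only [this, Finset.sum_add_distrib, ← Finset.mul_sum, h2, h2', ← add_mul, hst, one_mul]
  · have : s • w + t • w' - ∑ k ∈ u, (s * a k + t * a' k) • y k =
        s • (w - ∑ k ∈ u, a k • y k) + t • (w' - ∑ k ∈ u, a' k • y k) := by
      simp only [add_smul, mul_smul, Finset.sum_add_distrib, ← Finset.smul_sum, smul_sub]
      abel
    rw [this]
    refine (norm_add_le _ _).trans ?_
    rw [norm_smul, norm_smul, Real.norm_of_nonneg hs, Real.norm_of_nonneg ht]
    calc s * ‖w - ∑ k ∈ u, a k • y k‖ + t * ‖w' - ∑ k ∈ u, a' k • y k‖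
        ≤ s * (c / (2 * K)) + t * (c / (2 * K)) := by gcongr
      _ = c / (2 * K) := by rw [← add_mul, hst, one_mul]

theorem le_norm_of_mem_signedSet {y : ℕ → C00 d} {F : Set (Finset ℕ)} {K c : ℝ}
    (hest : LowerEstimate F c y) {u : Finset ℕ} (hu : u ∈ F) {w : C00 d}
    (hw : w ∈ signedSet y K c u) : c / (2 * K) ≤ ‖w‖ := by
  obtain ⟨a, h1, h2, h3⟩ := hw
  have h4 := hest u hu a
  have h5 : ∑ k ∈ u, |a k| = 1 / K := by
    rw [← h2]
    refine Finset.sum_congr rfl fun k hk => ?_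
    rw [← abs_of_nonneg (h1 k hk), abs_mul, abs_pow, abs_neg, abs_one, one_pow, one_mul]
  rw [h5] at h4
  have h6 := norm_sub_norm_le (∑ k ∈ u, a k • y k) w
  rw [norm_sub_rev] at h6
  have h7 : c * (1 / K) = c / (2 * K) + c / (2 * K) := by
    rw [mul_one_div, ← div_div, div_right_comm, add_halves]
  linarith

theorem exists_mem_signedSet {y : ℕ → C00 d} {K c : ℝ} (hK : 0 < K) (hy : ∀ k, ‖y k‖ ≤ K)
    {A : Finset I} {x : C00 d} {k k' : ℕ} (hk : Even k) (hk' : Odd k')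
    (h : ‖cut (y k) A - x‖ ≤ c / 2) (h' : ‖cut (y k') A - x‖ ≤ c / 2) :
    ∃ z ∈ signedSet y K c {k, k'}, (∀ ξ ∈ A, z ξ = 0) ∧ ‖z‖ ≤ 1 := by
  have hne : k ≠ k' := by
    rintro rfl
    exact (Nat.not_even_iff_odd.2 hk') hk
  set w : C00 d := (1 / (2 * K)) • (y k - y k') with hw
  have hproj : ‖w - proj (A : Set I)ᶜ w‖ ≤ c / (2 * K) := by
    have h1 : w - proj (A : Set I)ᶜ w = (1 / (2 * K)) • ((cut (y k) A - x) - (cut (y k') A - x)) := by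
      rw [sub_sub_sub_cancel_right, ← proj_eq_cut, ← proj_eq_cut, ← map_sub, ← map_smul,
        sub_eq_iff_eq_add, proj_add_proj_compl]
    rw [h1, norm_smul, Real.norm_of_nonneg (by positivity), one_div_mul_eq_div]
    gcongr
    exact (norm_sub_le _ _).trans (by linarith)
  refine ⟨proj (A : Set I)ᶜ w, ⟨fun j => (-1) ^ j * (1 / (2 * K)), fun j _ => ?_, ?_, ?_⟩,
    fun ξ hξ => proj_apply_of_notMem (by simpa using hξ) _, ?_⟩
  · rw [← mul_assoc, ← mul_pow]
    norm_num
    exact hK.le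
  · simp only [Finset.sum_pair hne, hk.neg_one_pow, hk'.neg_one_pow]
    field_simp
    norm_num
  · simp only [Finset.sum_pair hne, hk.neg_one_pow, hk'.neg_one_pow]
    rw [norm_sub_rev]
    refine le_trans (le_of_eq ?_) hproj
    congr 1
    rw [hw, one_mul, neg_one_mul, neg_smul, smul_sub, sub_eq_add_neg (_ • _) (_ • y k')]
  · refine (norm_proj_le _ _).trans ?_
    rw [hw, norm_smul, Real.norm_of_nonneg (by positivity), one_div_mul_eq_div,
      div_le_one (by positivity)]
    refine (norm_sub_le _ _).trans ?_
    linarith [hy k, hy k']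

/-- The signs alternate with the parity of `k`, so that a difference `y k - y k'` of vectors with
almost equal coordinates on a finite set `A` is far out; each new vector costs two elements of a
member of `F`, whence the rank `2 * ρ`. -/
theorem blockTree_of_subset_signedSet {y : ℕ → C00 d} {F : Set (Finset ℕ)} {K c : ℝ} (hK : 0 < K)
    (hc : 0 < c) (hy : ∀ k, ‖y k‖ ≤ K) (hest : LowerEstimate F c y) {g : I → ℝ}
    (hg : ∀ ξ, Tendsto (fun k => y k ξ) atTop (𝓝 (g ξ))) (ρ : Ordinal.{0}) (G : Set (Finset ℕ))
    (hG : SecRankGE (2 * ρ) G) (u : Finset ℕ) (hu : ∀ s ∈ G, u ∪ s ∈ F) (L : Set (C00 d))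
    (hL : L ⊆ signedSet y K c u) : BlockTree (farSets d) (c / (2 * K)) ρ L := by
  induction ρ using WellFoundedLT.induction generalizing G u L with
  | ind ρ ih =>
    have huF : u ∈ F := by simpa using hu ∅ (secRankGE_iff.1 hG).1
    rw [blockTree_iff]
    refine ⟨fun z hz => le_norm_of_mem_signedSet hest huF
      (convexHull_min hL (convex_signedSet y K c u) hz), ?_⟩
    rintro ρ' hρ' _ ⟨A, rfl⟩
    have hlt : 2 * ρ' + 1 < 2 * ρ := by
      have h1 : 2 * (ρ' + 1) ≤ 2 * ρ := mul_le_mul_right (Order.add_one_le_of_lt hρ') 2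
      refine lt_of_lt_of_le ?_ h1
      rw [mul_add_one, ← one_add_one_eq_two, ← add_assoc]
      exact Order.lt_add_one_iff.2 le_rfl
    obtain ⟨N, hN⟩ := (secRankGE_iff.1 hG).2 _ hlt
    have hcut := (tendsto_iff_norm_sub_tendsto_zero.1 (tendsto_cut (d := d) hg A))
    obtain ⟨N', hN'⟩ := eventually_atTop.1 (hcut.eventually_le_const (half_pos hc))
    set k := 2 * max N N' with hk
    have hkN : N ≤ k := by omega
    have hkN' : N' ≤ k := by omega
    obtain ⟨M, hM⟩ := (secRankGE_iff.1 (hN k hkN)).2 (2 * ρ') (Order.lt_add_one_iff.2 le_rfl)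
    set k' := 2 * (M + k) + 1 with hk'
    obtain ⟨z, hz, hzA, hz1⟩ := exists_mem_signedSet hK hy (k := k) (k' := k') (even_two_mul _)
      (odd_two_mul_add_one _) (hN' k hkN') (hN' k' (by omega))
    refine ⟨z, hzA, hz1, ih ρ' hρ' _ (hM k' (by omega)) (u ∪ {k, k'}) ?_ _ (insert_subset ?_ ?_)⟩
    · rintro s ⟨-, hs⟩
      have := hu _ hs.2
      rwa [Finset.insert_eq, Finset.insert_eq, ← Finset.union_assoc, ← Finset.union_assoc,
        Finset.union_assoc u, ← Finset.insert_eq] at this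
    · exact signedSet_mono y K c Finset.subset_union_right hz
    · exact hL.trans (signedSet_mono y K c Finset.subset_union_left)

/-- A bounded sequence with a lower `ℓ₁`-estimate on a family of rank `2 * ρ` gives rise to a tree
of rank `ρ` of vectors far out: the differences of its members along the family, with the signs
chosen so that convex combinations of such differences have coefficients with a fixed sum of
absolute values. -/
theorem exists_blockTree_farSets {y : ℕ → C00 d} {F : Set (Finset ℕ)} {K c : ℝ} (hc : 0 < c)
    (hy : ∀ k, ‖y k‖ ≤ K) (hest : LowerEstimate F c y) {ρ : Ordinal.{0}}
    (hF : SecRankGE (2 * ρ) F) : ∃ c' > 0, BlockTree (farSets d) c' ρ ∅ := by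
  obtain ⟨φ, hφ, g, hg⟩ := exists_tendsto_apply hy
  have hK : 0 < |K| + 1 := by positivity
  refine ⟨c / (2 * (|K| + 1)), by positivity, ?_⟩
  exact blockTree_of_subset_signedSet (y := y ∘ φ) hK hc
    (fun k => (hy _).trans ((le_abs_self K).trans (by linarith)))
    (hest.comp hφ.injective fun s hs => hs) hg ρ _ (hF.preimage hφ) ∅
    (fun s hs => by rwa [Finset.empty_union]) ∅ (empty_subset _)

/-! ### Averages on which finitely many of the families are small -/

theorem isVectorTree_farSets (d : TsData I) (c : ℝ) :
    IsVectorTree (toFinsupp (d := d)).toLinearMap cofinite {z : C00 d | ‖z‖ ≤ 1}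
      (fun ρ : Ordinal.{0} => BlockTree (farSets d) c ρ) where
  mono ρ ρ' L L' h hρ hL := h.mono le_rfl hρ hL
  extend ρ ρ' L h hρ U hU := by
    have hU' : Uᶜ.Finite := hU
    obtain ⟨z, hz, hz1, hzB⟩ := (blockTree_iff.1 h).2 ρ' hρ _ ⟨hU'.toFinset, rfl⟩
    refine ⟨z, hz1, fun ξ hξ => ?_, hzB⟩
    by_contra hno
    exact hξ (hz ξ (by simpa using hno))

open scoped Classical in
/-- If the families have ranks below the exponentially indecomposable ordinal `l`, then averages of
a tree of rank `l * ρ` form a tree of rank `ρ` on which the first few families are small. -/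
theorem blockTree_thinSets {l : Ordinal.{0}} (hl : IsExpIndecomposable l) (hω : ω < l)
    (hfam : ∀ n, ∃ ρ < l, RankLE cofinite link ρ (d.fam n)) {c : ℝ} {ρ : Ordinal.{0}}
    {L : Set (C00 d)} (h : BlockTree (farSets d) c (l * ρ) L) :
    BlockTree (thinSets d) c ρ L := by
  induction ρ using WellFoundedLT.induction generalizing L with
  | ind ρ ih =>
    rw [blockTree_iff]
    refine ⟨(blockTree_iff.1 h).1, ?_⟩
    rintro ρ' hρ' _ ⟨n, ε, hε, rfl⟩
    obtain ⟨σ, hσ, hσF⟩ := RankLE.iUnion_lt (l := cofinite) (step := link)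
      (fun ξ F G => link_union ξ F G) (fun ξ F G h => link_mono ξ F G h) link_empty
      (Ordinal.omega0_pos.trans hω) d.fam (n + 1) (fun k _ _ => hfam k)
    obtain ⟨β, hβ, hβl⟩ := hl.exists_lt_opow hω hσ
    have hle : l * ρ' + ω ^ β ≤ l * ρ := by
      refine le_trans (add_le_add le_rfl hβl.le) ?_
      rw [← mul_add_one]
      exact mul_le_mul_right (Order.add_one_le_of_lt hρ') l
    obtain ⟨w, hw1, -, hwB, hwt⟩ := (isVectorTree_farSets d c).exists_average
      (K := {z : C00 d | ‖z‖ ≤ 1}) (F := ⋃ k < n + 1, d.fam k) (M := 2 ^ n)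
      (by simpa [Metric.closedBall, dist_zero_right] using convex_closedBall (0 : C00 d) 1)
      (by
        intro s hs t hts
        simp only [mem_iUnion] at hs ⊢
        obtain ⟨k, hk, hs⟩ := hs
        exact ⟨k, hk, d.fam_hereditary k s hs t hts⟩)
      (by positivity)
      (by
        intro z hz t ht
        simp only [mem_iUnion] at ht
        obtain ⟨k, hk, ht⟩ := ht
        have h1 := ((sum_abs_le_q k z ht).trans (q_le_norm k z)).trans hz
        have h2 : (2 : ℝ) ^ k ≤ 2 ^ n := pow_le_pow_right₀ one_le_two (by omega)
        refine le_trans ?_ h2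
        rw [one_div, inv_pow, inv_mul_le_iff₀ (by positivity), mul_one] at h1
        exact h1)
      hσF hβ (h.mono le_rfl hle (subset_convexHull ℝ L)) univ_mem hε
    refine ⟨w, fun i hi => ?_, hw1, ih ρ' hρ' hwB⟩
    rw [q]
    have h1 : famNorm (d.fam i) (toFinsupp w) ≤ ε := famNorm_le hε.le fun t ht =>
      hwt t (by
        simp only [mem_iUnion]
        exact ⟨i, by omega, ht⟩)
    refine le_trans (mul_le_of_le_one_left (famNorm_nonneg _) ?_) h1
    exact pow_le_one₀ (by norm_num) (by norm_num)

theorem convex_of_mem_thinSets {V : Set (C00 d)} (hV : V ∈ thinSets d) : Convex ℝ V := by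
  obtain ⟨n, ε, hε, rfl⟩ := hV
  intro x hx y hy a b ha hb hab i hi
  have h1 := q_add_le i (a • x) (b • y)
  rw [q_smul, q_smul, abs_of_nonneg ha, abs_of_nonneg hb] at h1
  have h2 := mul_le_mul_of_nonneg_left (hx i hi) ha
  have h3 := mul_le_mul_of_nonneg_left (hy i hi) hb
  have h4 : a * ε + b * ε = ε := by rw [← add_mul, hab, one_mul]
  linarith

theorem exists_subset_inter_of_mem_thinSets {V V' : Set (C00 d)} (hV : V ∈ thinSets d)
    (hV' : V' ∈ thinSets d) : ∃ W ∈ thinSets d, W ⊆ V ∩ V' := by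
  obtain ⟨n, ε, hε, rfl⟩ := hV
  obtain ⟨n', ε', hε', rfl⟩ := hV'
  exact ⟨_, ⟨max n n', min ε ε', lt_min hε hε', rfl⟩, fun z hz =>
    ⟨fun i hi => (hz i (hi.trans (le_max_left _ _))).trans (min_le_left _ _),
      fun i hi => (hz i (hi.trans (le_max_right _ _))).trans (min_le_right _ _)⟩⟩

theorem exists_smul_mem_of_mem_thinSets {V : Set (C00 d)} (hV : V ∈ thinSets d) {a : ℝ}
    (ha : 0 < a) : ∃ W ∈ thinSets d, ∀ w ∈ W, a • w ∈ V := by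
  obtain ⟨n, ε, hε, rfl⟩ := hV
  refine ⟨_, ⟨n, ε / a, by positivity, rfl⟩, fun w hw i hi => ?_⟩
  rw [q_smul, abs_of_pos ha, ← le_div_iff₀' ha]
  exact hw i hi

end C00

/-! ### Admissible sums on averages of short blocks -/

/-- The families of intervals `(a, b]` all of which are met by one member of `G`. -/
def hit (G : Set (Finset ℕ)) : Set (Finset (ℕ × ℕ)) :=
  {t | ∃ P ∈ G, ∀ ξ ∈ t, (P ∩ Finset.Ioc ξ.1 ξ.2).Nonempty}

theorem isHereditary_hit (G : Set (Finset ℕ)) : IsHereditary (hit G) := by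
  rintro t ⟨P, hP, h⟩ s hst
  exact ⟨P, hP, fun ξ hξ => h ξ (hst hξ)⟩

theorem IsHereditary.section_ {G : Set (Finset ℕ)} (hG : IsHereditary G) (n : ℕ) :
    IsHereditary (section_ G n) := fun _ hs _ hts =>
  ⟨fun m hm => hs.1 m (hts hm), hG _ hs.2 _ (Finset.insert_subset_insert n hts)⟩

theorem IsHereditary.biUnion_lt {G : ℕ → Set (Finset ℕ)} (hG : ∀ k, IsHereditary (G k)) (n : ℕ) :
    IsHereditary (⋃ k < n, G k) := by
  intro s hs t hts
  simp only [mem_iUnion] at hs ⊢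
  obtain ⟨k, hk, hs⟩ := hs
  exact ⟨k, hk, hG k s hs t hts⟩

/-- A family of intervals whose tails are met by members of `G` has no larger rank than `G`: once an
interval `(a, b]` is fixed, the members of `G` meeting it have one of finitely many `p ≤ b`
as an element, and the intervals beyond `b` are met by the members of the section of `G` at `p`. -/
theorem rankLE_link_of_inter_subset_hit {ρ : Ordinal.{u}} {G : Set (Finset ℕ)}
    (hG : IsHereditary G) (hρ : SecRankLE ρ G) {F : Set (Finset (ℕ × ℕ))} (hF : IsHereditary F)
    {N : ℕ} (hFG : ∀ t ∈ F, (∀ ξ ∈ t, N ≤ ξ.1) → t ∈ hit G) :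
    RankLE (comap Prod.fst atTop) link ρ F := by
  induction ρ using WellFoundedLT.induction generalizing G F N with
  | ind ρ ih =>
    rw [rankLE_iff]
    filter_upwards [preimage_mem_comap (mem_atTop N)] with ξ hξ
    rintro ⟨s, hs⟩
    have hξF : {ξ} ∈ F := hF _ hs _ (Finset.singleton_subset_iff.2 (Finset.mem_insert_self ξ s))
    have hsec : ∀ p, (section_ G p).Nonempty → ∃ ρ' < ρ, SecRankLE ρ' (section_ G p) :=
      secRankLE_iff.1 hρ
    have hsub : ∀ P ∈ G, ∀ p ∈ P, P.filter (p < ·) ∈ section_ G p := fun P hP p hp =>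
      ⟨fun m hm => (Finset.mem_filter.1 hm).2, hG P hP _
        (Finset.insert_subset hp (Finset.filter_subset _ _))⟩
    obtain ⟨P, hP, hPξ⟩ := hFG _ hξF fun η hη => by
      rw [Finset.mem_singleton.1 hη]
      exact hξ
    obtain ⟨p, hp⟩ := hPξ ξ (Finset.mem_singleton_self ξ)
    obtain ⟨ρ₀, hρ₀, -⟩ := hsec p ⟨_, hsub P hP p (Finset.mem_inter.1 hp).1⟩
    obtain ⟨ρ', hρ', hρ'U⟩ := SecRankLE.iUnion_lt ((zero_le (a := ρ₀)).trans_lt hρ₀)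
      (fun p => section_ G p) (ξ.2 + 1) fun p _ => hsec p
    refine ⟨ρ', hρ', ih ρ' hρ' (IsHereditary.biUnion_lt (fun p => hG.section_ p) _) hρ'U
      (N := max N ξ.2) ?_ ?_⟩
    · intro t ht r hrt
      exact hF _ ht _ (Finset.insert_subset_insert ξ hrt)
    · intro t ht htN
      obtain ⟨P, hP, hPt⟩ := hFG _ ht fun η hη => by
        rcases Finset.mem_insert.1 hη with rfl | hη
        · exact hξ
        · exact (le_max_left _ _).trans (htN η hη)
      obtain ⟨p, hp⟩ := hPt ξ (Finset.mem_insert_self _ _)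
      rw [Finset.mem_inter, Finset.mem_Ioc] at hp
      refine ⟨P.filter (p < ·), ?_, fun η hη => ?_⟩
      · simp only [mem_iUnion]
        exact ⟨p, by omega, hsub P hP p hp.1⟩
      · obtain ⟨p', hp'⟩ := hPt η (Finset.mem_insert_of_mem hη)
        have h1 := (le_max_right _ _).trans (htN η hη)
        rw [Finset.mem_inter, Finset.mem_Ioc] at hp'
        refine ⟨p', Finset.mem_inter.2 ⟨Finset.mem_filter.2 ⟨hp'.1, ?_⟩, Finset.mem_Ioc.2 hp'.2⟩⟩
        omega

/-- The functionals `f p`, `p ∈ P`, can be combined to the functional `(1 / 2) ∑ f p`. -/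
structure IsAdmissible (H : Set (Finset ℕ)) (P : Finset ℕ) (f : ℕ → ℕ →₀ ℝ) : Prop where
  mem : P ∈ H
  functional : ∀ p ∈ P, TsFunctional H (f p)
  low : ∀ p ∈ P, ∀ x, f p x ≠ 0 → p ≤ x
  up : ∀ p ∈ P, ∀ p' ∈ P, p < p' → ∀ x, f p x ≠ 0 → x < p'

theorem IsAdmissible.node {H : Set (Finset ℕ)} {P : Finset ℕ} {f : ℕ → ℕ →₀ ℝ}
    (h : IsAdmissible H P f) : TsFunctional H ((1 / 2 : ℝ) • ∑ p ∈ P, f p) :=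
  TsFunctional.node P h.mem f h.functional h.low h.up

theorem ev_add (f : ℕ →₀ ℝ) (a b : ℕ → ℝ) : ev f (fun i => a i + b i) = ev f a + ev f b := by
  rw [ev, ev, ev, ← Finset.sum_add_distrib]
  exact Finset.sum_congr rfl fun i _ => mul_add _ _ _

/-- The part of `v` carried by the intervals that `P` meets. -/
noncomputable def hitMass (P : Finset ℕ) : (ℕ × ℕ →₀ ℝ) →ₗ[ℝ] ℝ :=
  Finsupp.linearCombination ℝ fun ξ => if (P ∩ Finset.Ioc ξ.1 ξ.2).Nonempty then 1 else 0

theorem hitMass_eq_sum (P : Finset ℕ) (v : ℕ × ℕ →₀ ℝ) :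
    hitMass P v = ∑ ξ ∈ v.support with (P ∩ Finset.Ioc ξ.1 ξ.2).Nonempty, v ξ := by
  rw [hitMass, Finsupp.linearCombination_apply, Finsupp.sum, Finset.sum_filter]
  exact Finset.sum_congr rfl fun ξ _ => by split_ifs <;> simp

namespace C00

variable {I : Type u} {d : TsData I}

/-- An admissible sum is not much larger than `1 / 2` on a vector concentrated on an interval
`(a, b]` that the admissible set does not meet: only one of the summands is not negligible. -/
theorem ev_node_le {P : Finset ℕ} {f : ℕ → ℕ →₀ ℝ} (h : IsAdmissible d.adm P f) {z : C00 d}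
    (hz : ‖z‖ ≤ 1) {a b : ℕ} {ε : ℝ}
    (hsmall : ∀ s : Finset ℕ, (∀ i ∈ s, i ∉ Finset.Ioc a b) → ∑ i ∈ s, q i z ≤ ε) :
    ev ((1 / 2 : ℝ) • ∑ p ∈ P, f p) (fun i => q i z) ≤
      1 / 2 + ε + 1 / 2 * hitMass P (Finsupp.single (a, b) 1) := by
  have hε : 0 ≤ ε := by simpa using hsmall ∅ (by simp)
  rw [hitMass, Finsupp.linearCombination_single, one_smul]
  simp only
  split_ifs with hP
  · refine (ev_le_norm h.node z).trans (hz.trans ?_)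
    linarith
  rw [Finset.not_nonempty_iff_eq_empty] at hP
  have hPab : ∀ p ∈ P, p ∉ Finset.Ioc a b := fun p hp hp' => by
    have := Finset.mem_inter.2 ⟨hp, hp'⟩
    rw [hP] at this
    simp at this
  set x : ℕ → ℝ := fun i => if i ∈ Finset.Ioc a b then q i z else 0 with hx
  set y : ℕ → ℝ := fun i => if i ∈ Finset.Ioc a b then 0 else q i z with hy
  have hxy : (fun i => q i z) = fun i => x i + y i := by
    ext i
    simp only [hx, hy]
    split_ifs <;> simp
  have h1 : ev ((1 / 2 : ℝ) • ∑ p ∈ P, f p) y ≤ ε := by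
    set g := (1 / 2 : ℝ) • ∑ p ∈ P, f p
    calc ev g y ≤ ∑ i ∈ g.support, y i :=
          Finset.sum_le_sum fun i _ => mul_le_of_le_one_left
            (by simp only [hy]; split_ifs; exacts [le_rfl, q_nonneg i z]) (h.node.bounds i).2
      _ = ∑ i ∈ g.support with i ∉ Finset.Ioc a b, q i z := by
          rw [Finset.sum_filter]
          exact Finset.sum_congr rfl fun i _ => by simp only [hy]; split_ifs <;> simp_all
      _ ≤ ε := hsmall _ fun i hi => (Finset.mem_filter.1 hi).2
  have hne : ∀ p ∈ P, ev (f p) x ≠ 0 → ∃ i ∈ Finset.Ioc a b, f p i ≠ 0 := by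
    intro p _ hpx
    obtain ⟨i, -, hi⟩ := Finset.exists_ne_zero_of_sum_ne_zero hpx
    refine ⟨i, ?_, left_ne_zero_of_mul hi⟩
    by_contra hno
    exact hi (by simp only [hx, if_neg hno, mul_zero])
  have hle : ∀ p ∈ P, ev (f p) x ≠ 0 → p ≤ a := by
    intro p hp hpx
    obtain ⟨i, hi, hpi⟩ := hne p hp hpx
    have := h.low p hp i hpi
    by_contra hlt
    exact hPab p hp (Finset.mem_Ioc.2 ⟨not_le.1 hlt, this.trans (Finset.mem_Ioc.1 hi).2⟩)
  have hlt : ∀ p ∈ P, ∀ p' ∈ P, ev (f p) x ≠ 0 → ev (f p') x ≠ 0 → ¬ p < p' := by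
    intro p hp p' hp' hpx hpx' hpp'
    obtain ⟨i, hi, hpi⟩ := hne p hp hpx
    have h2 := h.up p hp p' hp' hpp' i hpi
    have h3 := hle p' hp' hpx'
    have h4 := (Finset.mem_Ioc.1 hi).1
    omega
  have h5 : ∑ p ∈ P, ev (f p) x ≤ 1 := by
    by_cases hex : ∃ p ∈ P, ev (f p) x ≠ 0
    · obtain ⟨p, hp, hpx⟩ := hex
      rw [Finset.sum_eq_single_of_mem p hp]
      · refine (ev_mono (h.functional p hp) (b := fun i => q i z) fun i _ => ?_).trans
          ((ev_le_norm (h.functional p hp) z).trans hz)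
        simp only [hx]
        split_ifs
        exacts [le_rfl, q_nonneg i z]
      · intro p' hp' hpp'
        by_contra hpx'
        rcases lt_or_gt_of_ne hpp' with h6 | h6
        · exact hlt p' hp' p hp hpx' hpx h6
        · exact hlt p hp p' hp' hpx hpx' h6
    · push Not at hex
      rw [Finset.sum_eq_zero hex]
      exact zero_le_one
  rw [hxy, ev_add, ev_node P f x]
  linarith

/-- The vectors of the unit ball, together with probability measures on intervals which control the
values of admissible sums as in `ev_node_le`. -/
def controlled (d : TsData I) (n : ℕ) (ε : ℝ) : Set (C00 d × (ℕ × ℕ →₀ ℝ)) :=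
  {w | ‖w.1‖ ≤ 1 ∧ (∀ ξ, 0 ≤ w.2 ξ) ∧ (∀ t : Finset (ℕ × ℕ), ∑ ξ ∈ t, w.2 ξ ≤ 1) ∧
    (∀ i ≤ n, q i w.1 ≤ ε) ∧ ∀ P f, IsAdmissible d.adm P f →
      ev ((1 / 2 : ℝ) • ∑ p ∈ P, f p) (fun i => q i w.1) ≤ 1 / 2 + ε + 1 / 2 * hitMass P w.2}

theorem convex_controlled (d : TsData I) (n : ℕ) (ε : ℝ) : Convex ℝ (controlled d n ε) := by
  rintro ⟨z, v⟩ ⟨h1, h2, h3, h4, h5⟩ ⟨z', v'⟩ ⟨h1', h2', h3', h4', h5'⟩ a b ha hb hab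
  have hcomb : ∀ s t r : ℝ, s ≤ r → t ≤ r → a * s + b * t ≤ r := fun s t r hs ht => by
    have e1 := mul_le_mul_of_nonneg_left hs ha
    have e2 := mul_le_mul_of_nonneg_left ht hb
    have e3 : a * r + b * r = r := by rw [← add_mul, hab, one_mul]
    linarith
  refine ⟨?_, fun ξ => ?_, fun t => ?_, fun i hi => ?_, fun P f hf => ?_⟩
  · refine (norm_add_le _ _).trans ?_
    simp only [Prod.smul_fst]
    rw [norm_smul, norm_smul, Real.norm_of_nonneg ha, Real.norm_of_nonneg hb]
    exact hcomb _ _ _ h1 h1'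
  · exact add_nonneg (mul_nonneg ha (h2 ξ)) (mul_nonneg hb (h2' ξ))
  · have := hcomb _ _ _ (h3 t) (h3' t)
    rwa [Finset.mul_sum, Finset.mul_sum, ← Finset.sum_add_distrib] at this
  · have := q_add_le i (a • z) (b • z')
    rw [q_smul, q_smul, abs_of_nonneg ha, abs_of_nonneg hb] at this
    exact this.trans (hcomb _ _ _ (h4 i hi) (h4' i hi))
  · have e1 := ev_add_le hf.node (a • z) (b • z')
    have e2 := ev_smul_le hf.node a z
    have e3 := ev_smul_le hf.node b z'
    rw [abs_of_nonneg ha] at e2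
    rw [abs_of_nonneg hb] at e3
    have e4 := hcomb (ev ((1 / 2 : ℝ) • ∑ p ∈ P, f p) (fun i => q i z) - 1 / 2 * hitMass P v)
      (ev ((1 / 2 : ℝ) • ∑ p ∈ P, f p) (fun i => q i z') - 1 / 2 * hitMass P v') (1 / 2 + ε)
      (by have := h5 P f hf; simp only at this; linarith)
      (by have := h5' P f hf; simp only at this; linarith)
    simp only [Prod.fst_add, Prod.smul_fst, Prod.snd_add, Prod.smul_snd, map_add, map_smul,
      smul_eq_mul] at *
    linarith

/-- Blocks chosen along a tree on which the first families are small, with the intervals of the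
families that are not small on them. -/
theorem isVectorTree_thinSets (d : TsData I) (c : ℝ) (n : ℕ) {ε : ℝ} (hε : 0 < ε) (y : C00 d) :
    IsVectorTree (LinearMap.snd ℝ (C00 d) (ℕ × ℕ →₀ ℝ)) (comap Prod.fst atTop)
      (controlled d n ε)
      (fun (ρ : Ordinal.{0}) L => BlockTree (thinSets d) c ρ (insert y (Prod.fst '' L))) where
  mono ρ ρ' L L' h hρ hL := by
    refine h.mono le_rfl hρ (insert_subset (subset_convexHull ℝ _ (mem_insert _ _)) ?_)
    refine (image_mono hL).trans ?_
    have := (LinearMap.fst ℝ (C00 d) (ℕ × ℕ →₀ ℝ)).image_convexHull L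
    rw [LinearMap.coe_fst] at this
    rw [this]
    exact convexHull_mono (subset_insert _ _)
  extend ρ ρ' L h hρ U hU := by
    obtain ⟨V, hV, hVU⟩ := hU
    obtain ⟨N, hN⟩ := mem_atTop_sets.1 hV
    set a := max N n
    obtain ⟨z, hz, hz1, hzB⟩ := (blockTree_iff.1 h).2 ρ' hρ _ ⟨a, ε / (2 * (a + 1)), by positivity, rfl⟩
    obtain ⟨b, hb⟩ := exists_sum_q_le z (half_pos hε)
    have hsum : ∑ i ∈ Finset.range (a + 1), q i z ≤ ε / 2 := by
      refine (Finset.sum_le_card_nsmul _ _ _ fun i hi =>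
        hz i (Nat.lt_succ_iff.1 (Finset.mem_range.1 hi))).trans (le_of_eq ?_)
      rw [Finset.card_range, nsmul_eq_mul]
      push_cast
      field_simp
    have hsmall : ∀ s : Finset ℕ, (∀ i ∈ s, i ∉ Finset.Ioc a b) → ∑ i ∈ s, q i z ≤ ε := by
      intro s hs
      rw [← Finset.sum_filter_add_sum_filter_not s (b < ·), ← add_halves ε]
      refine add_le_add (hb _ fun i hi => (Finset.mem_filter.1 hi).2) (le_trans ?_ hsum)
      refine Finset.sum_le_sum_of_subset_of_nonneg (fun i hi => ?_) fun i _ _ => q_nonneg i z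
      have h1 := Finset.mem_filter.1 hi
      have h2 := hs i h1.1
      rw [Finset.mem_Ioc] at h2
      rw [Finset.mem_range]
      omega
    refine ⟨(z, Finsupp.single (a, b) 1), ⟨hz1, fun ξ => ?_, fun t => ?_, fun i hi => ?_,
      fun P f hf => ev_node_le hf hz1 hsmall⟩, fun ξ hξ => ?_, ?_⟩
    · simp only [Finsupp.single_apply]
      split_ifs <;> norm_num
    · classical
      simp only [Finsupp.single_apply, Finset.sum_ite_eq]
      split_ifs <;> norm_num
    · refine (hz i (hi.trans (le_max_right _ _))).trans (div_le_self hε.le ?_)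
      have : (0 : ℝ) ≤ a := Nat.cast_nonneg a
      linarith
    · have : ξ = (a, b) := by
        by_contra hne
        exact hξ (Finsupp.single_eq_of_ne hne)
      rw [this]
      exact hVU (hN a (le_max_left _ _))
    · rw [image_insert_eq, insert_comm]
      exact hzB

/-- No tree of rank `ω ^ β + 1` of vectors on which the first few families are small has the
constant `9 / 10`, if `adm` has rank at most `ω ^ β`. Let `y` be the first vector of the tree and
`z` a suitable average of later ones. On `z`, an admissible sum that starts in the essential support
of `y` is not much larger than `1 / 2`; on `y`, a sum that starts later is nearly `0`. So
`‖y + z‖ < 9 / 5`. -/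
theorem not_blockTree_thinSets {β : Ordinal.{0}} (hH : SecRankLE (ω ^ β) d.adm) :
    ¬ BlockTree (thinSets d) (9 / 10) (ω ^ β + 1) ∅ := by
  classical
  intro h
  obtain ⟨y, -, hy1, hy⟩ := (blockTree_iff.1 h).2 (ω ^ β) (Order.lt_add_one_iff.2 le_rfl) _
    ⟨0, 1, one_pos, rfl⟩
  obtain ⟨n, hn⟩ := exists_sum_q_le y (show (0 : ℝ) < 1 / 10 by norm_num)
  have hpos : (0 : Ordinal.{0}) < ω ^ β := Ordinal.opow_pos _ Ordinal.omega0_pos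
  obtain ⟨ρ, hρ, hρU⟩ := SecRankLE.iUnion_lt hpos (fun m => section_ d.adm m) (n + 1)
    fun m _ => secRankLE_iff.1 hH m
  set G := ⋃ m < n + 1, section_ d.adm m with hG
  have hGher : IsHereditary G := IsHereditary.biUnion_lt (fun m => d.adm_hereditary.section_ m) _
  have hrank : RankLE (comap Prod.fst atTop) link ρ (hit G) :=
    rankLE_link_of_inter_subset_hit hGher hρU (isHereditary_hit G) (N := 0) fun t ht _ => ht
  obtain ⟨⟨z, v⟩, ⟨hz1, hv0, -, hzn, hzP⟩, hvU, hB, hmass⟩ :=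
    (isVectorTree_thinSets d (9 / 10) n (show (0 : ℝ) < 1 / 10 by norm_num) y).exists_average
    (convex_controlled d n (1 / 10)) (isHereditary_hit G) zero_le_one
    (fun w hw t _ => by
      refine le_trans (le_of_eq ?_) (hw.2.2.1 t)
      exact Finset.sum_congr rfl fun ξ _ => abs_of_nonneg (hw.2.1 ξ))
    hrank hρ (τ := 0) (L := ∅) (by simpa using hy)
    (U := {ξ | n ≤ ξ.1}) (preimage_mem_comap (mem_atTop n)) (show (0 : ℝ) < 1 / 10 by norm_num)
  simp only at hz1 hv0 hzn hzP
  have hnorm : ‖y + z‖ ≤ 17 / 10 + 1 / 20 := by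
    refine norm_le (by norm_num) fun f hf => ?_
    cases hf with
    | unit i =>
      rw [ev_unit]
      have h1 := q_add_le i y z
      rcases le_or_gt i n with hi | hi
      · have := hzn i hi
        have := (q_le_norm i y).trans hy1
        linarith
      · have h2 := hn {i} (by simpa using hi)
        rw [Finset.sum_singleton] at h2
        have := (q_le_norm i z).trans hz1
        linarith
    | node P hP f hf hlow hup =>
      have hadm : IsAdmissible d.adm P f := ⟨hP, hf, hlow, hup⟩
      have h1 := ev_add_le hadm.node y z
      have hz' := (ev_le_norm hadm.node z).trans hz1
      have hy' := (ev_le_norm hadm.node y).trans hy1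
      by_cases hPn : ∃ m ∈ P, m ≤ n
      · -- The minimum of `P` is at most `n`, so that the rest of `P` belongs to `G`.
        obtain ⟨m, hm, hmn⟩ := hPn
        have hne : P.Nonempty := ⟨m, hm⟩
        have hmin : P.min' hne ≤ n := (P.min'_le m hm).trans hmn
        have h2 := hzP P f hadm
        have h3 : hitMass P v ≤ 1 / 10 := by
          rw [hitMass_eq_sum]
          have ht : (v.support.filter fun ξ => (P ∩ Finset.Ioc ξ.1 ξ.2).Nonempty) ∈ hit G := by
            refine ⟨P.erase (P.min' hne), ?_, fun ξ hξ => ?_⟩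
            · rw [hG]
              simp only [mem_iUnion]
              refine ⟨P.min' hne, Nat.lt_succ_of_le hmin, fun k hk =>
                Finset.min'_lt_of_mem_erase_min' P hne hk, ?_⟩
              rwa [Finset.insert_erase (P.min'_mem hne)]
            · rw [Finset.mem_filter, Finsupp.mem_support_iff] at hξ
              obtain ⟨p, hp⟩ := hξ.2
              rw [Finset.mem_inter, Finset.mem_Ioc] at hp
              have hξn : n ≤ ξ.1 := hvU ξ hξ.1
              refine ⟨p, Finset.mem_inter.2 ⟨Finset.mem_erase.2 ⟨?_, hp.1⟩, Finset.mem_Ioc.2 hp.2⟩⟩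
              omega
          refine le_trans (le_of_eq ?_) (hmass _ ht)
          exact Finset.sum_congr rfl fun ξ _ => (abs_of_nonneg (hv0 ξ)).symm
        linarith
      · push Not at hPn
        have h2 : ev ((1 / 2 : ℝ) • ∑ p ∈ P, f p) (fun i => q i y) ≤ 1 / 10 := by
          refine (ev_le_sum _ hadm.node y).trans (hn _ fun i hi => ?_)
          rw [Finsupp.mem_support_iff, Finsupp.smul_apply, Finsupp.finsetSum_apply] at hi
          obtain ⟨p, hp, hpi⟩ := Finset.exists_ne_zero_of_sum_ne_zero (right_ne_zero_of_mul hi)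
          exact (hPn p hp).trans_le (hlow p hp i hpi)
        linarith
  have hlow : 9 / 10 ≤ ‖(1 / 2 : ℝ) • (y + z)‖ := by
    refine (blockTree_iff.1 hB).1 _ ?_
    rw [smul_add]
    refine convex_convexHull ℝ _ (subset_convexHull ℝ _ (mem_insert _ _))
      (subset_convexHull ℝ _ (mem_insert_of_mem _ (mem_image_of_mem Prod.fst (mem_insert (z, v) ∅))))
      (by norm_num) (by norm_num) (by norm_num)
  rw [norm_smul, Real.norm_of_nonneg (by norm_num)] at hlow
  linarith

end C00

theorem exists_pow_two_pow_le {c : ℝ} (hc : 0 < c) : ∃ j : ℕ, (9 / 10 : ℝ) ^ 2 ^ j ≤ c := by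
  obtain ⟨n, hn⟩ := exists_pow_lt_of_lt_one hc (show (9 / 10 : ℝ) < 1 by norm_num)
  refine ⟨n, le_trans ?_ hn.le⟩
  exact pow_le_pow_of_le_one (by norm_num) (by norm_num) Nat.lt_two_pow_self.le

open scoped Classical in
/-- No bounded sequence of finitely supported vectors has a lower `ℓ₁`-estimate on a family of rank
`l * ω ^ (α * ω)`, where `l` is an exponentially indecomposable ordinal above the ranks of the
families and the family of admissible sets has rank at most `ω ^ α`. -/
theorem C00.not_lowerEstimate {I : Type u} {d : TsData I} {l α : Ordinal.{0}}
    (hl : IsExpIndecomposable l) (hω : ω < l) (hα : 1 ≤ α)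
    (hfam : ∀ n, ∃ ρ < l, RankLE cofinite link ρ (d.fam n))
    (hadm : SecRankLE (ω ^ α) d.adm) {F : Set (Finset ℕ)}
    (hF : SecRankGE (l * ω ^ (α * ω)) F) {y : ℕ → C00 d} {K c : ℝ} (hy : ∀ k, ‖y k‖ ≤ K)
    (hc : 0 < c) : ¬ LowerEstimate F c y := by
  intro hest
  obtain ⟨c', hc', h1⟩ := exists_blockTree_farSets (ρ := l * ω ^ (α * ω)) hc hy hest (by
    rwa [← mul_assoc, hl.two_mul])
  have h2 := blockTree_thinSets hl hω hfam h1
  obtain ⟨j, hj⟩ := exists_pow_two_pow_le hc'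
  have hpow : (ω ^ (α * 2)) ^ ((2 ^ j : ℕ) : Ordinal.{0}) ≤ ω ^ (α * ω) := by
    rw [← Ordinal.opow_mul, mul_assoc]
    refine Ordinal.opow_le_opow_right Ordinal.omega0_pos (mul_le_mul_right ?_ _)
    exact_mod_cast (Ordinal.natCast_lt_omega0 (2 * 2 ^ j)).le
  have h3 : BlockTree (thinSets d) (9 / 10) (ω ^ (α * 2)) ∅ :=
    BlockTree.improve (fun V => convex_of_mem_thinSets)
      (fun V hV V' hV' => exists_subset_inter_of_mem_thinSets hV hV')
      (fun V hV a ha => exists_smul_mem_of_mem_thinSets hV ha) j (by norm_num)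
      (h2.mono hj hpow (empty_subset _))
  refine not_blockTree_thinSets hadm (h3.mono le_rfl (Order.add_one_le_of_lt ?_) (empty_subset _))
  refine (Ordinal.opow_lt_opow_iff_right Ordinal.one_lt_omega0).2 ?_
  rw [← one_add_one_eq_two, mul_add, mul_one]
  exact lt_add_of_pos_right α (zero_lt_one.trans_le hα)

/-! ### The completed space and its unconditional basis -/

/-- The Banach space of the data `d`. -/
abbrev Space {I : Type u} (d : TsData I) : Type u := UniformSpace.Completion (C00 d)

namespace Space

open C00

variable {I : Type u} {d : TsData I}

/-- The embedding of the finitely supported vectors. -/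
noncomputable def emb : C00 d →ₗᵢ[ℝ] Space d := UniformSpace.Completion.toComplₗᵢ

theorem denseRange_emb : DenseRange (emb (d := d)) := UniformSpace.Completion.denseRange_coe

theorem exists_norm_sub_emb_lt (x : Space d) {ε : ℝ} (hε : 0 < ε) :
    ∃ y, ‖x - emb y‖ < ε := by
  obtain ⟨y, hy⟩ := denseRange_emb.exists_dist_lt x hε
  exact ⟨y, by rwa [← dist_eq_norm]⟩

/-- The coordinate functionals on the finitely supported vectors. -/
noncomputable def evalCLM (d : TsData I) (ξ : I) : C00 d →L[ℝ] ℝ :=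
  LinearMap.mkContinuous
    { toFun := fun x : C00 d => x ξ
      map_add' := fun _ _ => rfl
      map_smul' := fun _ _ => rfl } 1 fun x => by
    rw [one_mul]
    exact abs_apply_le_norm x ξ

/-- The coordinate functionals. -/
noncomputable def coord (d : TsData I) (ξ : I) : StrongDual ℝ (Space d) :=
  (evalCLM d ξ).extend emb.toContinuousLinearMap

theorem coord_emb (ξ : I) (x : C00 d) : coord d ξ (emb x) = x ξ :=
  ContinuousLinearMap.extend_eq (evalCLM d ξ) (e := emb.toContinuousLinearMap) denseRange_emb
    emb.isometry.isUniformInducing x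

/-- The projections on finite sets of coordinates. -/
noncomputable def sumProj (A : Finset I) : Space d →L[ℝ] Space d :=
  ∑ ξ ∈ A, (coord d ξ).smulRight (emb (unitVec ξ))

theorem sumProj_apply (A : Finset I) (x : Space d) :
    sumProj A x = ∑ ξ ∈ A, coord d ξ x • emb (unitVec ξ) := by
  simp [sumProj, _root_.sum_apply, ContinuousLinearMap.smulRight_apply]

theorem sumProj_emb (A : Finset I) (x : C00 d) : sumProj A (emb x) = emb (proj (A : Set I) x) := by
  rw [sumProj_apply, proj_eq_cut, cut, map_sum]
  exact Finset.sum_congr rfl fun ξ _ => by rw [coord_emb, map_smul]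

theorem norm_sumProj_le (A : Finset I) (x : Space d) : ‖sumProj A x‖ ≤ ‖x‖ := by
  refine denseRange_emb.induction_on (p := fun x => ‖sumProj A x‖ ≤ ‖x‖) x
    (isClosed_le (sumProj A).continuous.norm continuous_norm) fun y => ?_
  rw [sumProj_emb, emb.norm_map, emb.norm_map]
  exact norm_proj_le _ y

theorem sumProj_emb_of_supp_subset {A : Finset I} {x : C00 d} (h : supp x ⊆ A) :
    sumProj A (emb x) = emb x := by
  rw [sumProj_emb]
  congr 1
  ext ξ
  by_cases hξ : ξ ∈ A
  · rw [proj_apply_of_mem hξ]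
  · rw [proj_apply_of_notMem hξ, eq_comm]
    by_contra hne
    exact hξ (h (mem_supp.2 hne))

theorem tendsto_sumProj (x : Space d) : Tendsto (fun A => sumProj A x) atTop (𝓝 x) := by
  classical
  rw [Metric.tendsto_atTop]
  intro ε hε
  obtain ⟨y, hy⟩ := exists_norm_sub_emb_lt x (half_pos hε)
  refine ⟨supp y, fun A hA => ?_⟩
  have h1 : sumProj A x - x = sumProj A (x - emb y) - (x - emb y) := by
    rw [map_sub, sumProj_emb_of_supp_subset hA]
    abel
  rw [dist_eq_norm, h1]
  have h2 := norm_sumProj_le A (x - emb y)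
  have h3 := norm_sub_le (sumProj A (x - emb y)) (x - emb y)
  linarith

/-- The unit vectors form an unconditional basis. -/
noncomputable def schauderBasis (d : TsData I) : UnconditionalSchauderBasis I ℝ (Space d) where
  basis ξ := emb (unitVec ξ)
  coord ξ := coord d ξ
  ortho i j := by
    classical
    rw [coord_emb, unitVec_apply, Pi.single_apply]
    simp only [eq_comm]
  expansion x := by
    refine (tendsto_sumProj x).congr fun A => ?_
    rw [sumProj_apply]

theorem one_le_norm_unitVec_sub {ξ η : I} (h : ξ ≠ η) :
    1 ≤ ‖(unitVec ξ : C00 d) - unitVec η‖ := by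
  refine le_trans (le_of_eq ?_) (abs_apply_le_norm _ ξ)
  rw [sub_apply, unitVec_apply, unitVec_apply, if_pos rfl, if_neg h.symm, sub_zero, abs_one]

/-- Combinations of unit vectors with rational coefficients. -/
noncomputable def ratVec (d : TsData I) (v : I →₀ ℚ) : C00 d :=
  toFinsupp.symm (v.mapRange (fun r : ℚ => (r : ℝ)) Rat.cast_zero)

theorem ratVec_apply (v : I →₀ ℚ) (ξ : I) : ratVec d v ξ = v ξ :=
  Finsupp.mapRange_apply (hf := Rat.cast_zero)

theorem oneNorm_bound (x : C00 d) {A : Finset I} (hA : supp x ⊆ A) {M : ℝ}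
    (hM : ∀ ξ ∈ A, ‖(unitVec ξ : C00 d)‖ ≤ M) : ‖x‖ ≤ M * ∑ ξ ∈ A, |x ξ| := by
  have h1 : x = cut x A := by
    ext ξ
    rw [cut_apply]
    split_ifs with h
    · rfl
    · by_contra hne
      exact h (hA (mem_supp.2 hne))
  nth_rewrite 1 [h1]
  rw [cut, Finset.mul_sum]
  refine norm_sum_le_of_le _ fun ξ hξ => ?_
  rw [norm_smul, Real.norm_eq_abs, mul_comm]
  exact mul_le_mul_of_nonneg_right (hM ξ hξ) (abs_nonneg _)

theorem exists_norm_sub_ratVec_lt (x : C00 d) {ε : ℝ} (hε : 0 < ε) :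
    ∃ v, ‖x - ratVec d v‖ < ε := by
  classical
  set M := ∑ ξ ∈ supp x, ‖(unitVec ξ : C00 d)‖ with hM
  have hM0 : 0 ≤ M := Finset.sum_nonneg fun _ _ => norm_nonneg _
  set δ := ε / ((M + 1) * ((supp x).card + 1)) with hδ
  have hδ0 : 0 < δ := by positivity
  have hr : ∀ ξ, ∃ r : ℚ, |x ξ - r| < δ := fun ξ => by
    obtain ⟨r, hr⟩ := exists_rat_btwn (show x ξ - δ < x ξ + δ by linarith)
    exact ⟨r, abs_lt.2 ⟨by linarith, by linarith⟩⟩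
  choose r hr using hr
  refine ⟨Finsupp.onFinset (supp x) (fun ξ => if ξ ∈ supp x then r ξ else 0) fun ξ h => by
    by_contra hno
    exact h (if_neg hno), ?_⟩
  set y := ratVec d (Finsupp.onFinset (supp x) (fun ξ => if ξ ∈ supp x then r ξ else 0) fun ξ h => by
    by_contra hno
    exact h (if_neg hno)) with hy
  have hyξ : ∀ ξ, y ξ = if ξ ∈ supp x then (r ξ : ℝ) else 0 := fun ξ => by
    rw [hy, ratVec_apply, Finsupp.onFinset_apply]
    split_ifs <;> simp
  have hsub : supp (x - y) ⊆ supp x := fun ξ hξ => by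
    by_contra hno
    refine mem_supp.1 hξ ?_
    rw [sub_apply, hyξ, if_neg hno, sub_zero]
    by_contra hne
    exact hno (mem_supp.2 hne)
  have h1 := oneNorm_bound (x - y) hsub (M := M) fun ξ hξ =>
    Finset.single_le_sum (f := fun ξ => ‖(unitVec ξ : C00 d)‖) (fun _ _ => norm_nonneg _) hξ
  have h2 : ∑ ξ ∈ supp x, |(x - y) ξ| ≤ (supp x).card * δ := by
    rw [← nsmul_eq_mul]
    refine Finset.sum_le_card_nsmul _ _ _ fun ξ hξ => ?_
    rw [sub_apply, hyξ, if_pos hξ]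
    exact (hr ξ).le
  have h3 : M * ((supp x).card * δ) < ε := by
    have h4 : (M + 1) * ((supp x).card + 1) * δ = ε := by
      rw [hδ]
      field_simp
    have h5 : (0 : ℝ) ≤ (supp x).card := Nat.cast_nonneg _
    nlinarith [mul_pos (show (0 : ℝ) < M + 1 by linarith) hδ0, mul_nonneg h5 hδ0.le]
  exact (h1.trans (mul_le_mul_of_nonneg_left h2 hM0)).trans_lt h3

/-- The density character is the number of unit vectors. -/
theorem densityCharacter_eq [Infinite I] (d : TsData I) : densityCharacter (Space d) = #I := by
  apply le_antisymm
  · have hD : Dense (range fun v => emb (ratVec d v)) := by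
      intro x
      rw [Metric.mem_closure_iff]
      intro ε hε
      obtain ⟨y, hy⟩ := exists_norm_sub_emb_lt x (half_pos hε)
      obtain ⟨v, hv⟩ := exists_norm_sub_ratVec_lt y (half_pos hε)
      refine ⟨_, ⟨v, rfl⟩, ?_⟩
      have h1 : x - emb (ratVec d v) = (x - emb y) + emb (y - ratVec d v) := by
        rw [map_sub]
        abel
      rw [dist_eq_norm, h1]
      refine (norm_add_le _ _).trans_lt ?_
      rw [emb.norm_map]
      linarith
    refine (csInf_le' (s := {c | ∃ D : Set (Space d), Dense D ∧ #D = c})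
      ⟨_, hD, rfl⟩).trans (Cardinal.mk_range_le.trans (le_of_eq ?_))
    rw [Cardinal.mk_finsupp_lift_of_infinite]
    simp
  · refine le_csInf ⟨_, univ, dense_univ, rfl⟩ ?_
    rintro _ ⟨D, hD, rfl⟩
    have hx : ∀ ξ : I, ∃ x : D, ‖emb (unitVec ξ) - (x : Space d)‖ < 1 / 2 := fun ξ => by
      obtain ⟨x, hx, hlt⟩ := hD.exists_dist_lt (emb (unitVec ξ)) (show (0 : ℝ) < 1 / 2 by norm_num)
      exact ⟨⟨x, hx⟩, by rwa [← dist_eq_norm]⟩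
    choose x hx using hx
    refine Cardinal.mk_le_of_injective (f := x) fun ξ η h => ?_
    by_contra hne
    have h1 := one_le_norm_unitVec_sub (d := d) hne
    rw [← emb.norm_map, map_sub] at h1
    have h2 : emb (unitVec ξ) - emb (unitVec η) =
        (emb (unitVec ξ) - (x ξ : Space d)) - (emb (unitVec η) - (x η : Space d)) := by
      rw [h]
      abel
    rw [h2] at h1
    have h3 := norm_sub_le (emb (unitVec ξ) - (x ξ : Space d)) (emb (unitVec η) - (x η : Space d))
    have := hx ξ
    have := hx η
    linarith

/-! ### Reflexivity -/

/-- The unit vectors are shrinking if no bounded sequence is equivalent to the unit vectors of `ℓ₁`: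
normalized disjoint blocks on which a functional is bounded below are equivalent to the unit vectors
of `ℓ₁` by unconditionality. -/
theorem exists_forall_abs_le (hno : ∀ (y : ℕ → C00 d) (K c : ℝ), (∀ k, ‖y k‖ ≤ K) → 0 < c →
    ¬ LowerEstimate univ c y) (f : StrongDual ℝ (Space d)) {ε : ℝ} (hε : 0 < ε) :
    ∃ A : Finset I, ∀ y : C00 d, Disjoint A (supp y) → |f (emb y)| ≤ ε * ‖y‖ := by
  by_contra hcon
  push Not at hcon
  have hstep : ∀ A : Finset I, ∃ B, Disjoint A B ∧ ∃ y : C00 d, supp y = B ∧ ‖y‖ ≤ 1 ∧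
      ε ≤ f (emb y) := by
    intro A
    obtain ⟨y, hy, hlt⟩ := hcon A
    have hne : y ≠ 0 := by
      rintro rfl
      simp at hlt
    have hpos : 0 < ‖y‖ := norm_pos_iff.2 hne
    -- the sign of the multiple is that of `f (emb y)`
    obtain ⟨a, ha, hfa⟩ : ∃ a : ℝ, |a| = ‖y‖⁻¹ ∧ a * f (emb y) = ‖y‖⁻¹ * |f (emb y)| := by
      rcases le_total 0 (f (emb y)) with h | h
      · exact ⟨‖y‖⁻¹, abs_of_pos (inv_pos.2 hpos), by rw [abs_of_nonneg h]⟩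
      · exact ⟨-‖y‖⁻¹, by rw [abs_neg, abs_of_pos (inv_pos.2 hpos)], by
          rw [abs_of_nonpos h]; ring⟩
    have hane : a ≠ 0 := by
      rw [← abs_pos, ha]
      exact inv_pos.2 hpos
    refine ⟨supp (a • y), ?_, a • y, rfl, ?_, ?_⟩
    · have : supp (a • y) = supp y := by
        ext ξ
        rw [mem_supp, mem_supp, smul_apply]
        simp [hane]
      rwa [this]
    · rw [norm_smul, Real.norm_eq_abs, ha, inv_mul_cancel₀ hpos.ne']
    · rw [map_smul, map_smul, smul_eq_mul, hfa, le_inv_mul_iff₀ hpos, mul_comm]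
      exact hlt.le
  obtain ⟨B, hB, hy⟩ := exists_disjoint_seq hstep
  choose y hyB hy1 hyf using hy
  have hdis : Pairwise (Function.onFun Disjoint fun k => supp (y k)) := fun i j hij => by
    have := hB hij
    simp only [Function.onFun, hyB] at this ⊢
    exact this
  have hfpos : 0 < ‖f‖ + 1 := by positivity
  refine hno y 1 (ε / (‖f‖ + 1)) hy1 (by positivity) fun s _ a => ?_
  have h1 : ‖∑ k ∈ s, a k • y k‖ = ‖∑ k ∈ s, |a k| • y k‖ := by
    refine norm_congr_abs fun ξ => ?_
    by_cases h : ∃ k ∈ s, ξ ∈ supp (y k)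
    · obtain ⟨k, hk, hξ⟩ := h
      rw [sum_smul_apply_of_disjoint hdis a hk hξ,
        sum_smul_apply_of_disjoint hdis (fun k => |a k|) hk hξ, abs_mul, abs_mul, abs_abs]
    · push Not at h
      have h0 : ∀ b : ℕ → ℝ, (∑ k ∈ s, b k • y k) ξ = 0 := fun b => by
        rw [sum_apply]
        refine Finset.sum_eq_zero fun k hk => ?_
        rw [smul_apply]
        have := h k hk
        rw [mem_supp, not_not] at this
        rw [this, mul_zero]
      rw [h0, h0]
  have h2 : ε * ∑ k ∈ s, |a k| ≤ f (emb (∑ k ∈ s, |a k| • y k)) := by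
    rw [map_sum, map_sum, Finset.mul_sum]
    refine Finset.sum_le_sum fun k _ => ?_
    rw [map_smul, map_smul, smul_eq_mul, mul_comm]
    exact mul_le_mul_of_nonneg_left (hyf k) (abs_nonneg _)
  have h3 := f.le_opNorm (emb (∑ k ∈ s, |a k| • y k))
  rw [emb.norm_map, ← h1, Real.norm_eq_abs] at h3
  have h4 := le_abs_self (f (emb (∑ k ∈ s, |a k| • y k)))
  rw [div_mul_eq_mul_div, div_le_iff₀ hfpos]
  have h5 := norm_nonneg (∑ k ∈ s, a k • y k)
  nlinarith

/-- The unconditional basis is shrinking, as the space contains no `ℓ₁`-sequence of finitely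
supported vectors. -/
theorem tendsto_comp_sumProj (hno : ∀ (y : ℕ → C00 d) (K c : ℝ), (∀ k, ‖y k‖ ≤ K) → 0 < c →
    ¬ LowerEstimate univ c y) (f : StrongDual ℝ (Space d)) :
    Tendsto (fun A : Finset I => f.comp (sumProj A)) atTop (𝓝 f) := by
  classical
  rw [Metric.tendsto_atTop]
  intro ε hε
  obtain ⟨A₀, hA₀⟩ := exists_forall_abs_le hno f (half_pos hε)
  refine ⟨A₀, fun A hA => ?_⟩
  rw [dist_eq_norm]
  refine lt_of_le_of_lt (ContinuousLinearMap.opNorm_le_bound _ (half_pos hε).le fun x => ?_)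
    (half_lt_self hε)
  refine denseRange_emb.induction_on
    (p := fun x => ‖(f.comp (sumProj A) - f) x‖ ≤ ε / 2 * ‖x‖) x
    (isClosed_le (f.comp (sumProj A) - f).continuous.norm (continuous_norm.const_mul _)) fun y => ?_
  have h1 : (f.comp (sumProj A) - f) (emb y) = -f (emb (proj (A : Set I)ᶜ y)) := by
    rw [_root_.sub_apply, ContinuousLinearMap.comp_apply, sumProj_emb,
      ← map_sub, ← map_sub, ← map_neg, ← map_neg]
    congr 2
    have := proj_add_proj_compl (A : Set I) y
    nth_rewrite 2 [← this]
    abel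
  rw [h1, norm_neg, Real.norm_eq_abs, emb.norm_map]
  refine (hA₀ _ ?_).trans (mul_le_mul_of_nonneg_left (norm_proj_le _ y) (half_pos hε).le)
  refine Finset.disjoint_left.2 fun ξ hξ hξ' => mem_supp.1 hξ' ?_
  exact proj_apply_of_notMem (by simpa using hA hξ) y

/-- Reflexivity follows since the basis is shrinking and boundedly complete. -/
theorem isReflexiveSpace (hd : d.IsMultiplicative)
    (hno : ∀ (y : ℕ → C00 d) (K c : ℝ), (∀ k, ‖y k‖ ≤ K) → 0 < c → ¬ LowerEstimate univ c y) :
    IsReflexiveSpace (Space d) := by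
  classical
  intro Φ
  let g : I → ℝ := fun ξ => Φ (coord d ξ)
  have hcut : ∀ (f : StrongDual ℝ (Space d)) (A : Finset I),
      Φ (f.comp (sumProj A)) = f (emb (cut g A)) := by
    intro f A
    have h1 : f.comp (sumProj A) = ∑ ξ ∈ A, f (emb (unitVec ξ)) • coord d ξ := by
      ext x
      rw [ContinuousLinearMap.comp_apply, sumProj_apply, map_sum, _root_.sum_apply]
      exact Finset.sum_congr rfl fun ξ _ => by
        rw [map_smul, smul_eq_mul, mul_comm]
        rfl
    rw [h1, map_sum, cut, map_sum, map_sum]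
    exact Finset.sum_congr rfl fun ξ _ => by
      rw [map_smul, map_smul, map_smul, smul_eq_mul, smul_eq_mul, mul_comm]
  have hbound : ∀ A, ‖(cut g A : C00 d)‖ ≤ ‖Φ‖ := fun A => by
    rw [← emb.norm_map]
    refine NormedSpace.norm_le_dual_bound ℝ _ (norm_nonneg Φ) fun f => ?_
    rw [← hcut]
    refine (Φ.le_opNorm _).trans (mul_le_mul_of_nonneg_left ?_ (norm_nonneg Φ))
    refine ContinuousLinearMap.opNorm_le_bound _ (norm_nonneg f) fun x => ?_
    rw [ContinuousLinearMap.comp_apply]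
    exact (f.le_opNorm _).trans (mul_le_mul_of_nonneg_left (norm_sumProj_le A x) (norm_nonneg f))
  have hsum : Summable fun ξ => emb (g ξ • unitVec ξ : C00 d) := by
    rw [summable_iff_vanishing_norm]
    intro ε hε
    obtain ⟨A₀, hA₀⟩ := exists_forall_norm_cut_le hd hbound (half_pos hε)
    refine ⟨A₀, fun A hA => ?_⟩
    rw [← map_sum, emb.norm_map]
    exact (hA₀ A hA.symm).trans_lt (half_lt_self hε)
  refine ⟨∑' ξ, emb (g ξ • unitVec ξ : C00 d), ?_⟩
  ext f
  rw [NormedSpace.dual_def]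
  have h1 : Tendsto (fun A : Finset I => Φ (f.comp (sumProj A))) atTop (𝓝 (Φ f)) :=
    (Φ.continuous.tendsto f).comp (tendsto_comp_sumProj hno f)
  have h2 : Tendsto (fun A : Finset I => f (emb (cut g A))) atTop
      (𝓝 (f (∑' ξ, emb (g ξ • unitVec ξ : C00 d)))) := by
    have : Tendsto (fun A : Finset I => ∑ ξ ∈ A, emb (g ξ • unitVec ξ : C00 d)) atTop
      (𝓝 (∑' ξ, emb (g ξ • unitVec ξ : C00 d))) := hsum.hasSum
    refine ((f.continuous.tendsto _).comp this).congr fun A => ?_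
    rw [Function.comp_apply, ← map_sum]
    rfl
  exact tendsto_nhds_unique h2 (h1.congr fun A => hcut f A)

/-! ### Sequences in the completed space -/

/-- Every bounded sequence without convergent subsequences has a subsequence with a lower
`ℓ₁`-estimate on the admissible sets. -/
theorem exists_lowerEstimate (hd : d.IsMultiplicative) {x : ℕ → Space d} {K : ℝ}
    (hK : ∀ n, ‖x n‖ ≤ K) (hx : IsNontrivialSeq x) :
    ∃ φ : ℕ → ℕ, StrictMono φ ∧ ∃ c, 0 < c ∧ LowerEstimate d.adm c (x ∘ φ) := by
  choose y hy using fun n : ℕ => exists_norm_sub_emb_lt (x n)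
    (show (0 : ℝ) < 1 / ((n : ℝ) + 1) by positivity)
  have hle1 : ∀ n : ℕ, 1 / ((n : ℝ) + 1) ≤ 1 := fun n => by
    rw [div_le_one (by positivity)]
    have : (0 : ℝ) ≤ n := Nat.cast_nonneg n
    linarith
  have hyK : ∀ n, ‖y n‖ ≤ K + 1 := fun n => by
    rw [← emb.norm_map]
    have h1 := norm_sub_norm_le (emb (y n)) (x n)
    rw [norm_sub_rev] at h1
    linarith [hK n, hy n, hle1 n]
  have htend : Tendsto (fun n => x n - emb (y n)) atTop (𝓝 0) :=
    squeeze_zero_norm (fun n => (hy n).le) tendsto_one_div_add_atTop_nhds_zero_nat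
  have hyc : ∀ φ : ℕ → ℕ, StrictMono φ → ¬ CauchySeq (y ∘ φ) := by
    intro φ hφ hcau
    have hcau' : CauchySeq fun n => emb ((y ∘ φ) n) := hcau.map emb.isometry.uniformContinuous
    obtain ⟨z, hz⟩ := cauchySeq_tendsto_of_complete hcau'
    refine hx φ hφ ⟨0 + z, ((htend.comp hφ.tendsto_atTop).add hz).congr fun n => ?_⟩
    simp
  obtain ⟨φ, hφ, c, hc, hest⟩ := C00.exists_lowerEstimate hd hyK hyc
  have hest' : LowerEstimate d.adm c fun n => emb ((y ∘ φ) n) := fun s hs a => by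
    have := hest s hs a
    rwa [← emb.norm_map, map_sum, Finset.sum_congr rfl fun n _ => map_smul emb (a n) _] at this
  obtain ⟨N, hN⟩ := eventually_atTop.1
    (tendsto_one_div_add_atTop_nhds_zero_nat.eventually_le_const (half_pos hc))
  have hshift : StrictMono fun i : ℕ => i + N := fun i j h => Nat.add_lt_add_right h N
  refine ⟨fun i => φ (i + N), hφ.comp hshift, c / 2, half_pos hc, ?_⟩
  refine LowerEstimate.mono_const ((hest'.comp_strictMono hd.spreads hshift).of_norm_sub_le
    (e := c / 2) fun i => ?_) (by linarith)
  simp only [Function.comp_apply]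
  rw [norm_sub_rev]
  exact (hy _).le.trans (hN _ ((Nat.le_add_left N i).trans (hφ.id_le _)))

theorem not_lowerEstimate {F : Set (Finset ℕ)} (hno : ∀ (y : ℕ → C00 d) (K c : ℝ),
    (∀ k, ‖y k‖ ≤ K) → 0 < c → ¬ LowerEstimate F c y) {x : ℕ → Space d} {K c : ℝ}
    (hK : ∀ n, ‖x n‖ ≤ K) (hc : 0 < c) : ¬ LowerEstimate F c x := by
  intro hest
  choose y hy using fun n : ℕ => exists_norm_sub_emb_lt (x n) (half_pos hc)
  refine hno y (K + c / 2) (c / 2) (fun n => ?_) (half_pos hc) ?_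
  · rw [← emb.norm_map]
    have h1 := norm_sub_norm_le (emb (y n)) (x n)
    rw [norm_sub_rev] at h1
    linarith [hK n, hy n]
  · have h1 := hest.of_norm_sub_le fun n => (hy n).le
    intro s hs a
    have h2 := h1 s hs a
    rw [← Finset.sum_congr rfl fun n _ => map_smul emb (a n) (y n), ← map_sum, emb.norm_map] at h2
    linarith

theorem sum_eq_sum_orderEmbOfFin {M : Type*} [AddCommMonoid M] (s : Finset ℕ) {n : ℕ}
    (h : s.card = n) (g : ℕ → M) : ∑ k ∈ s, g k = ∑ i, g (s.orderEmbOfFin h i) := by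
  nth_rewrite 1 [← Finset.image_orderEmbOfFin_univ s h]
  exact Finset.sum_image (s.orderEmbOfFin h).injective.injOn

/-- In a subsymmetric sequence the estimates on the admissible sets, which have arbitrary sizes,
would hold on all finite sets. -/
theorem not_isSubsymmetric (hd : d.IsMultiplicative)
    (hno : ∀ (y : ℕ → C00 d) (K c : ℝ), (∀ k, ‖y k‖ ≤ K) → 0 < c → ¬ LowerEstimate univ c y)
    (x : ℕ → Space d) : ¬ IsSubsymmetric x := by
  rintro ⟨⟨i, j, hij⟩, C, hC, hsub⟩
  have hK : ∀ n, ‖x n‖ ≤ C * ‖x 0‖ := fun n => by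
    have := hsub 1 (fun _ => 1) (fun _ => n) (fun _ => 0) (Subsingleton.strictMono _)
      (Subsingleton.strictMono _)
    simpa using this
  have hpair : ∀ l₁ l₂ k₁ k₂, l₁ < l₂ → k₁ < k₂ →
      ‖x l₁ - x l₂‖ ≤ C * ‖x k₁ - x k₂‖ := by
    intro l₁ l₂ k₁ k₂ hl hk
    have hmono : ∀ a b : ℕ, a < b → StrictMono ![a, b] := fun a b hab p q hpq => by
      fin_cases p <;> fin_cases q <;> simp_all
    have := hsub 2 ![1, -1] ![l₁, l₂] ![k₁, k₂] (hmono _ _ hl) (hmono _ _ hk)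
    simpa [Fin.sum_univ_two, sub_eq_add_neg] using this
  have hnt : IsNontrivialSeq x := by
    rintro φ hφ ⟨z, hz⟩
    have hlim : Tendsto (fun n => C * ‖x (φ n) - x (φ (n + 1))‖) atTop (𝓝 (C * ‖z - z‖)) :=
      ((hz.sub (hz.comp (tendsto_add_atTop_nat 1))).norm.const_mul C)
    rw [sub_self, norm_zero, mul_zero] at hlim
    have hzero : ∀ l₁ l₂, l₁ < l₂ → x l₁ = x l₂ := fun l₁ l₂ hl => by
      rw [← sub_eq_zero, ← norm_le_zero_iff]
      exact ge_of_tendsto' hlim fun n => hpair _ _ _ _ hl (hφ (Nat.lt_succ_self n))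
    rcases lt_trichotomy i j with h | h | h
    · exact hij (hzero i j h)
    · exact hij (congrArg x h)
    · exact hij (hzero j i h).symm
  obtain ⟨φ, hφ, c, hc, hest⟩ := exists_lowerEstimate hd hK hnt
  have hC0 : 0 < C := one_pos.trans_le hC
  refine not_lowerEstimate hno hK (c := c / C) (by positivity) fun s _ a => ?_
  obtain ⟨t, ht, hts⟩ := hd.exists_card s.card
  have h1 := hest t ht (Function.extend (t.orderEmbOfFin hts) (a ∘ s.orderEmbOfFin rfl) 0)
  rw [sum_eq_sum_orderEmbOfFin t hts, sum_eq_sum_orderEmbOfFin t hts] at h1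
  simp only [(t.orderEmbOfFin hts).injective.extend_apply, Function.comp_apply] at h1
  have h2 := hsub s.card (fun i => a (s.orderEmbOfFin rfl i)) (fun i => φ (t.orderEmbOfFin hts i))
    (fun i => s.orderEmbOfFin rfl i) (hφ.comp (t.orderEmbOfFin hts).strictMono)
    (s.orderEmbOfFin rfl).strictMono
  rw [sum_eq_sum_orderEmbOfFin s rfl, sum_eq_sum_orderEmbOfFin s rfl, div_mul_eq_mul_div,
    div_le_iff₀ hC0, mul_comm ‖_‖]
  exact h1.trans h2

end Space

/-! ### The spaces of a basis of families -/

theorem IsHomogeneous.hereditary {P : Type u} [PartialOrder P] {F : Set (Finset P)}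
    (h : IsHomogeneous F) : IsHereditary F := by
  obtain ⟨α, -, h, -⟩ := h
  exact h

theorem IsHomogeneous.rk_lt {P : Type u} [PartialOrder P] {F : Set (Finset P)}
    (h : IsHomogeneous F) : rk F < iota (srk F) := by
  obtain ⟨α, -, -, -, -, h0, h1⟩ := h
  rcases eq_or_ne α 0 with rfl | hα
  · rw [h0 rfl]
    exact rk_singleton_empty.trans_lt ((zero_le (a := _)).trans_lt (iota_spec _).1)
  · obtain ⟨-, h2, -, h3⟩ := h1 (Order.one_le_iff_ne_zero.2 hα)
    rwa [h2]

theorem IsHomogeneous.singleton_mem {P : Type u} [LinearOrder P] [Infinite P] {F : Set (Finset P)}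
    (h : IsHomogeneous F) (hF : srk F = ω) (ξ : P) : {ξ} ∈ F := by
  obtain ⟨α, -, -, -, -, h0, h1⟩ := h
  rcases eq_or_ne α 0 with rfl | hα
  · have h2 : srk F ≤ 0 := (srk_le_rk F).trans (by rw [h0 rfl]; exact rk_singleton_empty)
    rw [hF] at h2
    exact absurd h2 Ordinal.omega0_pos.not_ge
  · exact (h1 (Order.one_le_iff_ne_zero.2 hα)).1 ⟨by simp, by simp⟩

open scoped Classical in
/-- The properties of the data that define the space with index `α`. -/
structure TsData.IsTsirelson {I : Type u} (d : TsData I) (S : Ordinal.{0} → Set (Finset ℕ))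
    (α : Ordinal.{0}) : Prop where
  multiplicative : d.IsMultiplicative
  secRankLE_adm : SecRankLE (ω ^ α) d.adm
  rankLE_fam : ∀ n, ∃ ρ < iota (ω ^ α), RankLE cofinite link ρ (d.fam n)
  exists_image_mem : ∃ φ : ℕ → ℕ, StrictMono φ ∧ ∀ s ∈ S α, s.image φ ∈ d.adm

theorem exists_opow_lt_omega_one {α : Ordinal.{0}} (hα : α < ω_ 1) :
    ω ^ α < ω_ 1 ∧ α * ω < ω_ 1 := by
  have hω : (ω : Ordinal.{0}) < ω_ 1 := Ordinal.omega0_lt_omega_one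
  have h1 := iota_lt_omega_one (max_lt hα hω)
  obtain ⟨h2, h3⟩ := iota_spec (max α ω)
  have hα' := (le_max_left α ω).trans_lt h2
  have hω' := (le_max_right α ω).trans_lt h2
  exact ⟨(h3.2 _ hω' _ hα').trans h1, (h3.mul_lt hα' hω').trans h1⟩

/-- The families are `fam 0` with `srk (fam 0) = ω` and its iterated multiplications `fam (n + 1)`
by a uniform family of rank `ω ^ α`. All their ranks stay below `ι(ω ^ α)`, since multiplication by a
family of rank `ω ^ α` does not lead beyond this exponentially indecomposable ordinal. -/
theorem exists_isTsirelson {κ : Cardinal.{u}} (hκ : HasBasisOfFamilies κ)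
    {S : Ordinal.{0} → Set (Finset ℕ)} (hS : IsSchreierSequence S) {α : Ordinal.{0}} (hα : 1 ≤ α)
    (hα1 : α < ω_ 1) : ∃ d : TsData κ.ord.ToType, d.IsTsirelson S α := by
  classical
  obtain ⟨⟨C, hC, -⟩, B, mul, hB⟩ := hκ
  have : Infinite κ.ord.ToType := infinite_univ_iff.1 (hC.mono (subset_univ C))
  obtain ⟨U, hU⟩ := exists_isGood_chain
  have hωα : ω ^ α < ω_ 1 := (exists_opow_lt_omega_one hα1).1
  have hgood := (hU _ hωα).1
  set H := U (ω ^ α) with hH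
  have hH𝔖 : H ∈ uniformFamilies := hgood.mem_uniformFamilies hωα
  have hHrank : SecRankLE (ω ^ α) H := hgood.uniform_univ.secRankLE
  obtain ⟨φ, hφ, hφS⟩ := exists_strictMono_image_mem hU hωα (hS.secRankLE hα1)
  have hω1 : (ω : Ordinal.{0}) ≤ ω ^ α := by
    nth_rewrite 1 [← Ordinal.opow_one ω]
    exact Ordinal.opow_le_opow_right Ordinal.omega0_pos hα
  obtain ⟨hι, hexp⟩ := iota_spec (ω ^ α)
  set l := iota (ω ^ α) with hl
  have hexp' : IsExpIndecomposable (Ordinal.lift.{u} l) := hexp.lift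
  obtain ⟨F₀, hF₀, hF₀srk⟩ := hB.exists_srk ω le_rfl Ordinal.omega0_lt_omega_one
  let fam : ℕ → Set (Finset κ.ord.ToType) := fun n => Nat.rec F₀ (fun _ F => mul F H) n
  have hsucc : ∀ n, fam (n + 1) = mul (fam n) H := fun _ => rfl
  have hfamB : ∀ n, fam n ∈ B := by
    intro n
    induction n with
    | zero => exact hF₀
    | succ n ih => exact hB.mul_mem _ ih _ hH𝔖
  have hsrkH : Ordinal.lift.{u} (srk H) < Ordinal.lift.{u} l :=
    Ordinal.lift_lt.2 (((srk_le_rk H).trans hHrank.rk_le).trans_lt hι)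
  have hiota : ∀ n, iota (srk (fam n)) ≤ Ordinal.lift.{u} l := by
    intro n
    induction n with
    | zero =>
      refine iota_le ?_ hexp'
      change srk F₀ < _
      rw [hF₀srk, ← Ordinal.lift_omega0.{u, 0}, Ordinal.lift_lt]
      exact hω1.trans_lt hι
    | succ n ih =>
      rw [hsucc, (hB.mul_spec _ (hfamB n) _ hH𝔖).2.1]
      exact iota_le (hexp'.mul_lt ((iota_spec _).1.trans_le ih) hsrkH) hexp'
  have hhom : ∀ n, IsHomogeneous (fam n) := fun n => hB.homogeneous _ (hfamB n)
  refine ⟨{ fam := fam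
            fam_hereditary := fun n => (hhom n).hereditary
            singleton_mem := fun ξ => (hhom 0).singleton_mem hF₀srk ξ
            adm := H
            adm_hereditary := hgood.hereditary
            empty_mem_adm := hgood.empty_mem }, ⟨?_, hgood.spreads, ?_⟩, hHrank, ?_, φ, hφ, hφS⟩
  · intro n s hs
    exact (hB.mul_spec _ (hfamB n) _ hH𝔖).2.2 s hs (isChain_of_trichotomous _)
  · intro n
    obtain ⟨s, hs, rfl⟩ := (hS.secRankGE hα1).exists_card (n := n)
      ((Ordinal.natCast_lt_omega0 n).le.trans hω1)
    exact ⟨_, hφS s hs, Finset.card_image_of_injective s hφ.injective⟩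
  · intro n
    have hcomp : IsCompactFamily (fam n) := by
      obtain ⟨α, h, -⟩ := hhom n
      exact h
    obtain ⟨ρ, hρ, hρ'⟩ := Ordinal.lt_lift_iff.1 ((hhom n).rk_lt.trans_le (hiota n))
    refine ⟨ρ, hρ, RankLE.of_lift.{u} ?_⟩
    rw [hρ']
    exact @IsCompactFamily.rankLE_link _ (fun _ _ => Classical.propDecidable _) _ hcomp

theorem IsSchreierSequence.secRankGE_iota {S : Ordinal.{0} → Set (Finset ℕ)}
    (hS : IsSchreierSequence S) {α β : Ordinal.{0}} (hβ : iota (ω ^ α) + α * ω ≤ β)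
    (hβ1 : β < ω_ 1) : SecRankGE (iota (ω ^ α) * ω ^ (α * ω)) (S β) := by
  refine (hS.secRankGE hβ1).mono ?_ subset_rfl
  refine le_trans ?_ (Ordinal.opow_le_opow_right Ordinal.omega0_pos hβ)
  rw [Ordinal.opow_add]
  exact mul_le_mul_left (Ordinal.right_le_opow _ Ordinal.one_lt_omega0) _

/-- The space of index `α` contains no bounded sequence with a lower `ℓ₁`-estimate on a family of
rank `ι(ω ^ α) * ω ^ (α * ω)`. -/
theorem TsData.IsTsirelson.not_lowerEstimate {I : Type u} {d : TsData I}
    {S : Ordinal.{0} → Set (Finset ℕ)} {α : Ordinal.{0}} (hd : d.IsTsirelson S α) (hα : 1 ≤ α)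
    {F : Set (Finset ℕ)} (hF : SecRankGE (iota (ω ^ α) * ω ^ (α * ω)) F) (y : ℕ → C00 d) (K c : ℝ)
    (hy : ∀ k, ‖y k‖ ≤ K) (hc : 0 < c) : ¬ LowerEstimate F c y := by
  obtain ⟨h1, h2⟩ := iota_spec (ω ^ α)
  refine C00.not_lowerEstimate h2 (lt_of_le_of_lt ?_ h1) hα hd.rankLE_fam hd.secRankLE_adm hF hy hc
  nth_rewrite 1 [← Ordinal.opow_one ω]
  exact Ordinal.opow_le_opow_right Ordinal.omega0_pos hα

/-- If bounded sequences without convergent subsequences have subsequences with a lower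
`ℓ₁`-estimate on `F` in `Y`, and no sequence has one in `X`, then the spaces are totally
incomparable. -/
theorem totallyIncomparable_of_lowerEstimate {X Y : Type u} [NormedAddCommGroup X]
    [NormedSpace ℝ X] [NormedAddCommGroup Y] [NormedSpace ℝ Y] [CompleteSpace Y]
    {F : Set (Finset ℕ)}
    (hX : ∀ (x : ℕ → X) (K c : ℝ), (∀ n, ‖x n‖ ≤ K) → 0 < c → ¬ LowerEstimate F c x)
    (hY : ∀ (y : ℕ → Y) (K : ℝ), (∀ n, ‖y n‖ ≤ K) → IsNontrivialSeq y →
      ∃ φ : ℕ → ℕ, StrictMono φ ∧ ∃ c, 0 < c ∧ LowerEstimate F c (y ∘ φ)) :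
    TotallyIncomparable X Y := by
  refine fun V W hV => ⟨fun T => ?_⟩
  obtain ⟨R, v, -, hvR, hv⟩ := exists_seq_norm_le_one_le_norm_sub hV
  set M : ℝ := ‖(T : V →L[ℝ] W)‖ + 1
  have hM : 0 < M := by positivity
  have hT : ∀ x, ‖T x‖ ≤ M * ‖x‖ := fun x =>
    ((T : V →L[ℝ] W).le_opNorm x).trans (by gcongr; simp [M])
  have hnt : IsNontrivialSeq fun n => (T (v n) : Y) := by
    rintro φ hφ ⟨z, hz⟩
    set M' : ℝ := ‖(T.symm : W →L[ℝ] V)‖ + 1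
    have hM' : 0 < M' := by positivity
    obtain ⟨N, hN⟩ := Metric.cauchySeq_iff'.1 hz.cauchySeq M'⁻¹ (by positivity)
    have h1 := hN (N + 1) (Nat.le_succ N)
    rw [dist_eq_norm] at h1
    have h2 : ‖T (v (φ (N + 1))) - T (v (φ N))‖ < M'⁻¹ := h1
    have h3 := (T.symm : W →L[ℝ] V).le_opNorm (T (v (φ (N + 1))) - T (v (φ N)))
    rw [← map_sub] at h2 h3
    have h4 : (T.symm : W →L[ℝ] V) (T (v (φ (N + 1)) - v (φ N))) = v (φ (N + 1)) - v (φ N) :=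
      T.symm_apply_apply _
    rw [h4] at h3
    have h5 := hv (hφ (Nat.lt_succ_self N)).ne'
    have h6 : M' * ‖T (v (φ (N + 1)) - v (φ N))‖ < 1 := by
      rwa [← lt_inv_mul_iff₀ hM', mul_one]
    have h7 := norm_nonneg (T (v (φ (N + 1)) - v (φ N)))
    simp only [M'] at h6
    linarith
  obtain ⟨φ, hφ, c, hc, hest⟩ := hY _ (M * R) (fun n =>
    (hT _).trans (mul_le_mul_of_nonneg_left (hvR n) hM.le)) hnt
  have h4 : LowerEstimate F (c / M) (v ∘ φ) :=
    LowerEstimate.of_map (W.subtype ∘ₗ (T : V →L[ℝ] W).toLinearMap) hM hT hest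
  exact hX (fun n => (v (φ n) : X)) R (c / M) (fun n => hvR _) (by positivity)
    fun s hs a => by
      have := h4 s hs a
      rw [← Submodule.norm_coe] at this
      simpa using this

end LongTsirelson

theorem mainTheorem3 (κ : Cardinal.{u}) (hκ : HasBasisOfFamilies κ)
    (S : Ordinal.{0} → Set (Finset ℕ)) (hS : IsSchreierSequence S) :
    ∃ (𝔛 : Ordinal.{0} → Type u) (_ : ∀ α, NormedAddCommGroup (𝔛 α))
      (_ : ∀ α, NormedSpace ℝ (𝔛 α)),
      (∀ α : Ordinal.{0}, 1 ≤ α → α < ω_ 1 →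
        CompleteSpace (𝔛 α) ∧ IsReflexiveSpace (𝔛 α) ∧ densityCharacter (𝔛 α) = κ ∧
        Nonempty (UnconditionalSchauderBasis κ.ord.ToType ℝ (𝔛 α)) ∧
        (∀ x : ℕ → 𝔛 α, (∃ K : ℝ, ∀ n, ‖x n‖ ≤ K) → IsNontrivialSeq x →
          ∃ φ : ℕ → ℕ, StrictMono φ ∧ IsL1SpreadingModel (S α) (x ∘ φ)) ∧
        (∀ x : ℕ → 𝔛 α, ¬ IsL1SpreadingModel (S (iota (ω ^ α) + α * ω)) x) ∧
        (∀ x : ℕ → 𝔛 α, ¬ IsSubsymmetric x)) ∧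
      (∀ α β : Ordinal.{0}, 1 ≤ α → α < ω_ 1 → β < ω_ 1 → iota (ω ^ α) + α * ω ≤ β →
        TotallyIncomparable (𝔛 α) (𝔛 β)) := by
  obtain ⟨C, hC, -⟩ := hκ.1
  have hinf : Infinite κ.ord.ToType := infinite_univ_iff.1 (hC.mono (subset_univ C))
  have hdata : ∀ α : Ordinal.{0}, ∃ d : TsData κ.ord.ToType,
      1 ≤ α → α < ω_ 1 → d.IsTsirelson S α := by
    intro α
    by_cases h : 1 ≤ α ∧ α < ω_ 1
    · obtain ⟨d, hd⟩ := exists_isTsirelson hκ hS h.1 h.2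
      exact ⟨d, fun _ _ => hd⟩
    · obtain ⟨d, -⟩ := exists_isTsirelson hκ hS le_rfl
        (Ordinal.one_lt_omega0.trans Ordinal.omega0_lt_omega_one)
      exact ⟨d, fun h1 h2 => absurd ⟨h1, h2⟩ h⟩
  choose d hd using hdata
  -- the estimates on the admissible sets, transported to the Schreier family
  have hest : ∀ α : Ordinal.{0}, 1 ≤ α → α < ω_ 1 → ∀ (x : ℕ → Space (d α)) (K : ℝ),
      (∀ n, ‖x n‖ ≤ K) → IsNontrivialSeq x →
      ∃ φ : ℕ → ℕ, StrictMono φ ∧ ∃ c, 0 < c ∧ LowerEstimate (S α) c (x ∘ φ) := by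
    intro α hα hα1 x K hK hx
    obtain ⟨φ, hφ, c, hc, h⟩ := Space.exists_lowerEstimate (hd α hα hα1).multiplicative hK hx
    obtain ⟨ψ, hψ, hψS⟩ := (hd α hα hα1).exists_image_mem
    exact ⟨φ ∘ ψ, hφ.comp hψ, c, hc, h.comp hψ.injective hψS⟩
  refine ⟨fun α => Space (d α), fun α => inferInstance, fun α => inferInstance,
    fun α hα hα1 => ?_, fun α β hα hα1 hβ1 hαβ => ?_⟩
  · have hβ1 : iota (ω ^ α) + α * ω < ω_ 1 := by
      obtain ⟨h1, h2⟩ := exists_opow_lt_omega_one hα1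
      exact Ordinal.isPrincipal_add_omega 1 (iota_lt_omega_one h1) h2
    have hno := fun (F : Set (Finset ℕ)) (hF : S (iota (ω ^ α) + α * ω) ⊆ F) =>
      (hd α hα hα1).not_lowerEstimate hα ((hS.secRankGE_iota le_rfl hβ1).mono le_rfl hF)
    refine ⟨inferInstance, Space.isReflexiveSpace (hd α hα hα1).multiplicative
      (hno univ (subset_univ _)), ?_, ⟨Space.schauderBasis (d α)⟩, ?_, ?_,
      Space.not_isSubsymmetric (hd α hα hα1).multiplicative (hno univ (subset_univ _))⟩
    · rw [Space.densityCharacter_eq, Cardinal.mk_ord_toType]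
    · rintro x ⟨K, hK⟩ hx
      obtain ⟨φ, hφ, c, hc, h⟩ := hest α hα hα1 x K hK hx
      exact ⟨φ, hφ, ⟨K, fun n => hK _⟩, c, hc, h⟩
    · rintro x ⟨⟨K, hK⟩, c, hc, h⟩
      exact Space.not_lowerEstimate (hno _ subset_rfl) hK hc h
  · have hβ : 1 ≤ β := by
      refine le_trans ?_ (le_self_add.trans hαβ)
      exact Order.one_le_iff_pos.2 ((zero_le (a := _)).trans_lt (iota_spec (ω ^ α)).1)
    exact totallyIncomparable_of_lowerEstimate
      (fun x K c hK hc => Space.not_lowerEstimate ((hd α hα hα1).not_lowerEstimate hα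
        (hS.secRankGE_iota hαβ hβ1)) hK hc) (hest β hβ hβ1)
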